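/- Let $\Gamma$ be the chain of rings of circumference $2\pi$ touching at the vertices $j\pi$, $j\in\mathbb Z$: the $j$-th ring consists of an upper and a lower edge, both parametrized by $[j\pi,(j+1)\pi]$, and $L^2(\Gamma)=L^2(\mathbb R)\oplus L^2(\mathbb R)$. For $A\in\mathbb R$ and real coupling constants $\boldsymbol\alpha=(\alpha_j)_{j\in\mathbb Z}$ let $-\Delta_{\boldsymbol\alpha}$ be the operator in $L^2(\Gamma)$ that acts as $-\mathcal D^2$ on each edge, with $\mathcal D=\frac{d}{dx}+iA$ on the upper and $\mathcal D=\frac{d}{dx}-iA$ on the lower edges. Its domain consists of all functions in $L^2(\Gamma)$ whose restrictions $\psi_j$ (upper) and $\varphi_j$ (lower) to the edges belong to $H^2$, for which $\mathcal D^2$ yields a function in $L^2(\Gamma)$, and which satisfy, for all $j\in\mathbb Z$, $$\psi_j(j\pi)=\varphi_j(j\pi)=\psi_{j-1}(j\pi)=\varphi_{j-1}(j\pi),$$ $$\mathcal D\psi_j(j\pi)+\mathcal D\varphi_j(j\pi)-\mathcal D\psi_{j-1}(j\pi)-\mathcal D\varphi_{j-1}(j\pi)=\alpha_j\psi_j(j\pi).$$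 Fix $\alpha,\gamma_1,\gamma_2\in\mathbb R$. Let $-\Delta_\alpha$ be the operator with $\alpha_j=\alpha$ for all $j$, and for $n\in\mathbb N$ let $-\Delta_{\alpha,n}$ be the operator in which the coupling constants at two vertices $p\pi$ and $(p+n+1)\pi$, with exactly $n$ vertices between them, are changed into $\alpha+\gamma_1$ and $\alpha+\gamma_2$, respectively. A gap is a connected component of $\mathbb R\setminus\sigma_{\mathrm{ess}}(-\Delta_\alpha)$; gaps are counted from the left, the first one being the unbounded interval below $\sigma_{\mathrm{ess}}(-\Delta_\alpha)$. Theorem. Suppose that $A\notin\mathbb Z$. (i) For every $n$, $\sigma_{\mathrm{ess}}(-\Delta_{\alpha,n})=\sigma_{\mathrm{ess}}(-\Delta_\alpha)$. (ii) If $\gamma_1\gamma_2<0$, then for every gap there is an $n_0$ such that for all $n\ge n_0$ the operator $-\Delta_{\alpha,n}$ has exactly one eigenvalue in this gap, and it is simple. (iii) If $\gamma_1,\gamma_2>0$ (respectively, $\gamma_1,\gamma_2<0$), then for every even (respectively, odd) gap there is an $n_0$ such that for all $n\ge n_0$ the operator $-\Delta_{\alpha,n}$ has exactly two eigenvalues in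 this gap, both simple; the only exception is the case when $A-\frac12\in\mathbb Z$ and $\gamma_1=\gamma_2$, in which there is exactly one eigenvalue in the gap and it has multiplicity two. Moreover, for all sufficiently large $n$ there are no eigenvalues of $-\Delta_{\alpha,n}$ in any odd (respectively, even) gap. (iv) If $\gamma_1=\gamma_2\neq0$, then for every gap there are constants $C,c>0$ and an $n_0$ such that for all $n\ge n_0$ any two eigenvalues $E,E'$ of $-\Delta_{\alpha,n}$ in this gap satisfy $|E-E'|\le C e^{-cn}$. The numbers $n_0$, $C$, $c$ do not depend on the position $p$. -/

import Mathlib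

open MeasureTheory Filter Set
open scoped Real

noncomputable section

namespace RingChain

/-- The state space `L²(Γ)` of the ring chain: two copies of `L²(ℝ)`, component `0` for the upper
and component `1` for the lower semicircles. The `j`-th ring (`j : ℤ`) is parametrized by
`[jπ, (j+1)π]` on both components, its vertices are the points `jπ` and `(j+1)π`. -/
abbrev State : Type := PiLp 2 (fun _ : Fin 2 => Lp ℂ 2 (volume : Measure ℝ))

/-- The sign of the vector potential is opposite on the upper and the lower semicircles:
`𝒟 = d/dx + iA` on the upper ones and `𝒟 = d/dx - iA` on the lower ones. -/
def potential (A : ℝ) (σ : Fin 2) : ℝ := if σ = 0 then A else -A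

/-- `f` is (the continuous representative of) an element of the Sobolev space `H¹(a, b)` and
`g = f' + iBf` is its quasiderivative, where `f'` is the weak derivative. -/
structure IsQuasiDeriv (B a b : ℝ) (f g : ℝ → ℂ) : Prop where
  continuousOn : ContinuousOn f (Icc a b)
  memLp : MemLp g 2 (volume.restrict (Ioo a b))
  eq_integral : ∀ x ∈ Icc a b, f x = f a + ∫ t in a..x, (g t - Complex.I * B * f t)

/-- The functions `f σ j`, with quasiderivatives `g σ j`, are the `H²` components of the state `u`
on the edges; they satisfy the `δ`-coupling with coupling constant `α j` at each vertex `jπ`, and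
`-𝒟²u = v`. -/
structure IsComponents (A : ℝ) (α : ℤ → ℝ) (u v : State) (f g : Fin 2 → ℤ → ℝ → ℂ) : Prop where
  ae_eq : ∀ σ (j : ℤ), f σ j =ᵐ[volume.restrict (Ioo (j * π) ((j + 1) * π))] u σ
  deriv_one : ∀ σ (j : ℤ), IsQuasiDeriv (potential A σ) (j * π) ((j + 1) * π) (f σ j) (g σ j)
  deriv_two : ∀ σ (j : ℤ),
    IsQuasiDeriv (potential A σ) (j * π) ((j + 1) * π) (g σ j) (fun x => -(v σ x))
  continuity : ∀ j : ℤ, f 1 j (j * π) = f 0 j (j * π) ∧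
    f 0 (j - 1) (j * π) = f 0 j (j * π) ∧ f 1 (j - 1) (j * π) = f 0 j (j * π)
  delta : ∀ j : ℤ, g 0 j (j * π) + g 1 j (j * π) - g 0 (j - 1) (j * π) - g 1 (j - 1) (j * π)
    = α j * f 0 j (j * π)

theorem IsQuasiDeriv.intervalIntegrable {B a b : ℝ} {f g : ℝ → ℂ} (h : IsQuasiDeriv B a b f g)
    (hab : a ≤ b) : IntervalIntegrable (fun t => g t - Complex.I * B * f t) volume a b := by
  have hg : IntervalIntegrable g volume a b := by
    rw [intervalIntegrable_iff_integrableOn_Ioo_of_le hab]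
    exact h.memLp.integrable (by norm_num)
  have hf : IntervalIntegrable f volume a b :=
    ContinuousOn.intervalIntegrable (by rw [uIcc_of_le hab]; exact h.continuousOn)
  exact hg.sub (hf.const_mul _)

theorem IsQuasiDeriv.add {B a b : ℝ} {f g f' g' : ℝ → ℂ} (h : IsQuasiDeriv B a b f g)
    (h' : IsQuasiDeriv B a b f' g') : IsQuasiDeriv B a b (f + f') (g + g') where
  continuousOn := h.continuousOn.add h'.continuousOn
  memLp := h.memLp.add h'.memLp
  eq_integral x hx := by
    have hs : uIcc a x ⊆ uIcc a b := by
      rw [uIcc_of_le hx.1, uIcc_of_le (hx.1.trans hx.2)]; exact Icc_subset_Icc_right hx.2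
    have hi := (h.intervalIntegrable (hx.1.trans hx.2)).mono_set hs
    have hi' := (h'.intervalIntegrable (hx.1.trans hx.2)).mono_set hs
    have := intervalIntegral.integral_add hi hi'
    simp only [Pi.add_apply]
    rw [h.eq_integral x hx, h'.eq_integral x hx]
    rw [show (∫ t in a..x, (g t + g' t - Complex.I * B * (f t + f' t)))
      = ∫ t in a..x, ((g t - Complex.I * B * f t) + (g' t - Complex.I * B * f' t)) from by
        congr 1; ext t; ring, this]
    ring

theorem IsQuasiDeriv.smul {B a b : ℝ} {f g : ℝ → ℂ} (c : ℂ) (h : IsQuasiDeriv B a b f g) :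
    IsQuasiDeriv B a b (c • f) (c • g) where
  continuousOn := h.continuousOn.const_smul c
  memLp := h.memLp.const_smul c
  eq_integral x hx := by
    simp only [Pi.smul_apply, smul_eq_mul]
    rw [h.eq_integral x hx, show (∫ t in a..x, (c * g t - Complex.I * B * (c * f t)))
      = ∫ t in a..x, c * (g t - Complex.I * B * f t) from by congr 1; ext t; ring,
      intervalIntegral.integral_const_mul]
    ring

theorem IsQuasiDeriv.congr {B a b : ℝ} {f g g' : ℝ → ℂ} (h : IsQuasiDeriv B a b f g)
    (hg : g =ᵐ[volume.restrict (Ioo a b)] g') : IsQuasiDeriv B a b f g' where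
  continuousOn := h.continuousOn
  memLp := h.memLp.ae_eq hg
  eq_integral x hx := by
    rw [h.eq_integral x hx]
    congr 1
    rw [intervalIntegral.integral_of_le hx.1, intervalIntegral.integral_of_le hx.1,
      ← restrict_Ioo_eq_restrict_Ioc]
    apply integral_congr_ae
    have := ae_mono (Measure.restrict_mono (Ioo_subset_Ioo_right hx.2) le_rfl) hg
    filter_upwards [this] with t ht
    rw [ht]

/-- The weak derivative is unique. -/
theorem IsQuasiDeriv.ae_eq_zero {B a b : ℝ} {f g : ℝ → ℂ} (h : IsQuasiDeriv B a b f g)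
    (hab : a < b) (hf : f =ᵐ[volume.restrict (Ioo a b)] 0) :
    (∀ x ∈ Icc a b, f x = 0) ∧ g =ᵐ[volume.restrict (Ioo a b)] 0 := by
  have hf' : f =ᵐ[volume.restrict (Icc a b)] fun _ => 0 := by
    rw [← restrict_Ioo_eq_restrict_Icc]; exact hf
  have h0 : ∀ x ∈ Icc a b, f x = 0 :=
    Measure.eqOn_Icc_of_ae_eq volume hab.ne hf' h.continuousOn continuousOn_const
  refine ⟨h0, ?_⟩
  have hint : ∀ x ∈ Icc a b, ∫ t in a..x, (g t - Complex.I * B * f t) = 0 := by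
    intro x hx
    have := h.eq_integral x hx
    rw [h0 x hx, h0 a (left_mem_Icc.2 hab.le)] at this
    simpa using this.symm
  have hd := (h.intervalIntegrable hab.le).ae_hasDerivAt_integral
  rw [Filter.EventuallyEq, ae_restrict_iff' measurableSet_Ioo]
  filter_upwards [hd] with x hx hxI
  have hxI' := Ioo_subset_Icc_self hxI
  have h1 := hx (by rw [uIcc_of_le hab.le]; exact hxI') a (by simp)
  have h2 : HasDerivAt (fun _ : ℝ => (0 : ℂ)) (g x - Complex.I * B * f x) x := by
    refine h1.congr_of_eventuallyEq ?_
    filter_upwards [Ioo_mem_nhds hxI.1 hxI.2] with y hy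
    exact (hint y (Ioo_subset_Icc_self hy)).symm
  have h3 := h2.unique (hasDerivAt_const x (0 : ℂ))
  rw [h0 x hxI'] at h3
  simpa using h3

/-- The graph of the Hamiltonian: all pairs `(u, -𝒟²u)` with `u ∈ L²(Γ)` edgewise in `H²`, with
`-𝒟²u ∈ L²(Γ)`, and satisfying the `δ`-coupling conditions. -/
def hamiltonianGraph (A : ℝ) (α : ℤ → ℝ) : Submodule ℂ (State × State) where
  carrier := {p | ∃ f g, IsComponents A α p.1 p.2 f g}
  zero_mem' := by
    have hz : ∀ B a b : ℝ, IsQuasiDeriv B a b 0 0 := fun B a b =>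
      ⟨continuousOn_const, MemLp.zero, fun x _ => by simp⟩
    have h0 : ∀ s : Set ℝ, (0 : ℝ → ℂ) =ᵐ[volume.restrict s] (0 : Lp ℂ 2 (volume : Measure ℝ)) :=
      fun s => ae_restrict_of_ae (Lp.coeFn_zero ℂ 2 volume).symm
    refine ⟨0, 0, fun σ j => h0 _, fun σ j => hz _ _ _, fun σ j => ?_, by simp, by simp⟩
    refine (hz _ _ _).congr ?_
    filter_upwards [h0 (Ioo ((j : ℝ) * π) ((j + 1) * π))] with x hx
    simp
  add_mem' := by
    rintro p q ⟨f, g, h⟩ ⟨f', g', h'⟩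
    refine ⟨f + f', g + g', fun σ j => ?_, fun σ j => (h.deriv_one σ j).add (h'.deriv_one σ j),
      fun σ j => ((h.deriv_two σ j).add (h'.deriv_two σ j)).congr ?_, fun j => ?_, fun j => ?_⟩
    · filter_upwards [h.ae_eq σ j, h'.ae_eq σ j,
        ae_restrict_of_ae (Lp.coeFn_add (p.1 σ) (q.1 σ))] with x h1 h2 h3
      simp only [Prod.fst_add, PiLp.add_apply, Pi.add_apply] at h3 ⊢
      rw [h1, h2, h3]
    · filter_upwards [ae_restrict_of_ae (Lp.coeFn_add (p.2 σ) (q.2 σ))] with x h3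
      simp only [Prod.snd_add, PiLp.add_apply, Pi.add_apply] at h3 ⊢
      rw [h3]; ring
    · obtain ⟨h1, h2, h3⟩ := h.continuity j
      obtain ⟨h1', h2', h3'⟩ := h'.continuity j
      simp only [Pi.add_apply]
      exact ⟨by rw [h1, h1'], by rw [h2, h2'], by rw [h3, h3']⟩
    · have h1 := h.delta j
      have h2 := h'.delta j
      simp only [Pi.add_apply]
      linear_combination h1 + h2
  smul_mem' := by
    rintro c p ⟨f, g, h⟩
    refine ⟨c • f, c • g, fun σ j => ?_, fun σ j => (h.deriv_one σ j).smul c,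
      fun σ j => ((h.deriv_two σ j).smul c).congr ?_, fun j => ?_, fun j => ?_⟩
    · filter_upwards [h.ae_eq σ j, ae_restrict_of_ae (Lp.coeFn_smul c (p.1 σ))] with x h1 h3
      simp only [Prod.smul_fst, PiLp.smul_apply, Pi.smul_apply] at h3 ⊢
      rw [h1, h3]
    · filter_upwards [ae_restrict_of_ae (Lp.coeFn_smul c (p.2 σ))] with x h3
      simp only [Prod.smul_snd, PiLp.smul_apply, Pi.smul_apply] at h3 ⊢
      rw [h3]; simp
    · obtain ⟨h1, h2, h3⟩ := h.continuity j
      simp only [Pi.smul_apply]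
      exact ⟨by rw [h1], by rw [h2], by rw [h3]⟩
    · have h1 := h.delta j
      simp only [Pi.smul_apply, smul_eq_mul]
      linear_combination c * h1

/-- The magnetic Hamiltonian `-Δ_α` of the ring chain with vector potential `A` and `δ`-couplings
of strength `α j` at the vertices `jπ`, as an unbounded operator in `L²(Γ)`. -/
def hamiltonian (A : ℝ) (α : ℤ → ℝ) : State →ₗ.[ℂ] State :=
  (hamiltonianGraph A α).toLinearPMap

/-- `-𝒟²u` is determined by `u`, so that `hamiltonianGraph` is indeed the graph of the operator. -/
theorem hamiltonian_graph (A : ℝ) (α : ℤ → ℝ) :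
    (hamiltonian A α).graph = hamiltonianGraph A α := by
  refine Submodule.toLinearPMap_graph_eq _ ?_
  rintro ⟨u, v⟩ ⟨f, g, h⟩ (rfl : u = 0)
  have hlt : ∀ j : ℤ, (j : ℝ) * π < (j + 1) * π := fun j => by nlinarith [Real.pi_pos]
  have key : ∀ σ, ∀ j : ℤ,
      ∀ᵐ x ∂(volume.restrict (Ioo ((j : ℝ) * π) ((j + 1) * π))), v σ x = 0 := by
    intro σ j
    have h1 : f σ j =ᵐ[volume.restrict (Ioo ((j : ℝ) * π) ((j + 1) * π))] 0 :=
      (h.ae_eq σ j).trans (ae_restrict_of_ae (Lp.coeFn_zero ℂ 2 volume))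
    have h2 := ((h.deriv_one σ j).ae_eq_zero (hlt j) h1).2
    have h3 := ((h.deriv_two σ j).ae_eq_zero (hlt j) h2).2
    filter_upwards [h3] with x hx
    simpa using hx
  change v = 0
  ext1 σ
  refine (Lp.eq_zero_iff_ae_eq_zero).2 ?_
  have hU : (⋃ j : ℤ, Icc ((j : ℝ) * π) ((j + 1) * π)) = univ := by
    have := iUnion_Icc_zsmul Real.pi_pos
    simpa using this
  have hall : ∀ᵐ x ∂((volume : Measure ℝ).restrict univ), v σ x = 0 := by
    rw [← hU]
    refine (ae_restrict_iUnion_iff _ _).2 fun j => ?_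
    rw [← restrict_Ioo_eq_restrict_Icc]
    exact key σ j
  rw [Measure.restrict_univ] at hall
  exact hall

/-- The restriction of `T - E` to a linear map on the domain of `T`. -/
def shifted (T : State →ₗ.[ℂ] State) (E : ℝ) : T.domain →ₗ[ℂ] State :=
  T.toFun - (E : ℂ) • T.domain.subtype

/-- The multiplicity of `E` as an eigenvalue of `T`, `0` if `E` is not an eigenvalue. -/
def multiplicity (T : State →ₗ.[ℂ] State) (E : ℝ) : Cardinal :=
  Module.rank ℂ (LinearMap.ker (shifted T E))

/-- The real eigenvalues of `T`. -/
def eigenvalues (T : State →ₗ.[ℂ] State) : Set ℝ := {E | multiplicity T E ≠ 0}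

/-- The (real) essential spectrum of a closed operator `T`: those `E` for which `T - E` is not
Fredholm, that is, does not have both a finite-dimensional kernel and a range of finite
codimension. For a self-adjoint operator these are the points of the spectrum that are not isolated
eigenvalues of finite multiplicity. -/
def essentialSpectrum (T : State →ₗ.[ℂ] State) : Set ℝ :=
  {E | ¬ (FiniteDimensional ℂ (LinearMap.ker (shifted T E)) ∧
    FiniteDimensional ℂ (State ⧸ LinearMap.range (shifted T E)))}

/-- The gaps of a subset `S` of the line are the connected components of its complement. -/
def IsGap (S I : Set ℝ) : Prop := ∃ x ∈ Sᶜ, I = connectedComponentIn Sᶜ x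

/-- `I` is the `m`-th gap of `S`, counted from the left, the leftmost gap being the first. -/
def IsNthGap (S : Set ℝ) (m : ℕ) (I : Set ℝ) : Prop :=
  IsGap S I ∧ {J | IsGap S J ∧ J ≠ I ∧ ∀ x ∈ J, ∀ y ∈ I, x < y}.encard + 1 = m

/-- The coupling constants of the chain with two impurities, of strengths `γ₁` and `γ₂`, at two
vertices with exactly `n` vertices between them, the first of them being the vertex `pπ`. -/
def distantImpurities (α γ₁ γ₂ : ℝ) (p : ℤ) (n : ℕ) (j : ℤ) : ℝ :=
  if j = p then α + γ₁ else if j = p + n + 1 then α + γ₂ else α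

/-- The periodic Hamiltonian `-Δ_α`. -/
def periodicHamiltonian (A α : ℝ) : State →ₗ.[ℂ] State := hamiltonian A (fun _ => α)

/-- The Hamiltonian `-Δ_{α,n}` with two distant impurities. -/
def impurityHamiltonian (A α γ₁ γ₂ : ℝ) (p : ℤ) (n : ℕ) : State →ₗ.[ℂ] State :=
  hamiltonian A (distantImpurities α γ₁ γ₂ p n)

/-- `T` has exactly `N` eigenvalues in `I` and all of them are simple. -/
def HasSimpleEigenvalues (T : State →ₗ.[ℂ] State) (I : Set ℝ) (N : ℕ) : Prop :=
  (eigenvalues T ∩ I).encard = N ∧ ∀ E ∈ eigenvalues T ∩ I, multiplicity T E = 1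

/-- `T` has exactly one eigenvalue in `I` and it has multiplicity two. -/
def HasDoubleEigenvalue (T : State →ₗ.[ℂ] State) (I : Set ℝ) : Prop :=
  ∃ E, eigenvalues T ∩ I = {E} ∧ multiplicity T E = 2

/-- For all large `n`, the Hamiltonian `-Δ_{α,n}` has exactly two eigenvalues in `I`, both simple.
If `A - 1/2` is an integer and `γ₁ = γ₂`, the two eigenvalues merge into one double eigenvalue. -/
def EventuallyTwoEigenvalues (A α γ₁ γ₂ : ℝ) (I : Set ℝ) : Prop :=
  ∀ᶠ n : ℕ in atTop, ∀ p : ℤ,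
    (¬ ((∃ m : ℤ, A - 1 / 2 = m) ∧ γ₁ = γ₂) →
      HasSimpleEigenvalues (impurityHamiltonian A α γ₁ γ₂ p n) I 2) ∧
    ((∃ m : ℤ, A - 1 / 2 = m) ∧ γ₁ = γ₂ →
      HasDoubleEigenvalue (impurityHamiltonian A α γ₁ γ₂ p n) I)

end RingChain

end

/-! Let C and S be the values at π of the solutions of -y'' = Ey with Cauchy data (1, 0) and (0, 1),
and put c = cos(Aπ), η = C + αS/4. If S ≠ 0, a solution of -𝒟²u = Eu + w is determined by its vertex
values φ_j, and the δ-conditions become the difference equation 2c(φ_{j+1} + φ_{j-1}) - (4C + α_j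
S)φ_j = F_j in ℓ²(ℤ) (`solS_mul_delta`, `exists_mem_graph`). For constant couplings it is uniquely
solvable when |c| < |η|, by a Neumann series, and has a range of infinite codimension when |η| ≤
|c|; where S = 0 there are infinitely many independent eigenfunctions supported by two neighbouring
rings. This gives `mem_essentialSpectrum_periodic`. The impurities do not affect the Fredholm
property: both operators agree on functions vanishing at the two vertices, a subspace of finite
codimension (`essentialSpectrum_congr`).

Put U = (η + c)/S and V = (η - c)/S. By half-angle formulas each is a constant plus a cotangent term
and minus a tangent term, with positive weights because |c| < 1 (`ratio_eq`). So both decrease from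
+∞ to -∞ between consecutive zeros of S, and also on the leftmost interval (-∞, 1). Since |c| < |η|
means UV > 0, each interval contains one gap with U, V > 0 on its left and one with U, V < 0 on its
right. The former are the odd gaps, the latter the even ones.

In a gap the Green function of the difference operator is a multiple of λ^|j-q| with λ = (√|U| -
√|V|)/(√|U| + √|V|). An eigenfunction is determined by its values at the impurities, which solve a
2×2 linear system; its determinant vanishes iff (τ - a)(τ - b) = ab λ^(2(n+1)), where τ = 4√(UV), a
= -sγ₁, b = -sγ₂ and s is the sign of U (`multiplicity_impurityHamiltonian`). The position p does
not enter. Multiplicity two requires the matrix to vanish, that is λ = 0 and τ = a = b.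

Solving for τ gives τ = κ(|λ|^(n+1)) with two branches κ, whose values at 0 are a and b. As τ > 0 is
strictly monotone with range (0, ∞) and |λ|^(n+1) is exponentially small on compact parts of the
gap, each branch positive at 0 should contribute exactly one eigenvalue, and the others none. The
delicate place is the band edge, where τ → 0 and |λ| may tend to 1; there κ(Λ) ≥ k(1 - Λ) and 1 -
|λ| ≥ const·τ exclude further solutions (`IsDescendingPair.existsUnique`). If a = b, both branches
have the same value at 0, whence the exponential closeness. -/

noncomputable section

namespace RingChain

/-! ### The entire functions `cos √z` and `sin √z / √z` -/

/-- The entire function `z ↦ cos √z`. -/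
def cosSqrt : ℝ → ℝ :=
  FormalMultilinearSeries.ofScalarsSum (fun n : ℕ => ((-1) ^ n / (2 * n).factorial : ℝ))

/-- The entire function `z ↦ sin √z / √z`. -/
def sincSqrt : ℝ → ℝ :=
  FormalMultilinearSeries.ofScalarsSum (fun n : ℕ => ((-1) ^ n / (2 * n + 1).factorial : ℝ))

theorem hasSum_cosSqrt_of_hasSum {z y : ℝ}
    (h : HasSum (fun n : ℕ => (-1 : ℝ) ^ n / (2 * n).factorial * z ^ n) y) : cosSqrt z = y := by
  rw [cosSqrt, FormalMultilinearSeries.ofScalarsSum_eq_tsum, ← h.tsum_eq]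
  simp

theorem hasSum_sincSqrt_of_hasSum {z y : ℝ}
    (h : HasSum (fun n : ℕ => (-1 : ℝ) ^ n / (2 * n + 1).factorial * z ^ n) y) :
    sincSqrt z = y := by
  rw [sincSqrt, FormalMultilinearSeries.ofScalarsSum_eq_tsum, ← h.tsum_eq]
  simp

theorem cosSqrt_sq (x : ℝ) : cosSqrt (x ^ 2) = Real.cos x := by
  refine hasSum_cosSqrt_of_hasSum ?_
  convert Real.hasSum_cos x using 2 with n
  rw [pow_mul]; ring

theorem cosSqrt_neg_sq (x : ℝ) : cosSqrt (-x ^ 2) = Real.cosh x := by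
  refine hasSum_cosSqrt_of_hasSum ?_
  convert Real.hasSum_cosh x using 2 with n
  rw [div_mul_eq_mul_div, ← mul_pow, pow_mul]; simp

theorem sincSqrt_zero : sincSqrt 0 = 1 := by
  simp [sincSqrt]

theorem mul_sincSqrt_sq (x : ℝ) : x * sincSqrt (x ^ 2) = Real.sin x := by
  rcases eq_or_ne x 0 with rfl | hx
  · simp
  rw [hasSum_sincSqrt_of_hasSum (y := x⁻¹ * Real.sin x), mul_inv_cancel_left₀ hx]
  refine Eq.mp (congrArg (fun g => HasSum g _) (funext fun n => ?_)) ((Real.hasSum_sin x).mul_left x⁻¹)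
  rw [pow_succ x, pow_mul]; field_simp

theorem mul_sincSqrt_neg_sq (x : ℝ) : x * sincSqrt (-x ^ 2) = Real.sinh x := by
  rcases eq_or_ne x 0 with rfl | hx
  · simp
  rw [hasSum_sincSqrt_of_hasSum (y := x⁻¹ * Real.sinh x), mul_inv_cancel_left₀ hx]
  refine Eq.mp (congrArg (fun g => HasSum g _) (funext fun n => ?_)) ((Real.hasSum_sinh x).mul_left x⁻¹)
  rw [div_mul_eq_mul_div, ← mul_pow, pow_succ x, pow_mul]; field_simp

theorem tendsto_two_mul_add_factorial (i : ℕ) :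
    Tendsto (fun n : ℕ => ‖((-1) ^ (n + 1) / (2 * (n + 1) + i).factorial : ℝ)‖ /
      ‖((-1) ^ n / (2 * n + i).factorial : ℝ)‖) atTop (nhds 0) := by
  refine squeeze_zero (fun n => by positivity) (g := fun n : ℕ => 1 / ((n : ℝ) + 1)) (fun n => ?_)
    tendsto_one_div_add_atTop_nhds_zero_nat
  simp only [norm_div, norm_pow, norm_neg, norm_one, one_pow, Real.norm_natCast]
  rw [show 2 * (n + 1) + i = (2 * n + i + 1) + 1 by ring, Nat.factorial_succ, Nat.factorial_succ]
  push_cast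
  have h1 : (0 : ℝ) < (2 * n + i).factorial := by exact_mod_cast Nat.factorial_pos _
  have h2 : (0 : ℝ) ≤ n := n.cast_nonneg
  have h3 : (0 : ℝ) ≤ i := i.cast_nonneg
  rw [div_div_div_cancel_left' _ _ one_ne_zero, div_le_div_iff₀ (by positivity) (by positivity),
    one_mul, ← mul_assoc, mul_comm (_ : ℝ) ((2 * n + i).factorial : ℝ)]
  refine mul_le_mul_of_nonneg_left ?_ h1.le
  nlinarith [mul_nonneg h2 h3, mul_nonneg h2 h2, mul_nonneg h3 h3]

/-- By the ratio test the power series has infinite radius of convergence, so its sum is analytic on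
the line. -/
theorem contDiff_ofScalarsSum_factorial (i : ℕ) : ContDiff ℝ 2
    (FormalMultilinearSeries.ofScalarsSum (E := ℝ)
      (fun n : ℕ => ((-1) ^ n / (2 * n + i).factorial : ℝ))) := by
  set c : ℕ → ℝ := fun n : ℕ => ((-1) ^ n / (2 * n + i).factorial : ℝ)
  have hr : (FormalMultilinearSeries.ofScalars ℝ c).radius = ⊤ := by
    refine FormalMultilinearSeries.ofScalars_radius_eq_top_of_tendsto (E := ℝ) c
      (Eventually.of_forall fun n => ?_) (tendsto_two_mul_add_factorial i)
    simp only [c]; positivity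
  have h := (FormalMultilinearSeries.ofScalars ℝ c).hasFPowerSeriesOnBall (by rw [hr]; simp)
  have h2 : AnalyticOnNhd ℝ (FormalMultilinearSeries.ofScalarsSum (E := ℝ) c) univ := by
    intro x _
    exact h.analyticOnNhd x (by rw [hr]; simp)
  exact contDiff_iff_contDiffAt.2 fun x => (h2 x trivial).contDiffAt

theorem contDiff_cosSqrt : ContDiff ℝ 2 cosSqrt := contDiff_ofScalarsSum_factorial 0

theorem contDiff_sincSqrt : ContDiff ℝ 2 sincSqrt := contDiff_ofScalarsSum_factorial 1

/-- Two continuous functions that agree on nonzero squares and their negatives are equal. -/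
theorem eq_of_eq_on_squares {f g : ℝ → ℝ} (hf : Continuous f) (hg : Continuous g)
    (h : ∀ x, x ≠ 0 → f (x ^ 2) = g (x ^ 2) ∧ f (-x ^ 2) = g (-x ^ 2)) (z : ℝ) : f z = g z := by
  have hd : Dense ({0}ᶜ : Set ℝ) := dense_compl_singleton 0
  refine congrFun (hf.ext_on hd hg fun w hw => ?_) z
  rcases lt_or_gt_of_ne (show w ≠ 0 from hw) with h0 | h0
  · have := (h (√(-w)) (Real.sqrt_ne_zero'.2 (by linarith))).2
    rwa [Real.sq_sqrt (by linarith), neg_neg] at this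
  · have := (h (√w) (Real.sqrt_ne_zero'.2 h0)).1
    rwa [Real.sq_sqrt h0.le] at this

theorem cosSqrt_sq_add (z : ℝ) : cosSqrt z ^ 2 + z * sincSqrt z ^ 2 = 1 := by
  have hc := contDiff_cosSqrt.continuous
  have hs := contDiff_sincSqrt.continuous
  refine eq_of_eq_on_squares (f := fun z => cosSqrt z ^ 2 + z * sincSqrt z ^ 2) (by fun_prop)
    continuous_const (fun x _ => ⟨?_, ?_⟩) z
  · have := mul_sincSqrt_sq x
    have h2 := Real.cos_sq_add_sin_sq x
    simp only [cosSqrt_sq]; rw [← this] at h2; linear_combination h2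
  · have := mul_sincSqrt_neg_sq x
    have h2 := Real.cosh_sq x
    simp only [cosSqrt_neg_sq]; rw [← this] at h2; linear_combination h2

theorem cosSqrt_mul_sincSqrt (z : ℝ) : cosSqrt z * sincSqrt z = sincSqrt (4 * z) := by
  have hc := contDiff_cosSqrt.continuous
  have hs := contDiff_sincSqrt.continuous
  refine eq_of_eq_on_squares (f := fun z => cosSqrt z * sincSqrt z) (g := fun z => sincSqrt (4 * z))
    (by fun_prop) (by fun_prop) (fun x hx => ⟨?_, ?_⟩) z
  · have h1 := mul_sincSqrt_sq x
    have h2 := mul_sincSqrt_sq (2 * x)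
    rw [Real.sin_two_mul, ← h1] at h2
    rw [show 4 * x ^ 2 = (2 * x) ^ 2 by ring, cosSqrt_sq]
    refine mul_left_cancel₀ (mul_ne_zero two_ne_zero hx) ?_
    rw [h2]; ring
  · have h1 := mul_sincSqrt_neg_sq x
    have h2 := mul_sincSqrt_neg_sq (2 * x)
    rw [Real.sinh_two_mul, ← h1] at h2
    rw [show 4 * -x ^ 2 = -(2 * x) ^ 2 by ring, cosSqrt_neg_sq]
    refine mul_left_cancel₀ (mul_ne_zero two_ne_zero hx) ?_
    rw [h2]; ring

theorem cosSqrt_four_mul (z : ℝ) : cosSqrt (4 * z) = 2 * cosSqrt z ^ 2 - 1 := by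
  have hc := contDiff_cosSqrt.continuous
  refine eq_of_eq_on_squares (f := fun z => cosSqrt (4 * z)) (g := fun z => 2 * cosSqrt z ^ 2 - 1)
    (by fun_prop) (by fun_prop) (fun x hx => ⟨?_, ?_⟩) z
  · rw [show 4 * x ^ 2 = (2 * x) ^ 2 by ring, cosSqrt_sq, cosSqrt_sq, Real.cos_two_mul]
  · rw [show 4 * -x ^ 2 = -(2 * x) ^ 2 by ring, cosSqrt_neg_sq, cosSqrt_neg_sq, Real.cosh_two_mul,
      Real.sinh_sq]
    ring

theorem differentiable_cosSqrt : Differentiable ℝ cosSqrt :=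
  contDiff_cosSqrt.differentiable (by norm_num)

theorem differentiable_sincSqrt : Differentiable ℝ sincSqrt :=
  contDiff_sincSqrt.differentiable (by norm_num)

theorem continuous_deriv_sincSqrt : Continuous (deriv sincSqrt) :=
  contDiff_sincSqrt.continuous_deriv (by norm_num)

/-- The chain rule for cos x = `cosSqrt (x ^ 2)` and cosh x = `cosSqrt (-x ^ 2)` gives the identity
at all z ≠ 0, and continuity gives it at 0. -/
theorem deriv_cosSqrt (z : ℝ) : deriv cosSqrt z = -(sincSqrt z / 2) := by
  have hs := contDiff_sincSqrt.continuous
  refine eq_of_eq_on_squares (f := deriv cosSqrt) (g := fun z => -(sincSqrt z / 2))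
    (contDiff_cosSqrt.continuous_deriv (by norm_num)) (by fun_prop) (fun x hx => ⟨?_, ?_⟩) z
  · have h1 : HasDerivAt (fun x => cosSqrt (x ^ 2)) _ x :=
      (differentiable_cosSqrt (x ^ 2)).hasDerivAt.comp x ((hasDerivAt_id x).pow 2)
    simp only [cosSqrt_sq] at h1
    have := h1.unique (Real.hasDerivAt_cos x)
    have h3 := mul_sincSqrt_sq x
    refine mul_left_cancel₀ (mul_ne_zero two_ne_zero hx) ?_
    simp at this
    linear_combination this + h3
  · have h1 : HasDerivAt (fun x => cosSqrt (-x ^ 2)) _ x :=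
      (differentiable_cosSqrt (-x ^ 2)).hasDerivAt.comp x (((hasDerivAt_id x).pow 2).neg)
    simp only [cosSqrt_neg_sq] at h1
    have := h1.unique (Real.hasDerivAt_cosh x)
    have h3 := mul_sincSqrt_neg_sq x
    refine mul_left_cancel₀ (mul_ne_zero two_ne_zero hx) ?_
    simp at this
    linear_combination -this + h3

theorem two_mul_mul_deriv_sincSqrt (z : ℝ) :
    2 * z * deriv sincSqrt z = cosSqrt z - sincSqrt z := by
  have hs := contDiff_sincSqrt.continuous
  have hc := contDiff_cosSqrt.continuous
  have hd := continuous_deriv_sincSqrt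
  refine eq_of_eq_on_squares (f := fun z => 2 * z * deriv sincSqrt z)
    (g := fun z => cosSqrt z - sincSqrt z) (by fun_prop) (by fun_prop) (fun x hx => ⟨?_, ?_⟩) z
  · have h1 : HasDerivAt (fun x => x * sincSqrt (x ^ 2)) _ x := (hasDerivAt_id x).mul
      ((differentiable_sincSqrt (x ^ 2)).hasDerivAt.comp x ((hasDerivAt_id x).pow 2))
    simp only [mul_sincSqrt_sq] at h1
    have := h1.unique (Real.hasDerivAt_sin x)
    simp only [cosSqrt_sq]
    simp at this
    linear_combination this
  · have h1 : HasDerivAt (fun x => x * sincSqrt (-x ^ 2)) _ x := (hasDerivAt_id x).mul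
      ((differentiable_sincSqrt (-x ^ 2)).hasDerivAt.comp x (((hasDerivAt_id x).pow 2).neg))
    simp only [mul_sincSqrt_neg_sq] at h1
    have := h1.unique (Real.hasDerivAt_sinh x)
    simp only [cosSqrt_neg_sq]
    simp at this
    linear_combination this

/-- The identity `two_mul_mul_deriv_sincSqrt` is void at 0. Differentiated once more there, it reads
2s'(0) = -1/2 - s'(0). -/
theorem deriv_sincSqrt_zero : deriv sincSqrt 0 = -1 / 6 := by
  have hd : Differentiable ℝ (deriv sincSqrt) := by
    have : ContDiff ℝ 1 (deriv sincSqrt) := by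
      have h2 : ContDiff ℝ (1 + 1) sincSqrt := contDiff_sincSqrt
      exact (contDiff_succ_iff_deriv.1 h2).2.2
    exact this.differentiable (by norm_num)
  have h1 : HasDerivAt (fun z => 2 * z * deriv sincSqrt z) _ 0 :=
    ((hasDerivAt_id (0 : ℝ)).const_mul 2).mul (hd 0).hasDerivAt
  have h2 : HasDerivAt (fun z => cosSqrt z - sincSqrt z) _ 0 :=
    (differentiable_cosSqrt 0).hasDerivAt.sub (differentiable_sincSqrt 0).hasDerivAt
  simp only [two_mul_mul_deriv_sincSqrt] at h1
  have := h1.unique h2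
  simp [deriv_cosSqrt, sincSqrt_zero] at this
  linarith

theorem hasDerivAt_cosSqrt (z : ℝ) : HasDerivAt cosSqrt (-(sincSqrt z / 2)) z := by
  rw [← deriv_cosSqrt]; exact (differentiable_cosSqrt z).hasDerivAt

theorem sincSqrt_lt_one {z : ℝ} (hz : 0 < z) : sincSqrt z < 1 := by
  have h := mul_sincSqrt_sq √z
  have h0 := Real.sqrt_pos.2 hz
  have h1 := Real.sin_lt h0
  rw [Real.sq_sqrt hz.le] at h
  nlinarith

theorem one_lt_sincSqrt {z : ℝ} (hz : z < 0) : 1 < sincSqrt z := by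
  have h := mul_sincSqrt_neg_sq √(-z)
  have h0 := Real.sqrt_pos.2 (neg_pos.2 hz)
  have h1 := Real.self_lt_sinh_iff.2 h0
  rw [Real.sq_sqrt (by linarith), neg_neg] at h
  nlinarith

theorem neg_one_lt_sincSqrt (z : ℝ) : -1 < sincSqrt z := by
  rcases lt_trichotomy z 0 with hz | rfl | hz
  · linarith [one_lt_sincSqrt hz]
  · rw [sincSqrt_zero]; norm_num
  · have h := mul_sincSqrt_sq √z
    have h0 := Real.sqrt_pos.2 hz
    have h1 := Real.sin_lt h0
    have h2 : -√z < Real.sin √z := by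
      -- Beyond 1 the bound sin ≥ -1 suffices; up to 1 < π the sine is positive.
      rcases lt_or_ge 1 √z with h4 | h4
      · linarith [Real.neg_one_le_sin √z]
      · linarith [Real.sin_pos_of_pos_of_lt_pi h0 (by linarith [Real.pi_gt_three])]
    rw [Real.sq_sqrt hz.le] at h
    nlinarith

/-- The numerator of the derivative of `cosSqrt / sincSqrt` is negative. -/
theorem deriv_quotient_neg (z : ℝ) :
    deriv cosSqrt z * sincSqrt z - cosSqrt z * deriv sincSqrt z < 0 := by
  have h1 := two_mul_mul_deriv_sincSqrt z
  have h2 := cosSqrt_sq_add z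
  have h3 := cosSqrt_mul_sincSqrt z
  -- Multiplied by 2z, the numerator becomes `sincSqrt (4 * z) - 1`, whose sign is opposite to that
  -- of z. Only z = 0 needs the value of the derivative of `sincSqrt`.
  have key : 2 * z * (deriv cosSqrt z * sincSqrt z - cosSqrt z * deriv sincSqrt z) =
      sincSqrt (4 * z) - 1 := by
    rw [deriv_cosSqrt]
    linear_combination -cosSqrt z * h1 + h3 - h2
  rcases lt_trichotomy z 0 with hz | rfl | hz
  · have := one_lt_sincSqrt (show 4 * z < 0 by linarith)
    nlinarith
  · have h4 : cosSqrt 0 = 1 := by simpa using cosSqrt_sq 0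
    rw [deriv_cosSqrt, deriv_sincSqrt_zero, sincSqrt_zero, h4]; norm_num
  · have := sincSqrt_lt_one (show 0 < 4 * z by linarith)
    nlinarith

/-! ### Primitives of integrable functions -/

theorem absolutelyContinuousOnInterval_integral {f : ℝ → ℂ} {a b : ℝ}
    (h : IntervalIntegrable f volume a b) :
    AbsolutelyContinuousOnInterval (fun x => ∫ t in a..x, f t) a b := by
  have hc : ∀ z : ℂ, AbsolutelyContinuousOnInterval (fun _ : ℝ => z) a b := fun z =>
    ((LipschitzWith.const z).lipschitzOnWith (s := uIcc a b)).absolutelyContinuousOnInterval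
  have hre : IntervalIntegrable (fun x => (f x).re) volume a b :=
    ⟨h.1.re, h.2.re⟩
  have him : IntervalIntegrable (fun x => (f x).im) volume a b :=
    ⟨h.1.im, h.2.im⟩
  have h1 := (hre.absolutelyContinuousOnInterval_intervalIntegral (c := a) left_mem_uIcc).smul
    (hc 1)
  have h2 := (him.absolutelyContinuousOnInterval_intervalIntegral (c := a) left_mem_uIcc).smul
    (hc Complex.I)
  have key : ∀ x ∈ uIcc a b, (∫ t in a..x, f t) =
      (∫ t in a..x, (f t).re) • (1 : ℂ) + (∫ t in a..x, (f t).im) • Complex.I := by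
    intro x hx
    have hi : IntervalIntegrable f volume a x :=
      h.mono_set (uIcc_subset_uIcc left_mem_uIcc hx)
    have e1 := Complex.reCLM.intervalIntegral_comp_comm hi
    have e2 := Complex.imCLM.intervalIntegral_comp_comm hi
    simp only [Complex.reCLM_apply, Complex.imCLM_apply] at e1 e2
    rw [e1, e2]
    apply Complex.ext <;> simp
  have h3 := h1.add h2
  rw [absolutelyContinuousOnInterval_iff] at h3 ⊢
  intro ε hε
  obtain ⟨δ, hδ, H⟩ := h3 ε hε
  refine ⟨δ, hδ, fun E hE hs => ?_⟩
  refine lt_of_eq_of_lt (Finset.sum_congr rfl fun i hi => ?_) (H E hE hs)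
  have hm := hE.1 i hi
  rw [key _ hm.1, key _ hm.2]
  rfl

/-- `F` is the primitive of the integrable function `F'` on `[a, b]`. -/
structure IsPrimitive (a b : ℝ) (F F' : ℝ → ℂ) : Prop where
  integrable : IntervalIntegrable F' volume a b
  eq_integral : ∀ x ∈ Icc a b, F x = F a + ∫ t in a..x, F' t

namespace IsPrimitive

variable {a b : ℝ} {F F' G G' : ℝ → ℂ}

theorem continuousOn (h : IsPrimitive a b F F') (hab : a ≤ b) : ContinuousOn F (Icc a b) := by
  have := (absolutelyContinuousOnInterval_integral h.integrable).continuousOn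
  rw [uIcc_of_le hab] at this
  exact (continuousOn_const.add this).congr h.eq_integral

theorem congr (h : IsPrimitive a b F F') (hab : a ≤ b) (hFG : EqOn F G (Icc a b))
    (h' : F' =ᵐ[volume.restrict (Ioo a b)] G') : IsPrimitive a b G G' := by
  have hu : F' =ᵐ[volume.restrict (uIoc a b)] G' := by
    rwa [uIoc_of_le hab, ← restrict_Ioo_eq_restrict_Ioc]
  refine ⟨h.integrable.congr_ae hu, fun x hx => ?_⟩
  rw [← hFG hx, ← hFG (left_mem_Icc.2 hab), h.eq_integral x hx]
  congr 1
  refine intervalIntegral.integral_congr_ae ?_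
  rw [Filter.EventuallyEq, ae_restrict_iff' measurableSet_uIoc] at hu
  filter_upwards [hu] with t ht htx
  refine ht ?_
  rw [uIoc_of_le hab]
  rw [uIoc_of_le hx.1] at htx
  exact ⟨htx.1, htx.2.trans hx.2⟩

theorem mono (h : IsPrimitive a b F F') {x : ℝ} (hx : x ∈ Icc a b) : IsPrimitive a x F F' :=
  ⟨h.integrable.mono_set (uIcc_subset_uIcc left_mem_uIcc
    (by rw [uIcc_of_le (hx.1.trans hx.2)]; exact hx)),
    fun y hy => h.eq_integral y ⟨hy.1, hy.2.trans hx.2⟩⟩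

theorem of_hasDerivAt (h : ∀ x, HasDerivAt F (F' x) x) (hc : Continuous F') :
    IsPrimitive a b F F' := by
  refine ⟨hc.intervalIntegrable _ _, fun x _ => ?_⟩
  rw [intervalIntegral.integral_eq_sub_of_hasDerivAt (fun t _ => h t) (hc.intervalIntegrable _ _)]
  ring

theorem add (h : IsPrimitive a b F F') (h' : IsPrimitive a b G G') :
    IsPrimitive a b (fun x => F x + G x) (fun x => F' x + G' x) := by
  refine ⟨h.integrable.add h'.integrable, fun x hx => ?_⟩
  rw [intervalIntegral.integral_add (h.mono hx).integrable (h'.mono hx).integrable,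
    h.eq_integral x hx, h'.eq_integral x hx]
  ring

theorem const (c : ℂ) : IsPrimitive a b (fun _ => c) (fun _ => 0) :=
  of_hasDerivAt (fun x => hasDerivAt_const x c) continuous_const

/-- The product minus the primitive of the Leibniz expression is absolutely continuous with
derivative zero almost everywhere, hence constant. -/
theorem mul (h : IsPrimitive a b F F') (h' : IsPrimitive a b G G') (hab : a ≤ b) :
    IsPrimitive a b (fun x => F x * G x) (fun x => F' x * G x + F x * G' x) := by
  have hint : IntervalIntegrable (fun x => F' x * G x + F x * G' x) volume a b := by
    have h1 := h.continuousOn hab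
    have h2 := h'.continuousOn hab
    rw [← uIcc_of_le hab] at h1 h2
    exact (h.integrable.mul_continuousOn h2).add (h'.integrable.continuousOn_mul h1)
  have hc : ∀ z : ℂ, AbsolutelyContinuousOnInterval (fun _ : ℝ => z) a b := fun z =>
    ((LipschitzWith.const z).lipschitzOnWith (s := uIcc a b)).absolutelyContinuousOnInterval
  set Φ : ℝ → ℂ := fun x => F a + ∫ t in a..x, F' t
  set Ψ : ℝ → ℂ := fun x => G a + ∫ t in a..x, G' t
  have hΦ : AbsolutelyContinuousOnInterval Φ a b :=
    (hc _).add (absolutelyContinuousOnInterval_integral h.integrable)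
  have hΨ : AbsolutelyContinuousOnInterval Ψ a b :=
    (hc _).add (absolutelyContinuousOnInterval_integral h'.integrable)
  have hac := (hΦ.smul hΨ).sub (absolutelyContinuousOnInterval_integral hint)
  obtain ⟨C, hC⟩ := hac.const_of_ae_hasDerivAt_zero (by
    filter_upwards [h.integrable.ae_hasDerivAt_integral, h'.integrable.ae_hasDerivAt_integral,
      hint.ae_hasDerivAt_integral] with x h1 h2 h3 hx
    have d1 : HasDerivAt Φ (F' x) x := (h1 hx a left_mem_uIcc).const_add _
    have d2 : HasDerivAt Ψ (G' x) x := (h2 hx a left_mem_uIcc).const_add _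
    have d3 := (d1.mul d2).sub (h3 hx a left_mem_uIcc)
    rw [uIcc_of_le hab] at hx
    have e1 : Φ x = F x := (h.eq_integral x hx).symm
    have e2 : Ψ x = G x := (h'.eq_integral x hx).symm
    rw [e1, e2, sub_self] at d3
    exact d3)
  refine ⟨hint, fun x hx => ?_⟩
  have h1 := hC x (by rwa [uIcc_of_le hab])
  have h2 := hC a left_mem_uIcc
  have e1 : Φ x = F x := (h.eq_integral x hx).symm
  have e2 : Ψ x = G x := (h'.eq_integral x hx).symm
  have e3 : Φ a = F a := by simp [Φ]
  have e4 : Ψ a = G a := by simp [Ψ]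
  simp only [Pi.sub_apply, smul_eq_mul, Pi.mul_apply, e1, e2, e3, e4,
    intervalIntegral.integral_same] at h1 h2
  linear_combination h1 - h2

end IsPrimitive

/-! ### Gauge phases and Green's identity on an edge -/

/-- The phase `e^{iB(x-a)}`. -/
def phase (B a x : ℝ) : ℂ := Complex.exp (Complex.I * B * (x - a))

theorem phase_self (B a : ℝ) : phase B a a = 1 := by simp [phase]

theorem phase_ne_zero (B a x : ℝ) : phase B a x ≠ 0 := Complex.exp_ne_zero _

theorem phase_mul_phase (B a b x : ℝ) : phase B a b * phase B b x = phase B a x := by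
  rw [phase, phase, phase, ← Complex.exp_add]; congr 1; ring

theorem norm_phase (B a x : ℝ) : ‖phase B a x‖ = 1 := by
  rw [phase, show Complex.I * B * (x - a) = ((B * (x - a) : ℝ) : ℂ) * Complex.I by push_cast; ring]
  exact Complex.norm_exp_ofReal_mul_I _

theorem hasDerivAt_phase (B a x : ℝ) :
    HasDerivAt (phase B a) (Complex.I * B * phase B a x) x := by
  have h : HasDerivAt (fun x : ℝ => Complex.I * B * (x - a : ℂ)) (Complex.I * B * 1) x :=
    ((Complex.ofRealCLM.hasDerivAt (x := x)).sub_const (a : ℂ)).const_mul _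
  have := h.cexp
  rwa [mul_one, mul_comm (Complex.exp _)] at this

theorem continuous_phase (B a : ℝ) : Continuous (phase B a) :=
  continuous_iff_continuousAt.2 fun x => (hasDerivAt_phase B a x).continuousAt

namespace IsQuasiDeriv

variable {B a b : ℝ} {f g v : ℝ → ℂ}

/-- Gauging away the potential: multiplication by the phase turns d/dx + iB into d/dx. -/
theorem isPrimitive (h : IsQuasiDeriv B a b f g) (hab : a ≤ b) :
    IsPrimitive a b (fun x => phase B a x * f x) (fun x => phase B a x * g x) := by
  have h1 : IsPrimitive a b f (fun t => g t - Complex.I * B * f t) :=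
    ⟨h.intervalIntegrable hab, h.eq_integral⟩
  have h2 : IsPrimitive a b (phase B a) (fun x => Complex.I * B * phase B a x) :=
    .of_hasDerivAt (hasDerivAt_phase B a) (continuous_const.mul (continuous_phase B a))
  refine (h2.mul h1 hab).congr hab (fun x _ => rfl) (Eventually.of_forall fun x => ?_)
  dsimp only
  ring

theorem of_isPrimitive (hab : a ≤ b) {F : ℝ → ℂ} (h : IsPrimitive a b F (fun x => phase B a x * g x))
    (hg : MemLp g 2 (volume.restrict (Ioo a b))) :
    IsQuasiDeriv B a b (fun x => (phase B a x)⁻¹ * F x) g := by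
  have hd : ∀ x, HasDerivAt (fun x => (phase B a x)⁻¹)
      (-(Complex.I * B) * (phase B a x)⁻¹) x := by
    intro x
    have := phase_ne_zero B a x
    refine ((hasDerivAt_phase B a x).inv this).congr_deriv ?_
    rw [neg_div, neg_mul, pow_two, mul_div_mul_right _ _ this, div_eq_mul_inv]
  have hc : Continuous (fun x => (phase B a x)⁻¹) :=
    (continuous_phase B a).inv₀ (phase_ne_zero B a)
  have h2 : IsPrimitive a b (fun x => (phase B a x)⁻¹)
      (fun x => -(Complex.I * B) * (phase B a x)⁻¹) :=
    .of_hasDerivAt hd (continuous_const.mul hc)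
  have h3 := (h2.mul h hab).congr (G' := fun t => g t - Complex.I * B * ((phase B a t)⁻¹ * F t))
    hab (fun x _ => rfl) (Eventually.of_forall fun x => by
      have := phase_ne_zero B a x
      dsimp only
      rw [← mul_assoc (phase B a x)⁻¹, inv_mul_cancel₀ this]
      ring)
  exact ⟨h3.continuousOn hab, hg, h3.eq_integral⟩

/-- **Green's identity** on an edge. -/
theorem green (h : IsQuasiDeriv B a b f g) (h' : IsQuasiDeriv B a b g v) (hab : a ≤ b)
    {χ χ' χ'' : ℝ → ℂ} (h1 : ∀ x, HasDerivAt χ (χ' x) x) (h2 : ∀ x, HasDerivAt χ' (χ'' x) x)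
    (h3 : Continuous χ'') {x : ℝ} (hx : x ∈ Icc a b) :
    phase B a x * (g x * χ x - f x * χ' x) = g a * χ a - f a * χ' a +
      ∫ t in a..x, phase B a t * (v t * χ t - f t * χ'' t) := by
  have hc' : Continuous χ' := continuous_iff_continuousAt.2 fun x => (h2 x).continuousAt
  have p1 := (h'.isPrimitive hab).mul (IsPrimitive.of_hasDerivAt h1 hc') hab
  have p2 := (h.isPrimitive hab).mul (IsPrimitive.of_hasDerivAt h2 h3) hab
  have e1 := p1.eq_integral x hx
  have e2 := p2.eq_integral x hx
  rw [phase_self] at e1 e2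
  have e3 : (∫ t in a..x, phase B a t * (v t * χ t - f t * χ'' t)) =
      (∫ t in a..x, (phase B a t * v t * χ t + phase B a t * g t * χ' t)) -
      ∫ t in a..x, (phase B a t * g t * χ' t + phase B a t * f t * χ'' t) := by
    rw [← intervalIntegral.integral_sub (p1.mono hx).integrable (p2.mono hx).integrable]
    congr 1; ext t; ring
  rw [e3]
  linear_combination e1 - e2

end IsQuasiDeriv

/-! ### The fundamental solutions of `-y'' = Ey` -/

/-- The solution of `-y'' = Ey` with `y(0) = 1` and `y'(0) = 0`. -/
def solC (E x : ℝ) : ℝ := cosSqrt (E * x ^ 2)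

/-- The solution of `-y'' = Ey` with `y(0) = 0` and `y'(0) = 1`. -/
def solS (E x : ℝ) : ℝ := x * sincSqrt (E * x ^ 2)

@[simp] theorem solC_zero (E : ℝ) : solC E 0 = 1 := by
  simpa [solC] using cosSqrt_sq 0

@[simp] theorem solS_zero (E : ℝ) : solS E 0 = 0 := by simp [solS]

theorem solC_sq_add (E x : ℝ) : solC E x ^ 2 + E * solS E x ^ 2 = 1 := by
  rw [solC, solS, ← cosSqrt_sq_add (E * x ^ 2)]; ring

theorem hasDerivAt_solC (E x : ℝ) : HasDerivAt (solC E) (-(E * solS E x)) x := by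
  have h := (hasDerivAt_cosSqrt (E * x ^ 2)).comp x (((hasDerivAt_id x).pow 2).const_mul E)
  refine h.congr_deriv ?_
  simp [solS]; ring

theorem hasDerivAt_solS (E x : ℝ) : HasDerivAt (solS E) (solC E x) x := by
  have h := (hasDerivAt_id x).mul ((differentiable_sincSqrt (E * x ^ 2)).hasDerivAt.comp x
    (((hasDerivAt_id x).pow 2).const_mul E))
  refine h.congr_deriv ?_
  have := two_mul_mul_deriv_sincSqrt (E * x ^ 2)
  simp [solC]; linear_combination this

theorem continuous_solC (E : ℝ) : Continuous (solC E) :=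
  continuous_iff_continuousAt.2 fun x => (hasDerivAt_solC E x).continuousAt

theorem continuous_solS (E : ℝ) : Continuous (solS E) :=
  continuous_iff_continuousAt.2 fun x => (hasDerivAt_solS E x).continuousAt

/-! ### The inhomogeneous equation on an edge -/

section Edge

variable {B a b E : ℝ} {f g w : ℝ → ℂ}

theorem hasDerivAt_solC_const_sub (E x t : ℝ) :
    HasDerivAt (fun t => (solC E (x - t) : ℂ)) (E * solS E (x - t) : ℂ) t := by
  have := ((hasDerivAt_solC E (x - t)).comp t ((hasDerivAt_id t).const_sub x)).ofReal_comp
  refine this.congr_deriv ?_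
  push_cast; ring

theorem hasDerivAt_solS_const_sub (E x t : ℝ) :
    HasDerivAt (fun t => (solS E (x - t) : ℂ)) (-solC E (x - t) : ℂ) t := by
  have := ((hasDerivAt_solS E (x - t)).comp t ((hasDerivAt_id t).const_sub x)).ofReal_comp
  refine this.congr_deriv ?_
  push_cast; ring

theorem hasDerivAt_solC_sub_const (E x t : ℝ) :
    HasDerivAt (fun t => (solC E (t - x) : ℂ)) (-(E * solS E (t - x)) : ℂ) t := by
  have := ((hasDerivAt_solC E (t - x)).comp t ((hasDerivAt_id t).sub_const x)).ofReal_comp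
  refine this.congr_deriv ?_
  push_cast; ring

theorem hasDerivAt_solS_sub_const (E x t : ℝ) :
    HasDerivAt (fun t => (solS E (t - x) : ℂ)) (solC E (t - x) : ℂ) t := by
  have := ((hasDerivAt_solS E (t - x)).comp t ((hasDerivAt_id t).sub_const x)).ofReal_comp
  refine this.congr_deriv ?_
  push_cast; ring

/-- Variation of constants. -/
theorem IsQuasiDeriv.eq_solution (h : IsQuasiDeriv B a b f g)
    (h' : IsQuasiDeriv B a b g (fun t => -(E * f t + w t))) (hab : a ≤ b) {x : ℝ}
    (hx : x ∈ Icc a b) :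
    phase B a x * f x = g a * solS E (x - a) + f a * solC E (x - a) -
      ∫ t in a..x, phase B a t * w t * solS E (x - t) := by
  have hc : Continuous fun t => (-(E * solS E (x - t)) : ℂ) := by
    have := continuous_solS E
    fun_prop
  -- The weight S(x - t) solves the homogeneous equation in t, so the integral retains only `w`. At
  -- t = x it vanishes and has derivative -1, which isolates the value of `f`.
  have := h.green h' hab (hasDerivAt_solS_const_sub E x)
    (fun t => (hasDerivAt_solC_const_sub E x t).neg) hc hx
  rw [sub_self, solS_zero, solC_zero] at this
  rw [show (fun t => phase B a t * (-(E * f t + w t) * (solS E (x - t) : ℂ) -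
    f t * (-(E * solS E (x - t))))) = fun t => -(phase B a t * w t * solS E (x - t)) from by
      ext t; ring, intervalIntegral.integral_neg] at this
  simp only [Complex.ofReal_zero, Complex.ofReal_one] at this
  linear_combination this

/-- Variation of constants for the derivative. -/
theorem IsQuasiDeriv.deriv_eq_solution (h : IsQuasiDeriv B a b f g)
    (h' : IsQuasiDeriv B a b g (fun t => -(E * f t + w t))) (hab : a ≤ b) {x : ℝ}
    (hx : x ∈ Icc a b) :
    phase B a x * g x = g a * solC E (x - a) - f a * (E * solS E (x - a)) -
      ∫ t in a..x, phase B a t * w t * solC E (x - t) := by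
  have hc : Continuous fun t => (E * (-solC E (x - t)) : ℂ) := by
    have := continuous_solC E
    fun_prop
  have := h.green h' hab (hasDerivAt_solC_const_sub E x)
    (fun t => (hasDerivAt_solS_const_sub E x t).const_mul (E : ℂ)) hc hx
  rw [sub_self, solS_zero, solC_zero] at this
  rw [show (fun t => phase B a t * (-(E * f t + w t) * (solC E (x - t) : ℂ) -
    f t * (E * (-solC E (x - t))))) = fun t => -(phase B a t * w t * solC E (x - t)) from by
      ext t; ring, intervalIntegral.integral_neg] at this
  simp only [Complex.ofReal_zero, Complex.ofReal_one] at this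
  linear_combination this

/-- The derivative at the right end of an edge in terms of the boundary values. -/
theorem IsQuasiDeriv.deriv_right (h : IsQuasiDeriv B a b f g)
    (h' : IsQuasiDeriv B a b g (fun t => -(E * f t + w t))) (hab : a ≤ b) :
    phase B a b * (solS E (b - a) * g b) = phase B a b * (solC E (b - a) * f b) - f a -
      ∫ t in a..b, phase B a t * w t * solS E (t - a) := by
  have hc : Continuous fun t => (-(E * solS E (t - a)) : ℂ) := by
    have := continuous_solS E
    fun_prop
  -- The weight S(t - a) vanishes at `a`, which eliminates the derivative at the left end.
  have := h.green h' hab (hasDerivAt_solS_sub_const E a)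
    (fun t => hasDerivAt_solC_sub_const E a t) hc (right_mem_Icc.2 hab)
  rw [sub_self, solS_zero, solC_zero] at this
  rw [show (fun t => phase B a t * (-(E * f t + w t) * (solS E (t - a) : ℂ) -
    f t * (-(E * solS E (t - a))))) = fun t => -(phase B a t * w t * solS E (t - a)) from by
      ext t; ring, intervalIntegral.integral_neg] at this
  simp only [Complex.ofReal_zero, Complex.ofReal_one] at this
  linear_combination this

/-- Existence of the solution of the initial value problem on an edge. -/
theorem exists_isQuasiDeriv (B E : ℝ) (hab : a ≤ b) (hw : MemLp w 2 (volume.restrict (Ioo a b)))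
    (φ d : ℂ) : ∃ f g : ℝ → ℂ, f a = φ ∧ g a = d ∧ IsQuasiDeriv B a b f g ∧
      IsQuasiDeriv B a b g (fun t => -(E * f t + w t)) := by
  have hwi : IntervalIntegrable w volume a b := by
    rw [intervalIntegrable_iff_integrableOn_Ioo_of_le hab]
    exact hw.integrable (by norm_num)
  have hh : IntervalIntegrable (fun t => phase B a t * w t) volume a b :=
    hwi.continuousOn_mul (continuous_phase B a).continuousOn
  have hC : Continuous fun t => (solC E (t - a) : ℂ) := by
    have := continuous_solC E
    fun_prop
  have hS : Continuous fun t => (solS E (t - a) : ℂ) := by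
    have := continuous_solS E
    fun_prop
  have pC : IsPrimitive a b (fun t => (solC E (t - a) : ℂ)) _ :=
    .of_hasDerivAt (hasDerivAt_solC_sub_const E a) (by fun_prop)
  have pS : IsPrimitive a b (fun t => (solS E (t - a) : ℂ)) _ :=
    .of_hasDerivAt (hasDerivAt_solS_sub_const E a) hC
  -- Variation of constants: P'S + Q'C = 0, so F = PS + QC has derivative G = PC - EQS. Then C² +
  -- ES² = 1 gives G' = -EF - (phase)·w.
  set P : ℝ → ℂ := fun x => d + ∫ t in a..x, -(phase B a t * w t * solC E (t - a))
  set Q : ℝ → ℂ := fun x => φ + ∫ t in a..x, phase B a t * w t * solS E (t - a)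
  have pP : IsPrimitive a b P (fun t => -(phase B a t * w t * solC E (t - a))) :=
    ⟨(hh.mul_continuousOn hC.continuousOn).neg, fun x _ => by simp [P]⟩
  have pQ : IsPrimitive a b Q (fun t => phase B a t * w t * solS E (t - a)) :=
    ⟨hh.mul_continuousOn hS.continuousOn, fun x _ => by simp [Q]⟩
  have pE : IsPrimitive a b (fun _ => (-E : ℂ)) _ := .const _
  set F : ℝ → ℂ := fun x => P x * solS E (x - a) + Q x * solC E (x - a)
  set G : ℝ → ℂ := fun x => P x * solC E (x - a) + -E * (Q x * solS E (x - a))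
  have pF : IsPrimitive a b F G :=
    ((pP.mul pS hab).add (pQ.mul pC hab)).congr hab (fun x _ => rfl)
      (Eventually.of_forall fun x => by simp only [G]; ring)
  have hn := phase_ne_zero B a
  have hid : ∀ x, (solC E (x - a) : ℂ) ^ 2 + E * (solS E (x - a) : ℂ) ^ 2 = 1 := fun x => by
    exact_mod_cast solC_sq_add E (x - a)
  have pG : IsPrimitive a b G
      (fun x => phase B a x * -(E * ((phase B a x)⁻¹ * F x) + w x)) :=
    ((pP.mul pC hab).add (pE.mul (pQ.mul pS hab) hab)).congr hab (fun x _ => rfl)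
      (Eventually.of_forall fun x => by
        simp only [F]
        have e : phase B a x * -(E * ((phase B a x)⁻¹ * (P x * solS E (x - a) +
            Q x * solC E (x - a))) + w x) =
            -E * (P x * solS E (x - a) + Q x * solC E (x - a)) - phase B a x * w x := by
          have := mul_inv_cancel₀ (hn x)
          linear_combination (-E * (P x * solS E (x - a) + Q x * solC E (x - a))) * this
        rw [e]
        linear_combination -(phase B a x * w x) * hid x)
  have hcF := pF.continuousOn hab
  have hcG := pG.continuousOn hab
  have hci : Continuous fun x => (phase B a x)⁻¹ := (continuous_phase B a).inv₀ hn
  have hmem : ∀ H : ℝ → ℂ, ContinuousOn H (Icc a b) →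
      MemLp H 2 (volume.restrict (Ioo a b)) := fun H hH => by
    obtain ⟨K, hK⟩ := isCompact_Icc.exists_bound_of_continuousOn hH
    refine MemLp.of_bound ((hH.mono Ioo_subset_Icc_self).aestronglyMeasurable measurableSet_Ioo) K ?_
    filter_upwards [ae_restrict_mem measurableSet_Ioo] with x hx
    exact hK x (Ioo_subset_Icc_self hx)
  refine ⟨fun x => (phase B a x)⁻¹ * F x, fun x => (phase B a x)⁻¹ * G x, ?_, ?_, ?_, ?_⟩
  · simp [F, P, Q, phase_self]
  · simp [G, P, Q, phase_self]
  · refine IsQuasiDeriv.of_isPrimitive hab (pF.congr hab (fun x _ => rfl)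
      (Eventually.of_forall fun x => ?_)) (hmem _ (hci.continuousOn.mul hcG))
    dsimp only
    rw [mul_inv_cancel_left₀ (hn x)]
  · refine IsQuasiDeriv.of_isPrimitive hab pG ?_
    exact (((hmem _ (hci.continuousOn.mul hcF)).const_mul (E : ℂ)).add hw).neg

end Edge

/-! ### Square integrable functions on the edges -/

/-- The interior of the `j`-th edge. -/
def edge (j : ℤ) : Set ℝ := Ioo ((j : ℝ) * π) ((j + 1) * π)

theorem left_lt_right (j : ℤ) : (j : ℝ) * π < (j + 1) * π := by nlinarith [Real.pi_pos]

theorem right_sub_left (j : ℤ) : ((j : ℝ) + 1) * π - j * π = π := by ring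

theorem pairwise_disjoint_edge : Pairwise (Function.onFun Disjoint edge) := by
  intro i j hij
  have := pairwise_disjoint_Ioo_zsmul π hij
  simpa [edge, Function.onFun] using this

theorem volume_restrict_iUnion_edge : (volume : Measure ℝ).restrict (⋃ j, edge j) = volume := by
  have h : (⋃ j, edge j) =ᵐ[volume] (univ : Set ℝ) := by
    have hU : (⋃ j : ℤ, Ioc ((j : ℝ) * π) ((j + 1) * π)) = univ := by
      have := iUnion_Ioc_zsmul Real.pi_pos
      simpa using this
    rw [← hU]
    exact Filter.EventuallyEq.countable_iUnion fun j => Ioo_ae_eq_Ioc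
  rw [Measure.restrict_congr_set h, Measure.restrict_univ]

theorem summable_integral_edge {w : ℝ → ℂ} (hw : MemLp w 2 volume) :
    Summable fun j : ℤ => ∫ x in edge j, ‖w x‖ ^ 2 := by
  have hi := (memLp_two_iff_integrable_sq_norm hw.1).1 hw
  exact (hasSum_integral_iUnion (fun j => measurableSet_Ioo) pairwise_disjoint_edge
    hi.integrableOn).summable

/-- This is the Cauchy-Schwarz inequality on an edge of length π. -/
theorem sq_integral_norm_le {w : ℝ → ℂ} (hw : MemLp w 2 volume) (j : ℤ) :
    (∫ x in edge j, ‖w x‖) ^ 2 ≤ π * ∫ x in edge j, ‖w x‖ ^ 2 := by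
  have hw' : MemLp w 2 (volume.restrict (edge j)) := hw.restrict _
  have hfin : IsFiniteMeasure (volume.restrict (edge j)) := by
    constructor; rw [Measure.restrict_apply_univ, edge]; simp
  have h1 : Integrable (fun x => ‖w x‖) (volume.restrict (edge j)) :=
    (hw'.integrable (by norm_num)).norm
  have h2 := (memLp_two_iff_integrable_sq_norm hw'.1).1 hw'
  set m := ∫ x in edge j, ‖w x‖
  have hvol : (volume.restrict (edge j)).real univ = π := by
    rw [measureReal_restrict_apply_univ, edge, Real.volume_real_Ioo_of_le (left_lt_right j).le]
    ring
  -- The integrand is the square (π‖w‖ - m)²/π, and its integral is π∫‖w‖² - m².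
  have h3 : 0 ≤ ∫ x in edge j, (π * ‖w x‖ ^ 2 - 2 * m * ‖w x‖ + m ^ 2 / π) :=
    integral_nonneg fun x => by
      have : π * ‖w x‖ ^ 2 - 2 * m * ‖w x‖ + m ^ 2 / π = (π * ‖w x‖ - m) ^ 2 / π := by
        field_simp; ring
      simp only [Pi.zero_apply, this]
      have := Real.pi_pos
      positivity
  have h4 : Integrable (fun x => π * ‖w x‖ ^ 2 - 2 * m * ‖w x‖) (volume.restrict (edge j)) :=
    (h2.const_mul _).sub (h1.const_mul _)
  rw [integral_add h4 (integrable_const _), integral_sub (h2.const_mul _) (h1.const_mul _), integral_const_mul, integral_const_mul,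
    integral_const, hvol, smul_eq_mul, mul_div_cancel₀ _ Real.pi_ne_zero] at h3
  change 0 ≤ π * _ - 2 * m * m + m ^ 2 at h3
  linarith

theorem summable_sq_integral_norm {w : ℝ → ℂ} (hw : MemLp w 2 volume) :
    Summable fun j : ℤ => (∫ x in edge j, ‖w x‖) ^ 2 :=
  .of_nonneg_of_le (fun _ => sq_nonneg _) (sq_integral_norm_le hw)
    ((summable_integral_edge hw).mul_left π)

/-- Functions on the edges with square summable bounds are the pieces of an `L²` function. -/
theorem exists_Lp_of_edges {F : ℤ → ℝ → ℂ}
    (hF : ∀ j : ℤ, ContinuousOn (F j) (Icc ((j : ℝ) * π) ((j + 1) * π))) {K : ℤ → ℝ}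
    (hK : ∀ j, ∀ x ∈ edge j, ‖F j x‖ ≤ K j) (hs : Summable fun j => K j ^ 2) :
    ∃ u : Lp ℂ 2 (volume : Measure ℝ), ∀ j, F j =ᵐ[volume.restrict (edge j)] u := by
  -- On the interior of the `j`-th edge the floor equals `j`; the vertices form a null set.
  set f : ℝ → ℂ := fun x => F ⌊x / π⌋ x
  have hf : ∀ j, ∀ x ∈ edge j, f x = F j x := by
    intro j x hx
    have : ⌊x / π⌋ = j := by
      rw [Int.floor_eq_iff, le_div_iff₀ Real.pi_pos, div_lt_iff₀ Real.pi_pos]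
      exact ⟨hx.1.le, hx.2⟩
    simp only [f, this]
  have hae : ∀ j, F j =ᵐ[volume.restrict (edge j)] f := fun j => by
    filter_upwards [ae_restrict_mem measurableSet_Ioo] with x hx
    exact (hf j x hx).symm
  have hmj : ∀ j, AEStronglyMeasurable f (volume.restrict (edge j)) := fun j =>
    (((hF j).mono Ioo_subset_Icc_self).aestronglyMeasurable measurableSet_Ioo).congr (hae j)
  have hm : AEStronglyMeasurable f volume := by
    rw [← volume_restrict_iUnion_edge, aestronglyMeasurable_iUnion_iff]
    exact hmj
  have hb : ∀ j, ∀ x ∈ edge j, ‖‖f x‖ ^ 2‖ ≤ K j ^ 2 := fun j x hx => by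
    rw [hf j x hx, norm_pow, norm_norm]
    exact pow_le_pow_left₀ (norm_nonneg _) (hK j x hx) 2
  have hv : ∀ j, volume.real (edge j) = π := fun j => by
    rw [edge, Real.volume_real_Ioo_of_le (left_lt_right j).le]; ring
  have hi : IntegrableOn (fun x => ‖f x‖ ^ 2) (⋃ j, edge j) volume := by
    refine integrableOn_iUnion_of_summable_integral_norm (fun j => ?_) ?_
    · refine IntegrableOn.of_bound (by rw [edge]; simp) ((hmj j).norm.pow 2) (K j ^ 2) ?_
      filter_upwards [ae_restrict_mem measurableSet_Ioo] with x hx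
      exact hb j x hx
    · refine .of_nonneg_of_le (fun j => integral_nonneg fun x => norm_nonneg _) (fun j => ?_)
        (hs.mul_right π)
      have := norm_setIntegral_le_of_norm_le_const (μ := volume) (s := edge j)
        (f := fun x => ‖‖f x‖ ^ 2‖) (C := K j ^ 2) (by rw [edge]; simp)
        (fun x hx => by rw [norm_norm]; exact hb j x hx)
      rw [hv] at this
      exact (le_abs_self _).trans this
  have hL : MemLp f 2 volume := by
    rw [memLp_two_iff_integrable_sq_norm hm]
    rwa [IntegrableOn, volume_restrict_iUnion_edge] at hi
  exact ⟨hL.toLp f, fun j => (hae j).trans (ae_restrict_of_ae hL.coeFn_toLp.symm)⟩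

/-! ### Square summable sequences -/

/-- The sequence `φ` is square summable. -/
def SqSummable (φ : ℤ → ℂ) : Prop := Summable fun j => ‖φ j‖ ^ 2

theorem SqSummable.of_norm_le {φ : ℤ → ℂ} {K : ℤ → ℝ} (hK : Summable fun j => K j ^ 2)
    (h : ∀ j, ‖φ j‖ ≤ K j) : SqSummable φ :=
  .of_nonneg_of_le (fun _ => by positivity)
    (fun j => pow_le_pow_left₀ (norm_nonneg _) (h j) 2) hK

theorem summable_sq_add {x y : ℤ → ℝ} (hx : Summable fun j => x j ^ 2)
    (hy : Summable fun j => y j ^ 2) : Summable fun j => (x j + y j) ^ 2 :=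
  .of_nonneg_of_le (fun _ => by positivity)
    (fun j => by nlinarith [sq_nonneg (x j - y j)]) ((hx.add hy).mul_left 2)

theorem summable_const_mul_sq {x : ℤ → ℝ} (hx : Summable fun j => x j ^ 2) (c : ℝ) :
    Summable fun j => (c * x j) ^ 2 := by
  simpa only [mul_pow] using hx.mul_left (c ^ 2)

theorem SqSummable.add {φ ψ : ℤ → ℂ} (hφ : SqSummable φ) (hψ : SqSummable ψ) :
    SqSummable (fun j => φ j + ψ j) :=
  .of_norm_le (summable_sq_add hφ hψ) fun _ => norm_add_le _ _

theorem SqSummable.const_mul {φ : ℤ → ℂ} (hφ : SqSummable φ) (c : ℂ) :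
    SqSummable (fun j => c * φ j) :=
  .of_norm_le (summable_const_mul_sq hφ ‖c‖) fun _ => (norm_mul _ _).le

theorem SqSummable.sub {φ ψ : ℤ → ℂ} (hφ : SqSummable φ) (hψ : SqSummable ψ) :
    SqSummable (fun j => φ j - ψ j) := by
  simpa [sub_eq_add_neg] using hφ.add (hψ.const_mul (-1))

theorem SqSummable.shift {φ : ℤ → ℂ} (hφ : SqSummable φ) (m : ℤ) :
    SqSummable (fun j => φ (j + m)) :=
  hφ.comp_injective (add_left_injective m)

theorem SqSummable.of_finite {φ : ℤ → ℂ} (s : Finset ℤ) (h : ∀ j ∉ s, φ j = 0) : SqSummable φ :=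
  summable_of_ne_finset_zero (s := s) fun j hj => by simp [h j hj]

theorem SqSummable.tendsto {φ : ℤ → ℂ} (hφ : SqSummable φ) : Tendsto φ cofinite (nhds 0) := by
  have := hφ.tendsto_cofinite_zero
  rw [tendsto_zero_iff_norm_tendsto_zero]
  have h2 := this.sqrt
  simpa [Real.sqrt_sq] using h2

/-! ### Weighted integrals over the edges -/

theorem intervalIntegrable_Lp (w : Lp ℂ 2 (volume : Measure ℝ)) (a b : ℝ) :
    IntervalIntegrable w volume a b :=
  (((Lp.memLp w).locallyIntegrable (by norm_num)).integrableOn_isCompact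
    isCompact_uIcc).intervalIntegrable

/-- The integral of `w` over the `j`-th edge with the weight `χ`. -/
def edgeIntegral (j : ℤ) (χ : ℝ → ℂ) (hχ : Continuous χ) :
    Lp ℂ 2 (volume : Measure ℝ) →ₗ[ℂ] ℂ where
  toFun w := ∫ t in (j : ℝ) * π..(j + 1) * π, χ t * w t
  map_add' w w' := by
    rw [← intervalIntegral.integral_add
      ((intervalIntegrable_Lp w _ _).continuousOn_mul hχ.continuousOn)
      ((intervalIntegrable_Lp w' _ _).continuousOn_mul hχ.continuousOn)]
    refine intervalIntegral.integral_congr_ae ?_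
    filter_upwards [Lp.coeFn_add w w'] with t ht _
    rw [ht, Pi.add_apply, mul_add]
  map_smul' c w := by
    rw [RingHom.id_apply, smul_eq_mul, ← intervalIntegral.integral_const_mul]
    refine intervalIntegral.integral_congr_ae ?_
    filter_upwards [Lp.coeFn_smul c w] with t ht _
    rw [ht, Pi.smul_apply, smul_eq_mul]
    ring

theorem edgeIntegral_apply (j : ℤ) (χ : ℝ → ℂ) (hχ : Continuous χ)
    (w : Lp ℂ 2 (volume : Measure ℝ)) :
    edgeIntegral j χ hχ w = ∫ t in (j : ℝ) * π..(j + 1) * π, χ t * w t := rfl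

theorem integral_edge_norm (j : ℤ) (w : ℝ → ℂ) :
    ∫ t in (j : ℝ) * π..(j + 1) * π, ‖w t‖ = ∫ t in edge j, ‖w t‖ := by
  rw [intervalIntegral.integral_of_le (left_lt_right j).le, edge, integral_Ioc_eq_integral_Ioo]

theorem norm_edgeIntegral_le (j : ℤ) {χ : ℝ → ℂ} (hχ : Continuous χ) {K : ℝ}
    (hK : ∀ t ∈ Icc ((j : ℝ) * π) ((j + 1) * π), ‖χ t‖ ≤ K)
    (w : Lp ℂ 2 (volume : Measure ℝ)) :
    ‖edgeIntegral j χ hχ w‖ ≤ K * ∫ t in edge j, ‖w t‖ := by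
  rw [← integral_edge_norm, ← intervalIntegral.integral_const_mul, edgeIntegral_apply]
  refine intervalIntegral.norm_integral_le_of_norm_le (left_lt_right j).le
    (Eventually.of_forall fun t ht => ?_) ((intervalIntegrable_Lp w _ _).norm.const_mul K)
  rw [norm_mul]
  exact mul_le_mul_of_nonneg_right (hK t (Ioc_subset_Icc_self ht)) (norm_nonneg _)

/-- Weights that are bounded uniformly in `j` yield square summable integrals. -/
theorem sqSummable_edgeIntegral {χ : ℤ → ℝ → ℂ} (hχ : ∀ j, Continuous (χ j)) {K : ℝ}
    (hK : ∀ j : ℤ, ∀ t ∈ Icc ((j : ℝ) * π) ((j + 1) * π), ‖χ j t‖ ≤ K)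
    (w : Lp ℂ 2 (volume : Measure ℝ)) : SqSummable fun j => edgeIntegral j (χ j) (hχ j) w :=
  .of_norm_le (summable_const_mul_sq (summable_sq_integral_norm (Lp.memLp w)) K)
    fun j => norm_edgeIntegral_le j (hχ j) (hK j) w

/-! ### The values at the vertices -/

namespace IsComponents

variable {A : ℝ} {α : ℤ → ℝ} {u v : State} {f g : Fin 2 → ℤ → ℝ → ℂ}

theorem left_eq (h : IsComponents A α u v f g) (σ : Fin 2) (j : ℤ) :
    f σ j (j * π) = f 0 j (j * π) := by
  fin_cases σ
  · rfl
  · exact (h.continuity j).1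

theorem right_eq (h : IsComponents A α u v f g) (σ : Fin 2) (j : ℤ) :
    f σ j ((j + 1) * π) = f 0 (j + 1) ((j + 1 : ℤ) * π) := by
  have := h.continuity (j + 1)
  rw [add_sub_cancel_right, Int.cast_add, Int.cast_one] at this
  rw [Int.cast_add, Int.cast_one]
  fin_cases σ
  · exact this.2.1
  · exact this.2.2

end IsComponents

/-- A cubic polynomial `χ` with `χ(0) = χ(π) = χ'(π) = 0` and `χ'(0) = -1`. -/
def cubic (x : ℝ) : ℂ := -x + 2 / π * x ^ 2 - 1 / π ^ 2 * x ^ 3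

/-- The second derivative of `cubic`. -/
def cubicDeriv₂ (x : ℝ) : ℂ := 4 / π - 6 / π ^ 2 * x

theorem continuous_cubic : Continuous cubic := by unfold cubic; fun_prop

theorem continuous_cubicDeriv₂ : Continuous cubicDeriv₂ := by unfold cubicDeriv₂; fun_prop

theorem hasDerivAt_cubic_sub (a x : ℝ) : HasDerivAt (fun x => cubic (x - a))
    (-1 + 4 / π * (x - a) - 3 / π ^ 2 * (x - a) ^ 2 : ℂ) x := by
  have h0 : HasDerivAt (fun x : ℝ => ((x - a : ℝ) : ℂ)) 1 x := by
    simpa using ((hasDerivAt_id x).sub_const a).ofReal_comp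
  have := ((h0.neg.add ((h0.pow 2).const_mul (2 / π : ℂ))).sub ((h0.pow 3).const_mul (1 / π ^ 2 : ℂ)))
  refine this.congr_deriv ?_
  push_cast; ring

theorem hasDerivAt_cubic_deriv_sub (a x : ℝ) : HasDerivAt
    (fun x : ℝ => (-1 + 4 / π * (x - a) - 3 / π ^ 2 * (x - a) ^ 2 : ℂ)) (cubicDeriv₂ (x - a)) x := by
  have h0 : HasDerivAt (fun x : ℝ => (x - a : ℂ)) 1 x := by
    simpa using ((hasDerivAt_id x).sub_const a).ofReal_comp
  have := ((h0.const_mul (4 / π : ℂ)).const_add (-1)).sub ((h0.pow 2).const_mul (3 / π ^ 2 : ℂ))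
  refine this.congr_deriv ?_
  simp [cubicDeriv₂]; ring

/-- The value at the vertex `jπ` of an element of the graph of the Hamiltonian. -/
def vertexValue (A : ℝ) (j : ℤ) : State × State →ₗ[ℂ] ℂ :=
  (edgeIntegral j (fun t => phase A (j * π) t * cubic (t - j * π))
    ((continuous_phase _ _).mul (continuous_cubic.comp (by fun_prop)))) ∘ₗ
      (PiLp.projₗ 2 _ 0) ∘ₗ (LinearMap.snd ℂ State State) +
  (edgeIntegral j (fun t => phase A (j * π) t * cubicDeriv₂ (t - j * π))
    ((continuous_phase _ _).mul (continuous_cubicDeriv₂.comp (by fun_prop)))) ∘ₗ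
      (PiLp.projₗ 2 _ 0) ∘ₗ (LinearMap.fst ℂ State State)

/-- The weights on different edges are translates of each other up to a unimodular phase, hence
bounded uniformly in `j`. -/
theorem sqSummable_vertexValue (A : ℝ) (p : State × State) :
    SqSummable fun j => vertexValue A j p := by
  obtain ⟨K, hK⟩ := (isCompact_Icc (a := 0) (b := π)).exists_bound_of_continuousOn
    continuous_cubic.continuousOn
  obtain ⟨K', hK'⟩ := (isCompact_Icc (a := 0) (b := π)).exists_bound_of_continuousOn
    continuous_cubicDeriv₂.continuousOn
  have hm : ∀ (j : ℤ) (t : ℝ), t ∈ Icc ((j : ℝ) * π) ((j + 1) * π) → t - j * π ∈ Icc 0 π :=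
    fun j t ht => ⟨by linarith [ht.1], by linarith [ht.2]⟩
  refine (sqSummable_edgeIntegral (fun j => (continuous_phase A (j * π)).mul
    (continuous_cubic.comp (by fun_prop : Continuous fun t : ℝ => t - j * π)))
    (K := K) (fun j t ht => ?_) (p.2 0)).add
    (sqSummable_edgeIntegral (fun j => (continuous_phase A (j * π)).mul
    (continuous_cubicDeriv₂.comp (by fun_prop : Continuous fun t : ℝ => t - j * π)))
    (K := K') (fun j t ht => ?_) (p.1 0))
  · simpa [norm_phase] using hK _ (hm j t ht)
  · simpa [norm_phase] using hK' _ (hm j t ht)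

/-- In Green's identity with the weight `cubic` every boundary term vanishes except the value at the
left vertex. That value is thereby a linear functional of the pair (u, v), independent of the chosen
components, of the coupling constants and of E. -/
theorem IsComponents.vertexValue_eq {A : ℝ} {α : ℤ → ℝ} {u v : State}
    {f g : Fin 2 → ℤ → ℝ → ℂ} (h : IsComponents A α u v f g) (j : ℤ) :
    vertexValue A j (u, v) = f 0 j (j * π) := by
  have hg := (h.deriv_one 0 j).green (h.deriv_two 0 j) (left_lt_right j).le
    (hasDerivAt_cubic_sub (j * π)) (hasDerivAt_cubic_deriv_sub (j * π))
    (continuous_cubicDeriv₂.comp (by fun_prop)) (right_mem_Icc.2 (left_lt_right j).le)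
  have hπ : (π : ℂ) ≠ 0 := by exact_mod_cast Real.pi_ne_zero
  have e1 : cubic ((j + 1) * π - j * π) = 0 := by
    rw [right_sub_left, cubic]; field_simp; ring
  have e2 : (-1 + 4 / π * (((j + 1) * π : ℝ) - (j * π : ℝ)) - 3 / π ^ 2 *
      (((j + 1) * π : ℝ) - (j * π : ℝ)) ^ 2 : ℂ) = 0 := by
    rw [← Complex.ofReal_sub, right_sub_left]; field_simp; ring
  have e3 : cubic (j * π - j * π) = 0 := by simp [cubic]
  rw [e1, e2, e3] at hg
  simp only [sub_self, mul_zero] at hg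
  have hA : potential A 0 = A := if_pos rfl
  rw [hA] at hg
  have hi1 := ((intervalIntegrable_Lp (v 0) (j * π) ((j + 1) * π)).continuousOn_mul
    ((continuous_phase A (j * π)).mul (continuous_cubic.comp
      (by fun_prop : Continuous fun t : ℝ => t - j * π))).continuousOn)
  have hi2 := ((intervalIntegrable_Lp (u 0) (j * π) ((j + 1) * π)).continuousOn_mul
    ((continuous_phase A (j * π)).mul (continuous_cubicDeriv₂.comp
      (by fun_prop : Continuous fun t : ℝ => t - j * π))).continuousOn)
  have hcalc : vertexValue A j (u, v) =
      -∫ t in (j * π : ℝ)..(j + 1) * π, phase A (j * π) t *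
        (-(v 0 t) * cubic (t - j * π) - f 0 j t * cubicDeriv₂ (t - j * π)) := by
    have e4 : (∫ t in (j * π : ℝ)..(j + 1) * π, phase A (j * π) t *
        (-(v 0 t) * cubic (t - j * π) - f 0 j t * cubicDeriv₂ (t - j * π))) =
        ∫ t in (j * π : ℝ)..(j + 1) * π, -(phase A (j * π) t * cubic (t - j * π) * v 0 t +
          phase A (j * π) t * cubicDeriv₂ (t - j * π) * u 0 t) := by
      refine intervalIntegral.integral_congr_ae ?_
      have := h.ae_eq 0 j
      rw [restrict_Ioo_eq_restrict_Ioc, Filter.EventuallyEq,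
        ae_restrict_iff' measurableSet_Ioc] at this
      filter_upwards [this] with t ht htx
      rw [uIoc_of_le (left_lt_right j).le] at htx
      rw [ht htx]
      ring
    rw [e4, intervalIntegral.integral_neg, neg_neg, intervalIntegral.integral_add]
    · rfl
    · exact hi1
    · exact hi2
  rw [hcalc]
  linear_combination hg

/-! ### Reduction of the resolvent equation to a difference equation -/

theorem phase_edge (B : ℝ) (j : ℤ) :
    phase B (j * π) ((j + 1) * π) = Complex.exp (Complex.I * (B * π)) := by
  rw [phase]; congr 1; push_cast; ring

theorem phase_edge_symm (B : ℝ) (j : ℤ) :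
    phase B ((j + 1) * π) (j * π) = Complex.exp (-(Complex.I * (B * π))) := by
  rw [phase]; congr 1; push_cast; ring

theorem exp_add_exp_neg (A : ℝ) : Complex.exp (Complex.I * (A * π)) +
    Complex.exp (-(Complex.I * (A * π))) = 2 * (Real.cos (A * π) : ℂ) := by
  rw [Complex.ofReal_cos, Complex.cos]; push_cast
  rw [mul_div_cancel₀ _ (two_ne_zero)]; congr 2 <;> ring

theorem potential_zero (A : ℝ) : potential A 0 = A := if_pos rfl

theorem potential_one (A : ℝ) : potential A 1 = -A := if_neg (by decide)

/-- The contribution of the inhomogeneity to the derivative at the left end of an edge. -/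
def sourceLeft (A E : ℝ) (σ : Fin 2) (j : ℤ) : Lp ℂ 2 (volume : Measure ℝ) →ₗ[ℂ] ℂ :=
  edgeIntegral j (fun t => phase (potential A σ) (j * π) t * solS E ((j + 1) * π - t))
    ((continuous_phase _ _).mul (Complex.continuous_ofReal.comp
      ((continuous_solS E).comp (by fun_prop))))

/-- The contribution of the inhomogeneity to the derivative at the right end of an edge. -/
def sourceRight (A E : ℝ) (σ : Fin 2) (j : ℤ) : Lp ℂ 2 (volume : Measure ℝ) →ₗ[ℂ] ℂ :=
  edgeIntegral j (fun t => phase (potential A σ) ((j + 1) * π) t * solS E (t - j * π))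
    ((continuous_phase _ _).mul (Complex.continuous_ofReal.comp
      ((continuous_solS E).comp (by fun_prop))))

/-- The inhomogeneity of the difference equation. -/
def source (A E : ℝ) (j : ℤ) : State →ₗ[ℂ] ℂ :=
  -∑ σ, (sourceLeft A E σ j + sourceRight A E σ (j - 1)) ∘ₗ PiLp.projₗ 2 _ σ

/-- The difference operator to which `-Δ_α - E` is reduced. -/
def jacobi (A E : ℝ) (α : ℤ → ℝ) (φ : ℤ → ℂ) (j : ℤ) : ℂ :=
  2 * Real.cos (A * π) * (φ (j + 1) + φ (j - 1)) -
    (4 * solC E π + α j * solS E π : ℝ) * φ j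

theorem norm_solS_le (E : ℝ) : ∃ K, ∀ x ∈ Icc 0 π, ‖(solS E x : ℂ)‖ ≤ K :=
  isCompact_Icc.exists_bound_of_continuousOn
    (Complex.continuous_ofReal.comp (continuous_solS E)).continuousOn

theorem norm_solC_le (E : ℝ) : ∃ K, ∀ x ∈ Icc 0 π, ‖(solC E x : ℂ)‖ ≤ K :=
  isCompact_Icc.exists_bound_of_continuousOn
    (Complex.continuous_ofReal.comp (continuous_solC E)).continuousOn

theorem sqSummable_sourceLeft (A E : ℝ) (σ : Fin 2) (w : Lp ℂ 2 (volume : Measure ℝ)) :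
    SqSummable fun j => sourceLeft A E σ j w := by
  obtain ⟨K, hK⟩ := norm_solS_le E
  refine sqSummable_edgeIntegral (K := K) _ (fun j t ht => ?_) w
  rw [norm_mul, norm_phase, one_mul]
  exact hK _ ⟨by linarith [ht.2], by linarith [ht.1, right_sub_left j]⟩

theorem sqSummable_sourceRight (A E : ℝ) (σ : Fin 2) (w : Lp ℂ 2 (volume : Measure ℝ)) :
    SqSummable fun j => sourceRight A E σ j w := by
  obtain ⟨K, hK⟩ := norm_solS_le E
  refine sqSummable_edgeIntegral (K := K) _ (fun j t ht => ?_) w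
  rw [norm_mul, norm_phase, one_mul]
  exact hK _ ⟨by linarith [ht.1], by linarith [ht.2, right_sub_left j]⟩

theorem source_apply (A E : ℝ) (j : ℤ) (w : State) : source A E j w =
    -(sourceLeft A E 0 j (w 0) + sourceRight A E 0 (j - 1) (w 0) +
      (sourceLeft A E 1 j (w 1) + sourceRight A E 1 (j - 1) (w 1))) := by
  simp [source, Fin.sum_univ_two]

theorem sqSummable_source (A E : ℝ) (w : State) : SqSummable fun j => source A E j w := by
  simp only [source_apply]
  have h : ∀ σ, SqSummable fun j => sourceLeft A E σ j (w σ) + sourceRight A E σ (j - 1) (w σ) :=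
    fun σ => (sqSummable_sourceLeft A E σ (w σ)).add ((sqSummable_sourceRight A E σ (w σ)).shift (-1))
  simpa using ((h 0).add (h 1)).const_mul (-1)

section Edge

variable {A E : ℝ} {σ : Fin 2} {j : ℤ} {f g : ℝ → ℂ} {w : Lp ℂ 2 (volume : Measure ℝ)}

/-- Variation of constants up to the right end of the edge, solved for the derivative at the left
end. The factor S is kept on the left so that the formula also holds at its zeros. -/
theorem solS_mul_left (h : IsQuasiDeriv (potential A σ) (j * π) ((j + 1) * π) f g)
    (h' : IsQuasiDeriv (potential A σ) (j * π) ((j + 1) * π) g (fun t => -(E * f t + w t))) :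
    solS E π * g (j * π) = Complex.exp (Complex.I * (potential A σ * π)) * f ((j + 1) * π) -
      solC E π * f (j * π) + sourceLeft A E σ j w := by
  have := h.eq_solution h' (left_lt_right j).le (right_mem_Icc.2 (left_lt_right j).le)
  rw [phase_edge, right_sub_left] at this
  rw [this, sourceLeft, edgeIntegral_apply, show (fun t => phase (potential A σ) (j * π) t *
    (solS E ((j + 1) * π - t) : ℂ) * w t) = fun t => phase (potential A σ) (j * π) t * w t *
    (solS E ((j + 1) * π - t) : ℂ) from by ext t; ring]
  ring

theorem solS_mul_right (h : IsQuasiDeriv (potential A σ) (j * π) ((j + 1) * π) f g)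
    (h' : IsQuasiDeriv (potential A σ) (j * π) ((j + 1) * π) g (fun t => -(E * f t + w t))) :
    solS E π * g ((j + 1) * π) = solC E π * f ((j + 1) * π) -
      Complex.exp (-(Complex.I * (potential A σ * π))) * f (j * π) - sourceRight A E σ j w := by
  have h1 := h.deriv_right h' (left_lt_right j).le
  rw [right_sub_left] at h1
  have h2 : sourceRight A E σ j w = phase (potential A σ) ((j + 1) * π) (j * π) *
      ∫ t in (j * π : ℝ)..(j + 1) * π, phase (potential A σ) (j * π) t * w t *
        solS E (t - j * π) := by
    rw [← intervalIntegral.integral_const_mul, sourceRight, edgeIntegral_apply]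
    congr 1; ext t
    rw [← phase_mul_phase (potential A σ) ((j + 1) * π) (j * π) t]; ring
  have h3 := phase_mul_phase (potential A σ) ((j + 1) * π) (j * π) ((j + 1) * π)
  rw [phase_self] at h3
  rw [h2, ← phase_edge_symm _ j]
  linear_combination phase (potential A σ) ((j + 1) * π) (j * π) * h1 -
    (solS E π * g ((j + 1) * π) - solC E π * f ((j + 1) * π)) * h3

end Edge

/-- The `δ`-coupling is equivalent to the difference equation for the values at the vertices. -/
theorem solS_mul_delta {A E : ℝ} (α : ℤ → ℝ) {f g : Fin 2 → ℤ → ℝ → ℂ} {w : State} {φ : ℤ → ℂ}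
    (hf : ∀ σ (j : ℤ), IsQuasiDeriv (potential A σ) (j * π) ((j + 1) * π) (f σ j) (g σ j))
    (hg : ∀ σ (j : ℤ), IsQuasiDeriv (potential A σ) (j * π) ((j + 1) * π) (g σ j)
      (fun t => -(E * f σ j t + w σ t)))
    (hl : ∀ σ (j : ℤ), f σ j (j * π) = φ j) (hr : ∀ σ (j : ℤ), f σ j ((j + 1) * π) = φ (j + 1))
    (j : ℤ) : solS E π * (g 0 j (j * π) + g 1 j (j * π) - g 0 (j - 1) (j * π) -
      g 1 (j - 1) (j * π) - α j * φ j) = jacobi A E α φ j - source A E j w := by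
  have l0 := solS_mul_left (hf 0 j) (hg 0 j)
  have l1 := solS_mul_left (hf 1 j) (hg 1 j)
  have r0 := solS_mul_right (hf 0 (j - 1)) (hg 0 (j - 1))
  have r1 := solS_mul_right (hf 1 (j - 1)) (hg 1 (j - 1))
  rw [hl, hr] at l0 l1 r0 r1
  have hj : ((j - 1 : ℤ) : ℝ) + 1 = j := by push_cast; ring
  rw [sub_add_cancel, hj] at r0 r1
  rw [potential_zero] at l0 r0
  rw [potential_one, Complex.ofReal_neg, neg_mul, mul_neg] at l1 r1
  rw [neg_neg] at r1
  rw [source_apply, jacobi]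
  -- The phases of the upper and the lower edge are conjugate and add up to 2cos(Aπ).
  have e := exp_add_exp_neg A
  push_cast at e ⊢
  linear_combination l0 + l1 - r0 - r1 + (φ (j + 1) + φ (j - 1)) * e

theorem IsComponents.deriv_two' {A E : ℝ} {α : ℤ → ℝ} {u w : State} {f g : Fin 2 → ℤ → ℝ → ℂ}
    (h : IsComponents A α u ((E : ℂ) • u + w) f g) (σ : Fin 2) (j : ℤ) :
    IsQuasiDeriv (potential A σ) (j * π) ((j + 1) * π) (g σ j)
      (fun t => -(E * f σ j t + w σ t)) := by
  refine (h.deriv_two σ j).congr ?_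
  filter_upwards [h.ae_eq σ j, ae_restrict_of_ae (Lp.coeFn_add ((E : ℂ) • u σ) (w σ)),
    ae_restrict_of_ae (Lp.coeFn_smul (E : ℂ) (u σ))] with t h1 h2 h3
  rw [Pi.add_apply, h3, Pi.smul_apply, smul_eq_mul] at h2
  rw [h1]
  exact congrArg Neg.neg h2

/-- The values at the vertices of a solution of the resolvent equation satisfy the difference
equation. -/
theorem jacobi_vertexValue {A E : ℝ} {α : ℤ → ℝ} {u w : State}
    (h : (u, (E : ℂ) • u + w) ∈ hamiltonianGraph A α) (j : ℤ) :
    jacobi A E α (fun j => vertexValue A j (u, (E : ℂ) • u + w)) j = source A E j w := by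
  obtain ⟨f, g, h⟩ := h
  have h1 := solS_mul_delta α h.deriv_one h.deriv_two'
    (φ := fun j => vertexValue A j (u, (E : ℂ) • u + w))
    (fun σ j => by rw [h.vertexValue_eq, h.left_eq]) (fun σ j => by
      rw [h.vertexValue_eq, h.right_eq]) j
  have h2 := h.delta j
  simp only [h.vertexValue_eq] at h1 h2 ⊢
  rw [h2, sub_self, mul_zero] at h1
  exact (sub_eq_zero.1 h1.symm)

theorem sqSummable_norm_add {φ d : ℤ → ℂ} (hφ : SqSummable φ) (hd : SqSummable d) (K : ℝ)
    (w : Lp ℂ 2 (volume : Measure ℝ)) :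
    Summable fun j => (K * (‖φ j‖ + ‖d j‖ + ∫ t in edge j, ‖w t‖)) ^ 2 :=
  summable_const_mul_sq (summable_sq_add (summable_sq_add hφ hd)
    (summable_sq_integral_norm (Lp.memLp w))) K

/-- The initial value problems on the edges with square summable data have a solution in
`L²(Γ)`. -/
theorem exists_state_of_initial_values (A E : ℝ) (w : State) {φ d : Fin 2 → ℤ → ℂ}
    (hφ : ∀ σ, SqSummable (φ σ)) (hd : ∀ σ, SqSummable (d σ)) :
    ∃ (u : State) (f g : Fin 2 → ℤ → ℝ → ℂ),
      (∀ σ (j : ℤ), f σ j =ᵐ[volume.restrict (Ioo (j * π) ((j + 1) * π))] u σ) ∧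
      (∀ σ (j : ℤ), IsQuasiDeriv (potential A σ) (j * π) ((j + 1) * π) (f σ j) (g σ j)) ∧
      (∀ σ (j : ℤ), IsQuasiDeriv (potential A σ) (j * π) ((j + 1) * π) (g σ j)
        (fun t => -(E * f σ j t + w σ t))) ∧
      (∀ σ (j : ℤ), f σ j (j * π) = φ σ j) ∧ ∀ σ (j : ℤ), g σ j (j * π) = d σ j := by
  have hex := fun σ (j : ℤ) => exists_isQuasiDeriv (potential A σ) E (left_lt_right j).le
    ((Lp.memLp (w σ)).restrict _) (φ σ j) (d σ j)
  choose f g hf hg h1 h2 using hex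
  obtain ⟨K, hK⟩ := norm_solS_le E
  obtain ⟨K', hK'⟩ := norm_solC_le E
  -- The constant does not depend on `j`, so square summable data yield a state in L²(Γ).
  have hb : ∀ σ (j : ℤ), ∀ x ∈ edge j, ‖f σ j x‖ ≤
      max K K' * (‖φ σ j‖ + ‖d σ j‖ + ∫ t in edge j, ‖w σ t‖) := by
    intro σ j x hx
    have hx' : x ∈ Icc ((j : ℝ) * π) ((j + 1) * π) := Ioo_subset_Icc_self hx
    have hx0 : x - j * π ∈ Icc 0 π :=
      ⟨by linarith [hx'.1], by linarith [hx'.2, right_sub_left j]⟩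
    have e := congrArg norm ((h1 σ j).eq_solution (h2 σ j) (left_lt_right j).le hx')
    rw [norm_mul, norm_phase, one_mul, hf, hg] at e
    have hi : ‖∫ t in (j * π : ℝ)..x, phase (potential A σ) (j * π) t * w σ t * solS E (x - t)‖ ≤
        max K K' * ∫ t in edge j, ‖w σ t‖ := by
      have i1 := (intervalIntegrable_Lp (w σ) (j * π) ((j + 1) * π)).norm.const_mul (max K K')
      have i2 : IntervalIntegrable (fun t => max K K' * ‖w σ t‖) volume (j * π) x :=
        (intervalIntegrable_Lp (w σ) (j * π) x).norm.const_mul (max K K')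
      refine (intervalIntegral.norm_integral_le_of_norm_le hx'.1
        (Eventually.of_forall fun t ht => ?_) i2).trans ?_
      · rw [norm_mul, norm_mul, norm_phase, one_mul, mul_comm]
        refine mul_le_mul_of_nonneg_right ((hK _ ?_).trans (le_max_left _ _)) (norm_nonneg _)
        exact ⟨by linarith [ht.2], by linarith [ht.1, hx0.2]⟩
      · rw [← integral_edge_norm, ← intervalIntegral.integral_const_mul]
        refine intervalIntegral.integral_mono_interval le_rfl hx'.1 hx'.2
          (Eventually.of_forall fun t => ?_) i1
        have : 0 ≤ K := (norm_nonneg _).trans (hK 0 ⟨le_rfl, Real.pi_pos.le⟩)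
        have : 0 ≤ max K K' := this.trans (le_max_left _ _)
        dsimp only [Pi.zero_apply]
        positivity
    have b1 : ‖d σ j * solS E (x - j * π)‖ ≤ max K K' * ‖d σ j‖ := by
      rw [norm_mul, mul_comm]
      exact mul_le_mul_of_nonneg_right ((hK _ hx0).trans (le_max_left _ _)) (norm_nonneg _)
    have b2 : ‖φ σ j * solC E (x - j * π)‖ ≤ max K K' * ‖φ σ j‖ := by
      rw [norm_mul, mul_comm]
      exact mul_le_mul_of_nonneg_right ((hK' _ hx0).trans (le_max_right _ _)) (norm_nonneg _)
    rw [e]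
    refine (norm_sub_le _ _).trans ((add_le_add (norm_add_le _ _) hi).trans ?_)
    linarith
  have hL := fun σ => exists_Lp_of_edges (fun j => (h1 σ j).continuousOn) (hb σ)
    (sqSummable_norm_add (hφ σ) (hd σ) (max K K') (w σ))
  choose u hu using hL
  exact ⟨WithLp.toLp 2 u, f, g, hu, h1, h2, hf, hg⟩

theorem deriv_two_of_ae {A E : ℝ} {u w : State} {f g : Fin 2 → ℤ → ℝ → ℂ}
    (hu : ∀ σ (j : ℤ), f σ j =ᵐ[volume.restrict (Ioo (j * π) ((j + 1) * π))] u σ)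
    (h : ∀ σ (j : ℤ), IsQuasiDeriv (potential A σ) (j * π) ((j + 1) * π) (g σ j)
      (fun t => -(E * f σ j t + w σ t))) (σ : Fin 2) (j : ℤ) :
    IsQuasiDeriv (potential A σ) (j * π) ((j + 1) * π) (g σ j)
      (fun x => -(((E : ℂ) • u + w) σ x)) := by
  refine (h σ j).congr ?_
  filter_upwards [hu σ j, ae_restrict_of_ae (Lp.coeFn_add ((E : ℂ) • u σ) (w σ)),
    ae_restrict_of_ae (Lp.coeFn_smul (E : ℂ) (u σ))] with t h1 h2 h3
  rw [Pi.add_apply, h3, Pi.smul_apply, smul_eq_mul] at h2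
  rw [h1]
  exact (congrArg Neg.neg h2).symm

/-- A square summable solution of the difference equation comes from a solution of the resolvent
equation. -/
theorem exists_mem_graph {A E : ℝ} {α : ℤ → ℝ} (hE : solS E π ≠ 0) {φ : ℤ → ℂ}
    (hφ : SqSummable φ) (w : State) (h : ∀ j, jacobi A E α φ j = source A E j w) :
    ∃ u : State, (u, (E : ℂ) • u + w) ∈ hamiltonianGraph A α ∧
      ∀ j, vertexValue A j (u, (E : ℂ) • u + w) = φ j := by
  have hS : (solS E π : ℂ) ≠ 0 := by exact_mod_cast hE
  -- The initial slope prescribed by `solS_mul_left`: with it, the solution starting from φ_j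
  -- arrives at φ_{j+1} on both edges of the ring.
  set d : Fin 2 → ℤ → ℂ := fun σ j => (solS E π : ℂ)⁻¹ *
    (Complex.exp (Complex.I * (potential A σ * π)) * φ (j + 1) - solC E π * φ j +
      sourceLeft A E σ j (w σ)) with hd_def
  have hd : ∀ σ, SqSummable (d σ) := fun σ =>
    ((((hφ.shift 1).const_mul _).sub (hφ.const_mul _)).add
      (sqSummable_sourceLeft A E σ (w σ))).const_mul _
  obtain ⟨u, f, g, hu, h1, h2, hf, hg⟩ :=
    exists_state_of_initial_values A E w (φ := fun _ => φ) (fun _ => hφ) hd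
  have hr : ∀ σ (j : ℤ), f σ j ((j + 1) * π) = φ (j + 1) := by
    intro σ j
    have e := solS_mul_left (h1 σ j) (h2 σ j)
    rw [hf, hg, hd_def] at e
    simp only [mul_inv_cancel_left₀ hS] at e
    refine mul_left_cancel₀ (Complex.exp_ne_zero (Complex.I * (potential A σ * π))) ?_
    linear_combination -e
  have hj : ∀ j : ℤ, ((j - 1 : ℤ) : ℝ) + 1 = j := fun j => by push_cast; ring
  have hr' : ∀ σ (j : ℤ), f σ (j - 1) (j * π) = φ j := fun σ j => by
    have := hr σ (j - 1)
    rwa [hj, sub_add_cancel] at this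
  have hc : IsComponents A α u ((E : ℂ) • u + w) f g := by
    refine ⟨hu, h1, deriv_two_of_ae hu h2, fun j => ?_, fun j => ?_⟩
    · rw [hf, hf, hr', hr']; exact ⟨rfl, rfl, rfl⟩
    · have e := solS_mul_delta α h1 h2 hf hr j
      rw [h, sub_self] at e
      rw [hf]
      exact sub_eq_zero.1 ((mul_eq_zero.1 e).resolve_left hS)
  exact ⟨u, ⟨f, g, hc⟩, fun j => by rw [hc.vertexValue_eq, hf]⟩

theorem ae_of_forall_edge {p : ℝ → Prop} (h : ∀ j, ∀ᵐ x ∂volume.restrict (edge j), p x) :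
    ∀ᵐ x, p x := by
  rw [← volume_restrict_iUnion_edge, ae_restrict_iUnion_iff]
  exact h

/-- A solution is determined by its values at the vertices. -/
theorem eq_zero_of_vertexValue {A E : ℝ} {α : ℤ → ℝ} (hE : solS E π ≠ 0) {u : State}
    (h : (u, (E : ℂ) • u) ∈ hamiltonianGraph A α)
    (h0 : ∀ j, vertexValue A j (u, (E : ℂ) • u) = 0) : u = 0 := by
  have hS : (solS E π : ℂ) ≠ 0 := by exact_mod_cast hE
  obtain ⟨f, g, h⟩ := h
  have hz : (0 : Lp ℂ 2 (volume : Measure ℝ)) =ᵐ[volume] fun _ => (0 : ℂ) := Lp.coeFn_zero ℂ 2 volume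
  have h' : IsComponents A α u ((E : ℂ) • u + 0) f g := by rwa [add_zero]
  have h2 : ∀ σ (j : ℤ), IsQuasiDeriv (potential A σ) (j * π) ((j + 1) * π) (g σ j)
      (fun t => -(E * f σ j t + (fun _ => (0 : ℂ)) t)) := fun σ j => by
    refine (h'.deriv_two' σ j).congr ?_
    filter_upwards [ae_restrict_of_ae hz] with t ht
    exact congrArg (fun z => -(E * f σ j t + z)) ht
  have hv : ∀ σ (j : ℤ), f σ j (j * π) = 0 := fun σ j => by
    rw [h.left_eq, ← h.vertexValue_eq, h0]
  have hv' : ∀ σ (j : ℤ), f σ j ((j + 1) * π) = 0 := fun σ j => by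
    rw [h.right_eq, ← h.vertexValue_eq, h0]
  ext1 σ
  refine Lp.eq_zero_iff_ae_eq_zero.2 (ae_of_forall_edge fun j => ?_)
  have hg : g σ j (j * π) = 0 := by
    have e := (h.deriv_one σ j).eq_solution (h2 σ j) (left_lt_right j).le
      (right_mem_Icc.2 (left_lt_right j).le)
    rw [hv, hv', right_sub_left] at e
    simpa [hE] using e
  filter_upwards [h.ae_eq σ j, ae_restrict_mem measurableSet_Ioo] with x hx hxe
  have e := (h.deriv_one σ j).eq_solution (h2 σ j) (left_lt_right j).le (Ioo_subset_Icc_self hxe)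
  rw [hv, hg] at e
  rw [← hx]
  simpa [phase_ne_zero] using e

/-! ### Fredholm properties in terms of the graph -/

section Algebra

variable {K V W F : Type*} [Field K] [AddCommGroup V] [Module K V] [AddCommGroup W] [Module K W]
  [AddCommGroup F] [Module K F]

/-- If R is a finite-dimensional complement of S, then T + R is finite-dimensional and spans the
whole space together with S'. -/
theorem cofg_of_le_sup {S S' T : Submodule K W} (hT : T.FG) (h : S ≤ S' ⊔ T) (hS : S.CoFG) :
    S'.CoFG := by
  obtain ⟨R, hR⟩ := S.exists_isCompl
  refine (hT.sup (hS.fg_of_isCompl hR)).cofg_of_codisjoint (codisjoint_iff_le_sup.2 ?_)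
  rw [sup_comm, ← sup_assoc, ← hR.sup_eq_top]
  exact sup_le_sup_right h R

/-- A complement of the kernel of ℓ in G embeds into F, so it is finite-dimensional. -/
theorem exists_fg_sup_ker (G : Submodule K V) (ℓ : V →ₗ[K] F) [FiniteDimensional K F] :
    ∃ R : Submodule K V, R.FG ∧ G ≤ G ⊓ LinearMap.ker ℓ ⊔ R := by
  obtain ⟨R, hR⟩ := (LinearMap.ker (ℓ ∘ₗ G.subtype)).exists_isCompl
  have hfg : R.FG := (Submodule.CoFG.ker (ℓ ∘ₗ G.subtype)).fg_of_isCompl hR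
  refine ⟨R.map G.subtype, hfg.map _, ?_⟩
  have h1 := congrArg (Submodule.map G.subtype) hR.sup_eq_top
  rw [Submodule.map_sup, Submodule.map_subtype_top] at h1
  conv_lhs => rw [← h1]
  refine sup_le_sup_right ?_ _
  rintro _ ⟨x, hx, rfl⟩
  exact ⟨x.2, hx⟩

/-- Passing to a subspace of finite codimension does not affect the Fredholm property. -/
theorem fredholm_inf_ker_iff (G : Submodule K V) (L : V →ₗ[K] W) (ℓ : V →ₗ[K] F)
    [FiniteDimensional K F] :
    (FiniteDimensional K ↥(G ⊓ LinearMap.ker ℓ ⊓ LinearMap.ker L) ∧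
      FiniteDimensional K (W ⧸ (G ⊓ LinearMap.ker ℓ).map L)) ↔
    (FiniteDimensional K ↥(G ⊓ LinearMap.ker L) ∧ FiniteDimensional K (W ⧸ G.map L)) := by
  refine and_congr ⟨fun h => ?_, fun h => ?_⟩ ⟨fun h => ?_, fun h => ?_⟩
  · refine Module.Finite.iff_fg.2 (Submodule.fg_of_fg_map_of_fg_inf_ker ℓ ?_ ?_)
    · exact IsNoetherian.noetherian _
    · rw [inf_right_comm]
      exact Module.Finite.iff_fg.1 h
  · exact Submodule.finiteDimensional_of_le (inf_le_inf_right _ inf_le_left)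
  · exact Submodule.CoFG.of_le (Submodule.map_mono inf_le_left) h
  · obtain ⟨R, hR, hG⟩ := exists_fg_sup_ker G ℓ
    refine cofg_of_le_sup (hR.map L) ?_ h
    rw [← Submodule.map_sup]
    exact Submodule.map_mono hG

end Algebra

/-- The map `(u, v) ↦ v - Eu`. -/
def shiftMap (E : ℝ) : State × State →ₗ[ℂ] State :=
  LinearMap.snd ℂ State State - (E : ℂ) • LinearMap.fst ℂ State State

theorem shiftMap_apply (E : ℝ) (p : State × State) : shiftMap E p = p.2 - (E : ℂ) • p.1 := rfl

section Graph

variable (T : State →ₗ.[ℂ] State) (E : ℝ)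

/-- The map `u ↦ (u, Tu)`. -/
def graphMap : T.domain →ₗ[ℂ] State × State := T.domain.subtype.prod T.toFun

theorem graphMap_injective : Function.Injective (graphMap T) := fun _ _ h =>
  Subtype.ext (congrArg Prod.fst h)

theorem range_shifted : LinearMap.range (shifted T E) = T.graph.map (shiftMap E) := by
  ext w
  constructor
  · rintro ⟨x, rfl⟩
    exact ⟨(x, T x), T.mem_graph x, rfl⟩
  · rintro ⟨p, hp, rfl⟩
    obtain ⟨y, hy, hy'⟩ := (T.mem_graph_iff).1 hp
    refine ⟨y, ?_⟩
    rw [shiftMap_apply, ← hy, ← hy']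
    rfl

theorem map_ker_shifted : (LinearMap.ker (shifted T E)).map (graphMap T) =
    T.graph ⊓ LinearMap.ker (shiftMap E) := by
  ext p
  constructor
  · rintro ⟨x, hx, rfl⟩
    exact ⟨T.mem_graph x, hx⟩
  · rintro ⟨hp, hp'⟩
    obtain ⟨y, hy, hy'⟩ := (T.mem_graph_iff).1 hp
    have e : graphMap T y = p := Prod.ext hy hy'
    refine ⟨y, ?_, e⟩
    rw [← e] at hp'
    exact hp'

/-- The kernel of `T - E` is isomorphic to the eigenvectors in the graph. -/
def kerShiftedEquiv : LinearMap.ker (shifted T E) ≃ₗ[ℂ]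
    ↥(T.graph ⊓ LinearMap.ker (shiftMap E)) :=
  (Submodule.equivMapOfInjective (graphMap T) (graphMap_injective T) _).trans
    (LinearEquiv.ofEq _ _ (map_ker_shifted T E))

end Graph

theorem mem_essentialSpectrum_iff {A : ℝ} {α : ℤ → ℝ} {E : ℝ} :
    E ∈ essentialSpectrum (hamiltonian A α) ↔
      ¬ (FiniteDimensional ℂ ↥(hamiltonianGraph A α ⊓ LinearMap.ker (shiftMap E)) ∧
        FiniteDimensional ℂ (State ⧸ (hamiltonianGraph A α).map (shiftMap E))) := by
  rw [essentialSpectrum, mem_ofPred_eq, range_shifted, hamiltonian_graph]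
  have e := kerShiftedEquiv (hamiltonian A α) E
  rw [hamiltonian_graph] at e
  refine not_congr (and_congr ⟨fun h => ?_, fun h => ?_⟩ Iff.rfl)
  · exact e.finiteDimensional
  · exact e.symm.finiteDimensional

theorem multiplicity_eq_rank {A : ℝ} {α : ℤ → ℝ} {E : ℝ} : multiplicity (hamiltonian A α) E =
    Module.rank ℂ ↥(hamiltonianGraph A α ⊓ LinearMap.ker (shiftMap E)) := by
  have e := kerShiftedEquiv (hamiltonian A α) E
  rw [hamiltonian_graph] at e
  exact e.rank_eq

/-- The values at two vertices. -/
def vertexPair (A : ℝ) (p q : ℤ) : State × State →ₗ[ℂ] ℂ × ℂ :=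
  (vertexValue A p).prod (vertexValue A q)

/-- At a vertex where the function vanishes the coupling constant is multiplied by zero and may be
changed freely. -/
theorem graph_inf_ker_le {A : ℝ} {α α' : ℤ → ℝ} {p q : ℤ}
    (h : ∀ j, j ≠ p → j ≠ q → α j = α' j) :
    hamiltonianGraph A α ⊓ LinearMap.ker (vertexPair A p q) ≤
      hamiltonianGraph A α' ⊓ LinearMap.ker (vertexPair A p q) := by
  rintro x ⟨⟨f, g, hx⟩, hk⟩
  refine ⟨⟨f, g, hx.ae_eq, hx.deriv_one, hx.deriv_two, hx.continuity, fun j => ?_⟩, hk⟩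
  rw [hx.delta j]
  have hp : f 0 p (p * π) = 0 := by
    rw [← hx.vertexValue_eq]; exact congrArg Prod.fst hk
  have hq : f 0 q (q * π) = 0 := by
    rw [← hx.vertexValue_eq]; exact congrArg Prod.snd hk
  by_cases h1 : j = p
  · rw [h1, hp, mul_zero, mul_zero]
  by_cases h2 : j = q
  · rw [h2, hq, mul_zero, mul_zero]
  rw [h j h1 h2]

/-- Changing two coupling constants does not change the essential spectrum. -/
theorem essentialSpectrum_congr {A : ℝ} {α α' : ℤ → ℝ} {p q : ℤ}
    (h : ∀ j, j ≠ p → j ≠ q → α j = α' j) :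
    essentialSpectrum (hamiltonian A α) = essentialSpectrum (hamiltonian A α') := by
  ext E
  rw [mem_essentialSpectrum_iff, mem_essentialSpectrum_iff,
    ← fredholm_inf_ker_iff _ _ (vertexPair A p q),
    ← fredholm_inf_ker_iff (hamiltonianGraph A α') _ (vertexPair A p q),
    le_antisymm (graph_inf_ker_le h) (graph_inf_ker_le fun j h1 h2 => (h j h1 h2).symm)]

/-! ### Invertibility of the periodic difference operator in the gaps -/

theorem memℓp_iff_sqSummable {φ : ℤ → ℂ} : Memℓp φ 2 ↔ SqSummable φ := by
  rw [memℓp_gen_iff (by norm_num), SqSummable]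
  simp

/-- The shift by `m` on the square summable sequences. -/
def shiftOp (m : ℤ) : lp (fun _ : ℤ => ℂ) 2 →L[ℂ] lp (fun _ : ℤ => ℂ) 2 :=
  LinearMap.mkContinuous
    { toFun := fun φ => ⟨fun j => φ (j + m),
        memℓp_iff_sqSummable.2 ((memℓp_iff_sqSummable.1 φ.2).shift m)⟩
      map_add' := fun _ _ => rfl
      map_smul' := fun _ _ => rfl } 1 fun φ => by
    rw [one_mul]
    refine lp.norm_le_of_tsum_le (by norm_num) (norm_nonneg _) ?_
    rw [lp.norm_rpow_eq_tsum (by norm_num) φ]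
    exact ((Equiv.addRight m).tsum_eq fun j => ‖φ j‖ ^ (2 : ENNReal).toReal).le

theorem norm_shiftOp_le (m : ℤ) : ‖shiftOp m‖ ≤ 1 :=
  LinearMap.mkContinuous_norm_le _ zero_le_one _

/-- Neumann series: the shifts are contractions, so the subtracted operator has norm at most |c|/|η|
< 1. -/
theorem isUnit_periodicOp {c η : ℝ} (h : |c| < |η|) :
    IsUnit (1 - (c / (2 * η) : ℂ) • (shiftOp 1 + shiftOp (-1))) := by
  have hη : 0 < |η| := (abs_nonneg c).trans_lt h
  refine ⟨Units.oneSub _ ?_, rfl⟩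
  calc ‖(c / (2 * η) : ℂ) • (shiftOp 1 + shiftOp (-1))‖
      ≤ |c| / (2 * |η|) * (1 + 1) := by
        rw [norm_smul]
        refine mul_le_mul (le_of_eq ?_) ((norm_add_le _ _).trans
          (add_le_add (norm_shiftOp_le _) (norm_shiftOp_le _))) (norm_nonneg _) (by positivity)
        simp
    _ < 1 := by
        rw [show |c| / (2 * |η|) * (1 + 1) = |c| / |η| by field_simp; norm_num, div_lt_one hη]
        exact h

theorem exists_periodic_solution {c η : ℝ} (h : |c| < |η|) {F : ℤ → ℂ} (hF : SqSummable F) :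
    ∃ φ, SqSummable φ ∧ ∀ j, 2 * c * (φ (j + 1) + φ (j - 1)) - 4 * η * φ j = F j := by
  have hη : (η : ℂ) ≠ 0 := by
    have : 0 < |η| := (abs_nonneg c).trans_lt h
    exact_mod_cast abs_pos.1 this
  obtain ⟨L, hL⟩ := isUnit_periodicOp h
  -- Division of the equation by -4η brings it to the form inverted in `isUnit_periodicOp`.
  set G : lp (fun _ : ℤ => ℂ) 2 :=
    ⟨fun j => -(4 * η : ℂ)⁻¹ * F j, memℓp_iff_sqSummable.2 (hF.const_mul _)⟩
  set φ := (L⁻¹ : (_ →L[ℂ] _)ˣ).1 G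
  have e : L.1 φ = G := by
    change (L.1 * (L⁻¹ : (_ →L[ℂ] _)ˣ).1) G = G
    rw [Units.mul_inv]; rfl
  refine ⟨φ, memℓp_iff_sqSummable.1 φ.2, fun j => ?_⟩
  rw [hL] at e
  have e2 : φ j - (c / (2 * η) : ℂ) * (φ (j + 1) + φ (j + -1)) = -(4 * η : ℂ)⁻¹ * F j :=
    congrFun (congrArg Subtype.val e) j
  rw [← sub_eq_add_neg] at e2
  field_simp at e2
  linear_combination -e2 / 2

theorem periodic_solution_unique {c η : ℝ} (h : |c| < |η|) {φ : ℤ → ℂ} (hφ : SqSummable φ)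
    (h0 : ∀ j, 2 * c * (φ (j + 1) + φ (j - 1)) - 4 * η * φ j = 0) (j : ℤ) : φ j = 0 := by
  have hη : (η : ℂ) ≠ 0 := by
    have : 0 < |η| := (abs_nonneg c).trans_lt h
    exact_mod_cast abs_pos.1 this
  obtain ⟨L, hL⟩ := isUnit_periodicOp h
  set Φ : lp (fun _ : ℤ => ℂ) 2 := ⟨φ, memℓp_iff_sqSummable.2 hφ⟩
  have e : L.1 Φ = 0 := by
    rw [hL]
    ext j
    change φ j - (c / (2 * η) : ℂ) * (φ (j + 1) + φ (j + -1)) = 0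
    have := h0 j
    rw [← sub_eq_add_neg]
    field_simp
    linear_combination -this / 2
  have e2 : Φ = 0 := by
    have : ((L⁻¹ : (_ →L[ℂ] _)ˣ).1 * L.1) Φ = 0 := by
      change (L⁻¹ : (_ →L[ℂ] _)ˣ).1 (L.1 Φ) = 0
      rw [e, map_zero]
    rwa [Units.inv_mul] at this
  exact congrFun (congrArg Subtype.val e2) j

/-- Half the discriminant of the periodic chain. -/
def disc (α E : ℝ) : ℝ := solC E π + α * solS E π / 4

theorem jacobi_const (A E α : ℝ) (φ : ℤ → ℂ) (j : ℤ) : jacobi A E (fun _ => α) φ j =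
    2 * Real.cos (A * π) * (φ (j + 1) + φ (j - 1)) - 4 * disc α E * φ j := by
  rw [jacobi, disc]; push_cast; ring

theorem mem_ker_shiftMap {E : ℝ} {p : State × State} :
    p ∈ LinearMap.ker (shiftMap E) ↔ p.2 = (E : ℂ) • p.1 := by
  rw [LinearMap.mem_ker, shiftMap_apply, sub_eq_zero]

/-- Here the shifted operator is even bijective: uniqueness for the difference equation makes the
kernel trivial, and solvability for every source makes the range everything. -/
theorem not_mem_essentialSpectrum {A α E : ℝ} (hS : solS E π ≠ 0)
    (h : |Real.cos (A * π)| < |disc α E|) :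
    E ∉ essentialSpectrum (periodicHamiltonian A α) := by
  rw [periodicHamiltonian, mem_essentialSpectrum_iff, not_not]
  constructor
  · have : hamiltonianGraph A (fun _ => α) ⊓ LinearMap.ker (shiftMap E) = ⊥ := by
      rw [eq_bot_iff]
      rintro ⟨u, v⟩ ⟨hg, hk⟩
      obtain rfl : v = (E : ℂ) • u := mem_ker_shiftMap.1 hk
      have e := fun j => jacobi_vertexValue (w := 0) (by rwa [add_zero]) j
      simp only [add_zero, map_zero, jacobi_const] at e
      have := eq_zero_of_vertexValue hS hg
        (periodic_solution_unique h (sqSummable_vertexValue A (u, (E : ℂ) • u)) e)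
      simp [this]
    rw [this]
    infer_instance
  · have : (hamiltonianGraph A (fun _ => α)).map (shiftMap E) = ⊤ := by
      rw [eq_top_iff]
      intro w _
      obtain ⟨φ, hφ, e⟩ := exists_periodic_solution h (sqSummable_source A E w)
      simp only [← jacobi_const] at e
      obtain ⟨u, hu, -⟩ := exists_mem_graph hS hφ w e
      exact ⟨_, hu, by simp [shiftMap_apply]⟩
    rw [this]
    infer_instance

/-! ### The flat bands -/

/-- The derivative at the left end of the `j`-th upper edge for an eigenfunction that vanishes at
the vertices. -/
def derivValue (A E : ℝ) (j : ℤ) : State × State →ₗ[ℂ] ℂ :=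
  (edgeIntegral j (fun t => phase A (j * π) t * (E * (1 - (t - j * π : ℝ) / π)))
    ((continuous_phase _ _).mul (by fun_prop))) ∘ₗ
      (PiLp.projₗ 2 _ 0) ∘ₗ (LinearMap.fst ℂ State State)

/-- Green's identity with the affine weight that is 1 at the left and 0 at the right end. The
resulting linear functionals serve to separate the eigenfunctions that vanish at all vertices. -/
theorem derivValue_eq {A E : ℝ} {j : ℤ} {f g : ℝ → ℂ} {u v : State}
    (hu : f =ᵐ[volume.restrict (Ioo (j * π) ((j + 1) * π))] u 0)
    (h : IsQuasiDeriv A (j * π) ((j + 1) * π) f g)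
    (h' : IsQuasiDeriv A (j * π) ((j + 1) * π) g (fun t => -(E * f t + (fun _ => (0 : ℂ)) t)))
    (hl : f (j * π) = 0) (hr : f ((j + 1) * π) = 0) :
    derivValue A E j (u, v) = g (j * π) := by
  have hπ : (π : ℂ) ≠ 0 := by exact_mod_cast Real.pi_ne_zero
  have h0 : ∀ x : ℝ, HasDerivAt (fun x : ℝ => (1 - (x - j * π : ℝ) / π : ℂ)) (-(1 / π)) x := by
    intro x
    simpa using ((((hasDerivAt_id x).sub_const (j * π)).ofReal_comp).div_const (π : ℂ)).const_sub 1
  have hg := h.green h' (left_lt_right j).le h0 (fun x => hasDerivAt_const x _) continuous_const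
    (right_mem_Icc.2 (left_lt_right j).le)
  rw [hl, hr, right_sub_left, sub_self, div_self hπ] at hg
  simp only [sub_self, mul_zero, zero_mul, sub_zero, Complex.ofReal_zero, zero_div, mul_one,
    add_zero] at hg
  have e : derivValue A E j (u, v) = -∫ t in (j * π : ℝ)..(j + 1) * π, phase A (j * π) t *
      (-(E * f t) * (1 - (t - j * π : ℝ) / π : ℂ)) := by
    rw [← intervalIntegral.integral_neg]
    refine intervalIntegral.integral_congr_ae ?_
    rw [restrict_Ioo_eq_restrict_Ioc, Filter.EventuallyEq,
      ae_restrict_iff' measurableSet_Ioc] at hu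
    filter_upwards [hu] with t ht htx
    rw [uIoc_of_le (left_lt_right j).le] at htx
    change phase A (j * π) t * (E * (1 - (t - j * π : ℝ) / π)) * u 0 t = _
    rw [← ht htx]
    ring
  rw [e]
  linear_combination hg

/-- Initial derivatives of an eigenfunction supported by the rings `m` and `m + 1`. -/
def flatData (A C : ℝ) (m : ℤ) (σ : Fin 2) (j : ℤ) : ℂ :=
  if j = m then (if σ = 0 then 1 else -1) else
    if j = m + 1 then (if σ = 0 then -C * Complex.exp (Complex.I * (A * π)) else
      C * Complex.exp (-(Complex.I * (A * π)))) else 0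

/-- When S = 0, a derivative is transported along an edge by the factor C times a phase. The slopes
1 and -1 balance at the vertex m, the slopes on the ring m + 1 absorb what arrives from the ring m,
and at m + 2 the phases cancel. A single ring would not suffice for a general flux. -/
theorem flatData_delta {A C : ℝ} (hC : C ^ 2 = 1) (m j : ℤ) :
    flatData A C m 0 j + flatData A C m 1 j -
      C * Complex.exp (-(Complex.I * (A * π))) * flatData A C m 0 (j - 1) -
      C * Complex.exp (Complex.I * (A * π)) * flatData A C m 1 (j - 1) = 0 := by
  have hC' : (C : ℂ) ^ 2 = 1 := by exact_mod_cast hC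
  have he : Complex.exp (Complex.I * (A * π)) * Complex.exp (-(Complex.I * (A * π))) = 1 := by
    rw [← Complex.exp_add, add_neg_cancel, Complex.exp_zero]
  unfold flatData
  by_cases h1 : j = m
  · subst h1
    have : j - 1 ≠ j + 1 := by omega
    simp [this]
  by_cases h2 : j = m + 1
  · subst h2; simp
  by_cases h3 : j = m + 2
  · subst h3
    have : m + 2 - 1 = m + 1 := by ring
    simp [this]; ring
  have h4 : j - 1 ≠ m := by omega
  have h5 : j - 1 ≠ m + 1 := by omega
  simp [h1, h2, h4, h5]

theorem sqSummable_flatData (A C : ℝ) (m : ℤ) (σ : Fin 2) : SqSummable (flatData A C m σ) :=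
  .of_finite {m, m + 1} fun j hj => by
    simp only [Finset.mem_insert, Finset.mem_singleton, not_or] at hj
    simp [flatData, hj.1, hj.2]

theorem exists_flat_eigenfunction {A E : ℝ} (α : ℤ → ℝ) (hS : solS E π = 0) (m : ℤ) :
    ∃ p ∈ hamiltonianGraph A α ⊓ LinearMap.ker (shiftMap E),
      ∀ j, derivValue A E j p = flatData A (solC E π) m 0 j := by
  have hC : solC E π ^ 2 = 1 := by
    have := solC_sq_add E π
    rwa [hS, zero_pow two_ne_zero, mul_zero, add_zero] at this
  obtain ⟨u, f, g, hu, h1, h2, hf, hg⟩ := exists_state_of_initial_values A E 0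
    (φ := fun _ _ => 0) (fun _ => .of_finite ∅ fun _ _ => rfl) (sqSummable_flatData A (solC E π) m)
  have hz : ((0 : Lp ℂ 2 (volume : Measure ℝ)) : ℝ → ℂ) =ᵐ[volume] fun _ => (0 : ℂ) :=
    Lp.coeFn_zero ℂ 2 volume
  have h3 : ∀ σ (j : ℤ), IsQuasiDeriv (potential A σ) (j * π) ((j + 1) * π) (g σ j)
      (fun t => -(E * f σ j t + (fun _ => (0 : ℂ)) t)) := fun σ j => by
    refine (h2 σ j).congr ?_
    filter_upwards [ae_restrict_of_ae hz] with t ht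
    exact congrArg (fun z => -(E * f σ j t + z)) ht
  have hn := fun B (j : ℤ) => phase_ne_zero B (j * π) ((j + 1) * π)
  have hr : ∀ σ (j : ℤ), f σ j ((j + 1) * π) = 0 := fun σ j => by
    have e := (h1 σ j).eq_solution (h3 σ j) (left_lt_right j).le
      (right_mem_Icc.2 (left_lt_right j).le)
    rw [hf, hg, right_sub_left, hS] at e
    simpa [hn] using e
  have hgr : ∀ σ (j : ℤ), g σ j ((j + 1) * π) = solC E π *
      Complex.exp (-(Complex.I * (potential A σ * π))) * flatData A (solC E π) m σ j := fun σ j => by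
    have e := (h1 σ j).deriv_eq_solution (h3 σ j) (left_lt_right j).le
      (right_mem_Icc.2 (left_lt_right j).le)
    rw [hf, hg, right_sub_left, hS] at e
    simp only [mul_zero, zero_mul, intervalIntegral.integral_zero, sub_zero] at e
    have h4 := phase_mul_phase (potential A σ) ((j + 1) * π) (j * π) ((j + 1) * π)
    rw [phase_self, phase_edge_symm] at h4
    linear_combination (Complex.exp (-(Complex.I * (potential A σ * π)))) * e -
      g σ j ((j + 1) * π) * h4
  have hj : ∀ j : ℤ, ((j - 1 : ℤ) : ℝ) + 1 = j := fun j => by push_cast; ring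
  have hr' : ∀ σ (j : ℤ), f σ (j - 1) (j * π) = 0 := fun σ j => by
    have := hr σ (j - 1)
    rwa [hj] at this
  have hgr' := fun σ (j : ℤ) => hgr σ (j - 1)
  simp only [hj] at hgr'
  have hc : IsComponents A α u ((E : ℂ) • u + 0) f g := by
    refine ⟨hu, h1, deriv_two_of_ae hu h2, fun j => ?_, fun j => ?_⟩
    · rw [hf, hf, hr', hr']; exact ⟨rfl, rfl, rfl⟩
    · rw [hf, hg, hg, hgr', hgr', potential_zero, potential_one, Complex.ofReal_neg, neg_mul,
        mul_neg, neg_neg, flatData_delta hC, mul_zero]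
  refine ⟨(u, (E : ℂ) • u), ⟨⟨f, g, by simpa using hc⟩, mem_ker_shiftMap.2 rfl⟩, fun j => ?_⟩
  rw [← hg]
  exact derivValue_eq (hu 0 j) (potential_zero A ▸ h1 0 j) (potential_zero A ▸ h3 0 j) (hf 0 j)
    (hr 0 j)

/-- At the Dirichlet eigenvalues of the edges there are infinitely many eigenfunctions. -/
theorem mem_essentialSpectrum_of_solS {A E : ℝ} (α : ℤ → ℝ) (hS : solS E π = 0) :
    E ∈ essentialSpectrum (hamiltonian A α) := by
  rw [mem_essentialSpectrum_iff]
  rintro ⟨hfin, -⟩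
  choose p hp hd using exists_flat_eigenfunction (A := A) α hS
  -- The eigenfunction with index m lives on the rings m and m + 1, so even indices give disjoint
  -- supports.
  have hli : LinearIndependent ℂ fun i : ℤ =>
      (⟨p (2 * i), hp (2 * i)⟩ : ↥(hamiltonianGraph A α ⊓ LinearMap.ker (shiftMap E))) := by
    rw [linearIndependent_iff']
    intro s a hs i hi
    have h1 := congrArg (fun x => derivValue A E (2 * i) x.1) hs
    simp only [Submodule.coe_sum, Submodule.coe_smul, map_sum, map_smul, hd,
      Submodule.coe_zero, map_zero] at h1
    rw [Finset.sum_eq_single i] at h1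
    · simpa [flatData] using h1
    · intro k _ hk
      have h2 : (2 * i : ℤ) ≠ 2 * k := by omega
      have h3 : (2 * i : ℤ) ≠ 2 * k + 1 := by omega
      simp [flatData, h2, h3]
    · exact fun h => (h hi).elim
  have := hli.finite
  exact not_finite ℤ

/-! ### The bands -/

theorem hasDerivAt_cubic (x : ℝ) : HasDerivAt cubic
    (-1 + 4 / π * x - 3 / π ^ 2 * x ^ 2 : ℂ) x := by
  simpa using hasDerivAt_cubic_sub 0 x

theorem hasDerivAt_cubic_deriv (x : ℝ) : HasDerivAt
    (fun x : ℝ => (-1 + 4 / π * x - 3 / π ^ 2 * x ^ 2 : ℂ)) (cubicDeriv₂ x) x := by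
  simpa using hasDerivAt_cubic_deriv_sub 0 x

theorem cubic_pi : cubic π = 0 := by
  have hπ : (π : ℂ) ≠ 0 := by exact_mod_cast Real.pi_ne_zero
  rw [cubic]; field_simp; ring

theorem cubic_deriv_pi : (-1 + 4 / π * π - 3 / π ^ 2 * π ^ 2 : ℂ) = 0 := by
  have hπ : (π : ℂ) ≠ 0 := by exact_mod_cast Real.pi_ne_zero
  field_simp; ring

/-- With χ = `cubic`, the integrand is the derivative of χ'(t)S(π - t) + χ(t)C(π - t), and only
χ'(0) = -1 survives at the ends. Together with `integral_cubic_right`, this gives an inhomogeneity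
on one edge that acts at its left vertex only. -/
theorem integral_cubic_left (E : ℝ) :
    ∫ t in (0 : ℝ)..π, (cubicDeriv₂ t + E * cubic t) * solS E (π - t) = solS E π := by
  have hc := continuous_cubic
  have hc2 := continuous_cubicDeriv₂
  have hs := continuous_solS E
  rw [intervalIntegral.integral_eq_sub_of_hasDerivAt (f := fun t : ℝ =>
    (-1 + 4 / π * t - 3 / π ^ 2 * t ^ 2 : ℂ) * solS E (π - t) + cubic t * solC E (π - t))
    (fun t _ => ?_) (Continuous.intervalIntegrable (by fun_prop) _ _)]
  · rw [cubic_pi, cubic_deriv_pi]; simp [cubic]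
  · refine (((hasDerivAt_cubic_deriv t).mul (hasDerivAt_solS_const_sub E π t)).add
      ((hasDerivAt_cubic t).mul (hasDerivAt_solC_const_sub E π t))).congr_deriv ?_
    ring

theorem integral_cubic_right (E : ℝ) :
    ∫ t in (0 : ℝ)..π, (cubicDeriv₂ t + E * cubic t) * solS E t = 0 := by
  have hc := continuous_cubic
  have hc2 := continuous_cubicDeriv₂
  have hs := continuous_solS E
  rw [intervalIntegral.integral_eq_sub_of_hasDerivAt (f := fun t : ℝ =>
    (-1 + 4 / π * t - 3 / π ^ 2 * t ^ 2 : ℂ) * solS E t - cubic t * solC E t)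
    (fun t _ => ?_) (Continuous.intervalIntegrable (by fun_prop) _ _)]
  · rw [cubic_pi, cubic_deriv_pi]; simp [cubic]
  · refine (((hasDerivAt_cubic_deriv t).mul (hasDerivAt_solS E t).ofReal_comp).sub
      ((hasDerivAt_cubic t).mul (hasDerivAt_solC E t).ofReal_comp)).congr_deriv ?_
    push_cast; ring

/-- Every square summable sequence is the inhomogeneity of the difference equation for some
state. -/
theorem exists_source_eq {A E : ℝ} (hS : solS E π ≠ 0) {b : ℤ → ℂ} (hb : SqSummable b) :
    ∃ w : State, ∀ j, source A E j w = b j := by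
  have hS' : (solS E π : ℂ) ≠ 0 := by exact_mod_cast hS
  have hc := continuous_cubic
  have hc2 := continuous_cubicDeriv₂
  have hn := phase_ne_zero A
  have hcp := fun a => (continuous_phase A a).inv₀ (hn a)
  set ω : ℝ → ℂ := fun s => cubicDeriv₂ s + E * cubic s
  have hω : Continuous ω := by fun_prop
  obtain ⟨K, hK⟩ := (isCompact_Icc (a := 0) (b := π)).exists_bound_of_continuousOn hω.continuousOn
  set k : ℤ → ℂ := fun j => -(solS E π : ℂ)⁻¹ * b j
  -- The inverse phase cancels the one in the source functionals; the `j`-th piece then contributes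
  -- `b j` at the vertex `j` and nothing at `j + 1`.
  set F : ℤ → ℝ → ℂ := fun j t => k j * ((phase A (j * π) t)⁻¹ * ω (t - j * π))
  obtain ⟨u, hu⟩ := exists_Lp_of_edges (F := F) (K := fun j => K * ‖k j‖)
    (fun j => (continuous_const.mul ((hcp _).mul (hω.comp (by fun_prop)))).continuousOn)
    (fun j x hx => by
      have hx0 : x - j * π ∈ Icc 0 π :=
        ⟨by linarith [hx.1], by linarith [hx.2, right_sub_left j]⟩
      simp only [F]
      rw [norm_mul (k j), norm_mul (phase A (j * π) x)⁻¹, norm_inv, norm_phase, inv_one, one_mul,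
        mul_comm]
      exact mul_le_mul_of_nonneg_right (hK _ hx0) (norm_nonneg _))
    (summable_const_mul_sq (hb.const_mul _) K)
  have hint : ∀ (j : ℤ) (χ : ℝ → ℂ) (hχ : Continuous χ), edgeIntegral j χ hχ u =
      ∫ t in (j * π : ℝ)..(j + 1) * π, χ t * F j t := fun j χ hχ => by
    refine intervalIntegral.integral_congr_ae ?_
    have := hu j
    rw [edge, restrict_Ioo_eq_restrict_Ioc, Filter.EventuallyEq,
      ae_restrict_iff' measurableSet_Ioc] at this
    filter_upwards [this] with t ht htx
    rw [uIoc_of_le (left_lt_right j).le] at htx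
    rw [ht htx]
  have hl : ∀ j, sourceLeft A E 0 j u = -b j := fun j => by
    rw [sourceLeft, hint, potential_zero]
    have e1 : ∀ t, phase A (j * π) t * solS E ((j + 1) * π - t) * F j t =
        (fun s => k j * (ω s * solS E (π - s))) (t - j * π) := fun t => by
      simp only [F, show π - (t - j * π) = (j + 1) * π - t by ring]
      have := mul_inv_cancel₀ (hn (j * π) t)
      linear_combination (k j * ω (t - j * π) * solS E ((j + 1) * π - t)) * this
    simp only [e1]
    rw [intervalIntegral.integral_comp_sub_right (fun s => k j * (ω s * solS E (π - s))),
      sub_self, right_sub_left, intervalIntegral.integral_const_mul, integral_cubic_left]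
    simp only [k]
    field_simp
  have hr : ∀ j, sourceRight A E 0 j u = 0 := fun j => by
    rw [sourceRight, hint, potential_zero]
    have e1 : ∀ t, phase A ((j + 1) * π) t * solS E (t - j * π) * F j t =
        (fun s => phase A ((j + 1) * π) (j * π) * k j * (ω s * solS E s)) (t - j * π) := fun t => by
      simp only [F]
      have h1 := mul_inv_cancel₀ (hn (j * π) t)
      have h2 := phase_mul_phase A ((j + 1) * π) (j * π) t
      rw [← h2]
      linear_combination (phase A ((j + 1) * π) (j * π) * k j * ω (t - j * π) *
        solS E (t - j * π)) * h1
    simp only [e1]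
    rw [intervalIntegral.integral_comp_sub_right
      (fun s => phase A ((j + 1) * π) (j * π) * k j * (ω s * solS E s)),
      sub_self, right_sub_left, intervalIntegral.integral_const_mul, integral_cubic_right, mul_zero]
  refine ⟨WithLp.toLp 2 ![u, 0], fun j => ?_⟩
  rw [source_apply]
  simp [hl, hr]

/-- In a band, the modulated block sums of the inhomogeneity tend to zero. -/
theorem tendsto_block_sum {c η θ : ℝ} (h : η = c * Real.cos θ) {φ b : ℤ → ℂ} (hφ : SqSummable φ)
    (hb : ∀ j, 2 * c * (φ (j + 1) + φ (j - 1)) - 4 * η * φ j = b j) :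
    Tendsto (fun k : ℕ => ∑ n ∈ (Finset.Ico (2 ^ k) (2 ^ (k + 1)) : Finset ℕ),
      Complex.exp (Complex.I * θ) ^ n * b n) atTop (nhds 0) := by
  set z := Complex.exp (Complex.I * θ)
  have hz : ‖z‖ = 1 := by
    simp only [z]; rw [mul_comm]; exact Complex.norm_exp_ofReal_mul_I θ
  have hz0 : z ≠ 0 := Complex.exp_ne_zero _
  have hc : z + z⁻¹ = 2 * Real.cos θ := by
    simp only [z]
    rw [← Complex.exp_neg, Complex.ofReal_cos, Complex.cos, mul_div_cancel₀ _ two_ne_zero]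
    congr 2 <;> ring
  -- The discrete Wronskian of φ and the bounded homogeneous solution z^n, which exists because η =
  -- c cos θ. Its increments are z^n b_n, so sums over blocks telescope, and it tends to zero with
  -- φ.
  set Y : ℕ → ℂ := fun n => 2 * c * (z⁻¹ * z ^ n * (φ n - z * φ (n - 1)))
  have hY : Tendsto Y atTop (nhds 0) := by
    have hφ0 : Tendsto (fun n : ℕ => φ n) atTop (nhds 0) := by
      have := hφ.tendsto.comp (Nat.cast_injective (R := ℤ)).tendsto_cofinite
      rwa [Nat.cofinite_eq_atTop] at this
    have hφ1 : Tendsto (fun n : ℕ => φ (n - 1)) atTop (nhds 0) := by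
      have := (hφ.shift (-1)).tendsto.comp (Nat.cast_injective (R := ℤ)).tendsto_cofinite
      rwa [Nat.cofinite_eq_atTop] at this
    have h1 : Tendsto (fun n : ℕ => ‖φ n‖ + ‖φ (n - 1)‖) atTop (nhds 0) := by
      simpa using hφ0.norm.add hφ1.norm
    have h2 : Tendsto (fun n : ℕ => z⁻¹ * z ^ n * (φ n - z * φ (n - 1))) atTop (nhds 0) := by
      refine squeeze_zero_norm (fun n => ?_) h1
      rw [norm_mul, norm_mul, norm_inv, norm_pow, hz, one_pow, inv_one, one_mul, one_mul]
      refine (norm_sub_le _ _).trans ?_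
      rw [norm_mul, hz, one_mul]
    simpa using h2.const_mul (2 * c : ℂ)
  have hstep : ∀ n : ℕ, z ^ n * b n = Y (n + 1) - Y n := fun n => by
    have e1 : φ (((n + 1 : ℕ) : ℤ) - 1) = φ n := by congr 1; push_cast; ring
    have e2 : φ ((n + 1 : ℕ) : ℤ) = φ (n + 1) := by congr 1
    have e3 := mul_inv_cancel₀ hz0
    simp only [Y]
    rw [e1, e2, ← hb n, h, pow_succ, Complex.ofReal_mul]
    linear_combination (2 * c * φ n * z ^ n) * hc -
      (2 * c * z ^ n * (φ (n + 1) - z * φ n + φ (n - 1))) * e3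
  have hsum : ∀ k : ℕ, ∑ n ∈ (Finset.Ico (2 ^ k) (2 ^ (k + 1)) : Finset ℕ), z ^ n * b n =
      Y (2 ^ (k + 1)) - Y (2 ^ k) := fun k => by
    simp only [hstep]
    exact Finset.sum_Ico_sub Y (Nat.pow_le_pow_right two_pos k.le_succ)
  simp only [hsum]
  have hp : Tendsto (fun k : ℕ => 2 ^ k) atTop atTop :=
    tendsto_pow_atTop_atTop_of_one_lt one_lt_two
  simpa using (hY.comp (hp.comp (tendsto_add_atTop_nat 1))).sub (hY.comp hp)

/-- A square summable sequence that is large on dyadic blocks of class `i`. -/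
def blockSeq (z : ℂ) (i : ℕ) (j : ℤ) : ℂ :=
  if 0 < j ∧ (Nat.log 2 j.toNat).unpair.1 = i then
    (z⁻¹) ^ j.toNat * ((2 : ℂ) ^ Nat.log 2 j.toNat)⁻¹ else 0

theorem sqSummable_blockSeq {z : ℂ} (hz : ‖z‖ = 1) (i : ℕ) : SqSummable (blockSeq z i) := by
  have hs : Summable fun j : ℤ => (2 * |(j : ℝ)|⁻¹) ^ 2 := by
    refine summable_const_mul_sq ?_ 2
    have := Real.summable_one_div_int_pow.2 (one_lt_two)
    simpa using this
  refine .of_norm_le hs fun j => ?_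
  unfold blockSeq
  split_ifs with h
  · have hj : ((j.toNat : ℕ) : ℝ) = j := by
      exact_mod_cast congrArg (Int.cast (R := ℝ)) (Int.toNat_of_nonneg h.1.le)
    have hj0 : (0 : ℝ) < j := by exact_mod_cast h.1
    rw [norm_mul, norm_pow, norm_inv, hz, inv_one, one_pow, one_mul, norm_inv, norm_pow,
      Complex.norm_ofNat, abs_of_pos hj0, ← div_eq_mul_inv, inv_le_comm₀ (by positivity)
      (by positivity), inv_div, div_le_iff₀ two_pos, ← pow_succ]
    have := (Nat.lt_pow_succ_log_self one_lt_two j.toNat).le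
    rw [← hj]
    exact_mod_cast this
  · rw [norm_zero]; positivity

theorem block_sum_blockSeq {z : ℂ} (hz : z ≠ 0) (i k : ℕ) :
    ∑ n ∈ (Finset.Ico (2 ^ k) (2 ^ (k + 1)) : Finset ℕ), z ^ n * blockSeq z i n =
      if k.unpair.1 = i then 1 else 0 := by
  have h : ∀ n ∈ (Finset.Ico (2 ^ k) (2 ^ (k + 1)) : Finset ℕ), z ^ n * blockSeq z i n =
      if k.unpair.1 = i then ((2 : ℂ) ^ k)⁻¹ else 0 := fun n hn => by
    rw [Finset.mem_Ico] at hn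
    have hl : Nat.log 2 n = k := Nat.log_eq_of_pow_le_of_lt_pow hn.1 hn.2
    have hn0 : (0 : ℤ) < n := by exact_mod_cast (pow_pos two_pos k).trans_le hn.1
    unfold blockSeq
    rw [Int.toNat_natCast, hl]
    simp only [hn0, true_and]
    split_ifs with h
    · rw [← mul_assoc, ← mul_pow, mul_inv_cancel₀ hz, one_pow, one_mul]
    · rw [mul_zero]
  rw [Finset.sum_congr rfl h, Finset.sum_const, Nat.card_Ico, pow_succ]
  split_ifs
  · rw [show 2 ^ k * 2 - 2 ^ k = 2 ^ k by omega, nsmul_eq_mul]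
    push_cast
    exact mul_inv_cancel₀ (pow_ne_zero _ two_ne_zero)
  · rw [smul_zero]

/-- For sources in the range, the modulated sums over dyadic blocks tend to zero. The block sequence
of class i has sum 1 on the infinitely many blocks of its class and 0 on all others, so these
sequences are independent modulo the range, whose codimension is therefore infinite. -/
theorem mem_essentialSpectrum_of_abs_le {A α E : ℝ} (hS : solS E π ≠ 0)
    (h : |disc α E| ≤ |Real.cos (A * π)|) :
    E ∈ essentialSpectrum (periodicHamiltonian A α) := by
  rw [periodicHamiltonian, mem_essentialSpectrum_iff]
  rintro ⟨-, hfin⟩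
  set c := Real.cos (A * π) with hc_def
  obtain ⟨θ, hθ⟩ : ∃ θ, disc α E = c * Real.cos θ := by
    rcases eq_or_ne c 0 with hc | hc
    · rw [hc, abs_zero, abs_nonpos_iff] at h
      exact ⟨0, by rw [h, hc, zero_mul]⟩
    · refine ⟨Real.arccos (disc α E / c), ?_⟩
      have : |disc α E / c| ≤ 1 := by
        rw [abs_div]; exact div_le_one_of_le₀ h (abs_nonneg _)
      rw [Real.cos_arccos (abs_le.1 this).1 (abs_le.1 this).2, mul_div_cancel₀ _ hc]
  set z := Complex.exp (Complex.I * θ) with hz_def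
  have hz : ‖z‖ = 1 := by
    rw [hz_def, mul_comm]; exact Complex.norm_exp_ofReal_mul_I θ
  choose w hw using fun i => exists_source_eq (A := A) hS (sqSummable_blockSeq hz i)
  have hli : LinearIndependent ℂ fun i : ℕ =>
      ((hamiltonianGraph A fun _ => α).map (shiftMap E)).mkQ (w i) := by
    rw [linearIndependent_iff']
    intro s a hs i hi
    simp only [← map_smul, ← map_sum] at hs
    rw [Submodule.mkQ_apply, Submodule.Quotient.mk_eq_zero] at hs
    obtain ⟨⟨u, v⟩, hp, hv⟩ := hs
    rw [shiftMap_apply] at hv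
    obtain rfl : v = (E : ℂ) • u + ∑ i ∈ s, a i • w i := by rw [← hv]; simp
    have hj := jacobi_vertexValue hp
    simp only [jacobi_const, map_sum, map_smul, hw] at hj
    have ht := tendsto_block_sum hθ (sqSummable_vertexValue A _) hj
    have hsum : ∀ k : ℕ, ∑ n ∈ (Finset.Ico (2 ^ k) (2 ^ (k + 1)) : Finset ℕ), z ^ n *
        ∑ i ∈ s, a i • blockSeq z i n = ∑ i ∈ s, a i * if k.unpair.1 = i then 1 else 0 := by
      intro k
      simp only [Finset.mul_sum, ← block_sum_blockSeq (Complex.exp_ne_zero (Complex.I * θ))]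
      rw [Finset.sum_comm]
      refine Finset.sum_congr rfl fun i _ => Finset.sum_congr rfl fun n _ => ?_
      rw [smul_eq_mul]; ring
    simp only [← hz_def, hsum] at ht
    -- Along the blocks of class `i` the block sum is constantly the coefficient `a i`, which must
    -- therefore be the limit zero.
    have hpair : Tendsto (fun m => Nat.pair i m) atTop atTop :=
      tendsto_atTop_mono (fun m => Nat.right_le_pair i m) tendsto_id
    have h2 := ht.comp hpair
    simp only [Function.comp_def, Nat.unpair_pair, mul_ite, mul_one, mul_zero,
      Finset.sum_ite_eq, hi, if_true] at h2
    exact tendsto_nhds_unique tendsto_const_nhds h2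
  have := hli.finite
  exact not_finite ℕ

/-- The essential spectrum of the periodic chain. -/
theorem mem_essentialSpectrum_periodic {A α E : ℝ} :
    E ∈ essentialSpectrum (periodicHamiltonian A α) ↔
      solS E π = 0 ∨ |disc α E| ≤ |Real.cos (A * π)| := by
  by_cases hS : solS E π = 0
  · simp only [hS, true_or, iff_true]
    exact mem_essentialSpectrum_of_solS _ hS
  · simp only [hS, false_or]
    refine ⟨fun h => ?_, mem_essentialSpectrum_of_abs_le hS⟩
    by_contra! h'
    exact not_mem_essentialSpectrum hS h' h

/-! ### Counting the solutions of the eigenvalue equation in a gap -/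

/-- The rate `τ = 4√(UV)`. -/
def rate (U V : ℝ → ℝ) (x : ℝ) : ℝ := 4 * √(U x * V x)

/-- The decay factor `λ = (√U - √V) / (√U + √V)`. -/
def decay (U V : ℝ → ℝ) (x : ℝ) : ℝ := (√(U x) - √(V x)) / (√(U x) + √(V x))

/-- `U` and `V` are continuously differentiable with negative derivatives on the open interval `J`,
unbounded at its left end, and `e` is the first zero of `UV`. -/
structure IsDescendingPair (J : Set ℝ) (U V : ℝ → ℝ) (e : ℝ) : Prop where
  isOpen : IsOpen J
  ordConnected : J.OrdConnected
  contDiffOn_left : ContDiffOn ℝ 1 U J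
  contDiffOn_right : ContDiffOn ℝ 1 V J
  deriv_left : ∀ x ∈ J, deriv U x < 0
  deriv_right : ∀ x ∈ J, deriv V x < 0
  mem : e ∈ J
  nonneg_left : 0 ≤ U e
  nonneg_right : 0 ≤ V e
  mul_eq : U e * V e = 0
  unbounded : ∀ K, ∃ x ∈ J, K < U x ∧ K < V x

/-- The part of `J` where both functions are positive. -/
def posPart (J : Set ℝ) (U V : ℝ → ℝ) : Set ℝ := {x ∈ J | 0 < U x ∧ 0 < V x}

section

variable {J : Set ℝ} {U V : ℝ → ℝ} {e : ℝ}

theorem abs_decay_lt_one {x : ℝ} (hU : 0 < U x) (hV : 0 < V x) : |decay U V x| < 1 := by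
  have h1 := Real.sqrt_pos.2 hU
  have h2 := Real.sqrt_pos.2 hV
  rw [decay, abs_div, abs_of_pos (add_pos h1 h2), div_lt_one (add_pos h1 h2), abs_lt]
  constructor <;> linarith

/-- For square roots a ≤ b with b² ≤ M one has (b - a)/(a + b) ≤ 1 - a/b ≤ 1 - ab/M. This controls
how fast |λ| can approach 1 when τ tends to zero. -/
theorem abs_decay_le {x M : ℝ} (hU : 0 < U x) (hV : 0 < V x) (hUM : U x ≤ M) (hVM : V x ≤ M) :
    |decay U V x| ≤ 1 - rate U V x / (4 * M) := by
  have h1 := Real.sqrt_pos.2 hU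
  have h2 := Real.sqrt_pos.2 hV
  have hM : 0 < M := hU.trans_le hUM
  rw [decay, rate, Real.sqrt_mul hU.le, abs_div, abs_of_pos (add_pos h1 h2), mul_div_mul_left _ _
    four_ne_zero]
  have e1 := Real.sq_sqrt hU.le
  have e2 := Real.sq_sqrt hV.le
  set a := √(U x)
  set b := √(V x)
  have key : ∀ {a b : ℝ}, 0 < a → 0 < b → a ≤ b → b ^ 2 ≤ M →
      (b - a) / (a + b) ≤ 1 - a * b / M := by
    intro a b ha hb hab hbM
    have hab' : a * b / M ≤ a / b := by
      rw [div_le_div_iff₀ hM hb]; nlinarith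
    have : (b - a) / (a + b) ≤ 1 - a / b := by
      rw [div_le_iff₀ (by positivity), show (1 - a / b) * (a + b) = b - a ^ 2 / b by field_simp; ring]
      have : a ^ 2 / b ≤ a := by rw [div_le_iff₀ hb]; nlinarith
      linarith
    linarith
  rcases le_total a b with h | h
  · rw [abs_sub_comm, abs_of_nonneg (sub_nonneg.2 h)]
    exact key h1 h2 h (by rw [e2]; exact hVM)
  · rw [abs_of_nonneg (sub_nonneg.2 h), add_comm a b, mul_comm a b]
    exact key h2 h1 h (by rw [e1]; exact hUM)

namespace IsDescendingPair

theorem strictAntiOn_left (h : IsDescendingPair J U V e) : StrictAntiOn U J :=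
  strictAntiOn_of_deriv_neg h.ordConnected.convex h.contDiffOn_left.continuousOn fun x hx =>
    h.deriv_left x (interior_subset hx)

theorem strictAntiOn_right (h : IsDescendingPair J U V e) : StrictAntiOn V J :=
  strictAntiOn_of_deriv_neg h.ordConnected.convex h.contDiffOn_right.continuousOn fun x hx =>
    h.deriv_right x (interior_subset hx)

/-- Before `e` both decreasing functions exceed their nonnegative values there; from `e` on, one of
them is no longer positive. -/
theorem mem_posPart_iff (h : IsDescendingPair J U V e) {x : ℝ} :
    x ∈ posPart J U V ↔ x ∈ J ∧ x < e := by
  refine ⟨fun hx => ⟨hx.1, ?_⟩, fun hx => ⟨hx.1, ?_, ?_⟩⟩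
  · by_contra! hle
    have h1 := h.strictAntiOn_left.antitoneOn h.mem hx.1 hle
    have h2 := h.strictAntiOn_right.antitoneOn h.mem hx.1 hle
    have := mul_pos (hx.2.1.trans_le h1) (hx.2.2.trans_le h2)
    rw [h.mul_eq] at this
    exact lt_irrefl _ this
  · exact h.nonneg_left.trans_lt (h.strictAntiOn_left hx.1 h.mem hx.2)
  · exact h.nonneg_right.trans_lt (h.strictAntiOn_right hx.1 h.mem hx.2)

theorem ordConnected_posPart (h : IsDescendingPair J U V e) : (posPart J U V).OrdConnected := by
  refine ⟨fun x hx y hy z hz => ?_⟩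
  rw [h.mem_posPart_iff] at hx hy ⊢
  exact ⟨h.ordConnected.out hx.1 hy.1 hz, hz.2.trans_lt hy.2⟩

theorem isOpen_posPart (h : IsDescendingPair J U V e) : IsOpen (posPart J U V) := by
  have : posPart J U V = J ∩ Iio e := by ext x; exact h.mem_posPart_iff
  rw [this]
  exact h.isOpen.inter isOpen_Iio

theorem contDiffOn_rate (h : IsDescendingPair J U V e) :
    ContDiffOn ℝ 1 (rate U V) (posPart J U V) := by
  have hs : posPart J U V ⊆ J := fun x hx => hx.1
  exact contDiffOn_const.mul (((h.contDiffOn_left.mono hs).mul (h.contDiffOn_right.mono hs)).sqrt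
    fun x hx => (mul_pos hx.2.1 hx.2.2).ne')

theorem contDiffOn_decay (h : IsDescendingPair J U V e) :
    ContDiffOn ℝ 1 (decay U V) (posPart J U V) := by
  have hs : posPart J U V ⊆ J := fun x hx => hx.1
  have h1 := (h.contDiffOn_left.mono hs).sqrt fun x hx => hx.2.1.ne'
  have h2 := (h.contDiffOn_right.mono hs).sqrt fun x hx => hx.2.2.ne'
  exact (h1.sub h2).div (h1.add h2) fun x hx =>
    (add_pos (Real.sqrt_pos.2 hx.2.1) (Real.sqrt_pos.2 hx.2.2)).ne'

theorem deriv_rate (h : IsDescendingPair J U V e) {x : ℝ} (hx : x ∈ posPart J U V) :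
    deriv (rate U V) x < 0 := by
  have hJ := h.isOpen.mem_nhds hx.1
  have d1 := ((h.contDiffOn_left.contDiffAt hJ).differentiableAt (by norm_num)).hasDerivAt
  have d2 := ((h.contDiffOn_right.contDiffAt hJ).differentiableAt (by norm_num)).hasDerivAt
  have hp := mul_pos hx.2.1 hx.2.2
  have d3 : HasDerivAt (rate U V) _ x := ((d1.mul d2).sqrt hp.ne').const_mul 4
  rw [d3.deriv]
  have h1 := h.deriv_left x hx.1
  have h2 := h.deriv_right x hx.1
  have : deriv U x * V x + U x * deriv V x < 0 := by nlinarith [hx.2.1, hx.2.2]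
  have h3 : 0 < 2 * √((U * V) x) := mul_pos two_pos (Real.sqrt_pos.2 hp)
  have := div_neg_of_neg_of_pos this h3
  linarith

theorem strictAntiOn_rate (h : IsDescendingPair J U V e) :
    StrictAntiOn (rate U V) (posPart J U V) :=
  strictAntiOn_of_deriv_neg h.ordConnected_posPart.convex h.contDiffOn_rate.continuousOn
    fun _ hx => h.deriv_rate (interior_subset hx)

theorem rate_pos {x : ℝ} (hx : x ∈ posPart J U V) : 0 < rate U V x :=
  mul_pos four_pos (Real.sqrt_pos.2 (mul_pos hx.2.1 hx.2.2))

theorem exists_rate_gt (h : IsDescendingPair J U V e) (K : ℝ) :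
    ∃ x ∈ posPart J U V, K < rate U V x := by
  obtain ⟨x, hx, h1, h2⟩ := h.unbounded |K|
  have h1' := (abs_nonneg K).trans_lt h1
  have h2' := (abs_nonneg K).trans_lt h2
  refine ⟨x, ⟨hx, h1', h2'⟩, ?_⟩
  have : |K| < √(U x * V x) := Real.lt_sqrt_of_sq_lt (by nlinarith [abs_nonneg K])
  rw [rate]
  linarith [le_abs_self K, abs_nonneg K]

theorem exists_rate_lt (h : IsDescendingPair J U V e) {k : ℝ} (hk : 0 < k) :
    ∃ x ∈ posPart J U V, rate U V x < k := by
  have hJ := h.isOpen.mem_nhds h.mem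
  have c1 := (h.contDiffOn_left.contDiffAt hJ).continuousAt
  have c2 := (h.contDiffOn_right.contDiffAt hJ).continuousAt
  have c3 : ContinuousAt (rate U V) e := continuousAt_const.mul (c1.mul c2).sqrt
  have h0 : rate U V e = 0 := by rw [rate, h.mul_eq, Real.sqrt_zero, mul_zero]
  have h1 : ∀ᶠ x in nhds e, rate U V x < k := c3.eventually_lt_const (by rwa [h0])
  have h2 := (h1.and hJ).filter_mono (nhdsWithin_le_nhds (s := Iio e))
  obtain ⟨x, hx, hxe⟩ := (h2.and self_mem_nhdsWithin).exists
  exact ⟨x, h.mem_posPart_iff.2 ⟨hx.2, hxe⟩, hx.1⟩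

end IsDescendingPair

/-- Bernoulli's inequality 1 + Ns ≤ (1 + s)^N combined with (1 - s)^N (1 + s)^N ≤ 1. -/
theorem one_sub_pow_ge {s : ℝ} (hs : 0 ≤ s) (hs1 : s ≤ 1) (N : ℕ) :
    N * s / (1 + N * s) ≤ 1 - (1 - s) ^ N := by
  have h1 : (1 - s) ^ N * (1 + N * s) ≤ 1 := by
    calc (1 - s) ^ N * (1 + N * s) ≤ (1 - s) ^ N * (1 + s) ^ N := by
          refine mul_le_mul_of_nonneg_left (one_add_mul_le_pow (by linarith) N)
            (pow_nonneg (by linarith) N)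
      _ = (1 - s ^ 2) ^ N := by rw [← mul_pow]; ring
      _ ≤ 1 := pow_le_one₀ (by nlinarith) (by nlinarith)
  rw [div_le_iff₀ (by positivity)]
  nlinarith

/-- A solution curve `κ` of the eigenvalue equation: a function that is Lipschitz near zero, bounded,
and bounded from below by a multiple of `1 - Λ`. -/
structure IsBranch (κ : ℝ → ℝ) : Prop where
  lower : ∃ k > 0, ∀ x, 0 ≤ x → x < 1 → k * (1 - x) ≤ κ x
  upper : ∃ K, ∀ x, 0 ≤ x → x ≤ 1 → κ x ≤ K
  lipschitz : ∃ L, 0 ≤ L ∧ ∀ x y, 0 ≤ x → x ≤ 1 / 2 → 0 ≤ y → y ≤ 1 / 2 →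
    |κ x - κ y| ≤ L * |x - y|

theorem abs_pow_sub_pow_le_mul {x y q : ℝ} (hx : |x| ≤ q) (hy : |y| ≤ q) (N : ℕ) :
    |(|x| ^ N) - |y| ^ N| ≤ N * q ^ (N - 1) * |x - y| := by
  have h1 := abs_pow_sub_pow_le |x| |y| N
  have hq : 0 ≤ q := (abs_nonneg x).trans hx
  rw [abs_abs, abs_abs] at h1
  calc |(|x| ^ N) - |y| ^ N| ≤ |(|x| - |y|)| * N * max |x| |y| ^ (N - 1) := h1
    _ ≤ |x - y| * N * q ^ (N - 1) := by
        refine mul_le_mul (mul_le_mul_of_nonneg_right (abs_abs_sub_abs_le_abs_sub x y)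
          (by positivity)) (pow_le_pow_left₀ (le_max_of_le_left (abs_nonneg _)) (max_le hx hy) _)
          (by positivity) (by positivity)
    _ = _ := by ring

/-- **The counting lemma.** For large `N` the equation `τ = κ(|λ|^N)` has a unique solution, and it
is exponentially close to the solution of `τ = κ(0)`. -/
theorem IsDescendingPair.existsUnique (h : IsDescendingPair J U V e) {κ : ℝ → ℝ}
    (hκ : IsBranch κ) : ∃ x₀ ∈ posPart J U V, rate U V x₀ = κ 0 ∧
      ∃ C q : ℝ, 0 < C ∧ 0 < q ∧ q < 1 ∧ ∀ᶠ N : ℕ in atTop,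
        (∃! x, x ∈ posPart J U V ∧ rate U V x = κ (|decay U V x| ^ N)) ∧
        ∀ x ∈ posPart J U V, rate U V x = κ (|decay U V x| ^ N) → |x - x₀| ≤ C * q ^ N := by
  obtain ⟨k, hk, hlow⟩ := hκ.lower
  obtain ⟨K, hK⟩ := hκ.upper
  obtain ⟨L, hL, hlip⟩ := hκ.lipschitz
  -- Left of `a` the rate exceeds every value of κ. At `b` it is below k/2, while κ(Λ) ≥ k/2 for Λ ≤
  -- 1/2.
  obtain ⟨a, ha, hKa⟩ := h.exists_rate_gt K
  obtain ⟨b, hb, hbk⟩ := h.exists_rate_lt (half_pos hk)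
  have hk0 : k ≤ κ 0 := by simpa using hlow 0 le_rfl one_pos
  have hK0 := hK 0 le_rfl zero_le_one
  have hab : a < b := by
    by_contra! hle
    have := h.strictAntiOn_rate.antitoneOn hb ha hle
    linarith
  have hsub : Icc a b ⊆ posPart J U V := h.ordConnected_posPart.out ha hb
  have hτc : ContinuousOn (rate U V) (Icc a b) := h.contDiffOn_rate.continuousOn.mono hsub
  have hdc : ContinuousOn (decay U V) (Icc a b) := h.contDiffOn_decay.continuousOn.mono hsub
  have hO := h.isOpen_posPart
  have hcd : ∀ x ∈ Icc a b, ContDiffAt ℝ 1 (decay U V) x := fun x hx =>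
    h.contDiffOn_decay.contDiffAt (hO.mem_nhds (hsub hx))
  have hcr : ∀ x ∈ Icc a b, ContDiffAt ℝ 1 (rate U V) x := fun x hx =>
    h.contDiffOn_rate.contDiffAt (hO.mem_nhds (hsub hx))
  -- the rate decreases uniformly
  obtain ⟨m, hm, hslope⟩ : ∃ m > 0, ∀ x ∈ Icc a b, ∀ y ∈ Icc a b,
      m * |x - y| ≤ |rate U V x - rate U V y| := by
    have hc : ContinuousOn (deriv (rate U V)) (Icc a b) :=
      (h.contDiffOn_rate.continuousOn_deriv_of_isOpen hO le_rfl).mono hsub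
    obtain ⟨z, hz, hmax⟩ := isCompact_Icc.exists_isMaxOn (nonempty_Icc.2 hab.le) hc
    refine ⟨-deriv (rate U V) z, by linarith [h.deriv_rate (hsub hz)], ?_⟩
    have key : ∀ x ∈ Icc a b, ∀ y ∈ Icc a b, x ≤ y →
        rate U V y - rate U V x ≤ deriv (rate U V) z * (y - x) :=
      (convex_Icc a b).image_sub_le_mul_sub_of_deriv_le hτc
        (fun x hx => ((hcr x (interior_subset hx)).differentiableAt
          (by norm_num)).differentiableWithinAt)
        fun x hx => hmax (interior_subset hx)
    intro x hx y hy
    rcases le_total x y with hxy | hxy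
    · have := key x hx y hy hxy
      rw [abs_sub_comm, abs_of_nonneg (sub_nonneg.2 hxy)]
      refine le_trans ?_ (le_abs_self _)
      linarith
    · have := key y hy x hx hxy
      rw [abs_of_nonneg (sub_nonneg.2 hxy), abs_sub_comm]
      refine le_trans ?_ (le_abs_self _)
      linarith
  -- the decay factor is Lipschitz
  obtain ⟨D, hD, hdl⟩ : ∃ D, 0 ≤ D ∧ ∀ x ∈ Icc a b, ∀ y ∈ Icc a b,
      |decay U V x - decay U V y| ≤ D * |x - y| := by
    have hc : ContinuousOn (deriv (decay U V)) (Icc a b) :=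
      (h.contDiffOn_decay.continuousOn_deriv_of_isOpen hO le_rfl).mono hsub
    obtain ⟨D, hD⟩ := isCompact_Icc.exists_bound_of_continuousOn hc
    refine ⟨D, (norm_nonneg _).trans (hD a (left_mem_Icc.2 hab.le)), fun x hx y hy => ?_⟩
    exact (convex_Icc a b).norm_image_sub_le_of_norm_deriv_le
      (fun x hx => (hcd x hx).differentiableAt (by norm_num)) hD hy hx
  obtain ⟨q, hq0, hq1, hdq⟩ : ∃ q, 0 < q ∧ q < 1 ∧ ∀ x ∈ Icc a b, |decay U V x| ≤ q := by
    obtain ⟨z, hz, hmax⟩ := isCompact_Icc.exists_isMaxOn (nonempty_Icc.2 hab.le) hdc.abs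
    refine ⟨max |decay U V z| (1 / 2), lt_max_of_lt_right (by norm_num),
      max_lt (abs_decay_lt_one (hsub hz).2.1 (hsub hz).2.2) (by norm_num),
      fun x hx => le_max_of_le_left (hmax hx)⟩
  -- the solution of the limit equation
  obtain ⟨x₀, hx₀, hx₀'⟩ : κ 0 ∈ rate U V '' Icc a b :=
    intermediate_value_Icc' hab.le hτc ⟨by linarith, by linarith⟩
  -- The estimate holds with L/m; the added 1 keeps the constant positive when L = 0.
  refine ⟨x₀, hsub hx₀, hx₀', L / m + 1, q, by positivity, hq0, hq1, ?_⟩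
  -- solutions lie in `[a, b]`
  set M := max (U a) (V a) with hM
  have hMpos : 0 < M := lt_max_of_lt_left ha.2.1
  have hloc : ∀ N : ℕ, 8 * M / k ≤ N → ∀ x ∈ posPart J U V,
      rate U V x = κ (|decay U V x| ^ N) → x ∈ Icc a b := by
    intro N hN x hx hsol
    have hN0 : (0 : ℝ) < N := lt_of_lt_of_le (by positivity) hN
    have hNne : N ≠ 0 := by rintro rfl; simp at hN0
    have hd1 := abs_decay_lt_one hx.2.1 hx.2.2
    have hp0 : 0 ≤ |decay U V x| ^ N := by positivity
    have hp1 : |decay U V x| ^ N < 1 := pow_lt_one₀ (abs_nonneg _) hd1 hNne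
    have hax : a ≤ x := by
      by_contra! hlt
      have h1 := h.strictAntiOn_rate hx ha hlt
      have h2 := hK _ hp0 hp1.le
      linarith
    refine ⟨hax, ?_⟩
    by_contra! hlt
    have h1 := h.strictAntiOn_rate hb hx hlt
    have hU : U x ≤ M := (h.strictAntiOn_left.antitoneOn ha.1 hx.1 hax).trans (le_max_left _ _)
    have hV : V x ≤ M := (h.strictAntiOn_right.antitoneOn ha.1 hx.1 hax).trans (le_max_right _ _)
    have h2 := abs_decay_le hx.2.1 hx.2.2 hU hV
    -- A solution beyond `b` has 4Ms = τ = κ(|λ|^N) ≥ kNs/(1 + Ns), hence kN ≤ 4M + 4MNs. Since 4M ≤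
    -- kN/2, this forces τ ≥ k/2, contrary to τ(x) < τ(b) < k/2.
    set s := rate U V x / (4 * M) with hs
    have hτ := IsDescendingPair.rate_pos hx
    have hs0 : 0 < s := by positivity
    have hs1 : s ≤ 1 := by linarith [abs_nonneg (decay U V x)]
    have h3 : |decay U V x| ^ N ≤ (1 - s) ^ N := pow_le_pow_left₀ (abs_nonneg _) h2 N
    have h4 := one_sub_pow_ge hs0.le hs1 N
    have h5 := hlow _ hp0 hp1
    have h6 : rate U V x = 4 * M * s := by rw [hs]; field_simp
    have h7 : k * (N * s / (1 + N * s)) ≤ 4 * M * s := by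
      rw [← h6, hsol]
      refine le_trans ?_ h5
      exact mul_le_mul_of_nonneg_left (by linarith) hk.le
    rw [← mul_div_assoc, div_le_iff₀ (by positivity)] at h7
    have h8 : k * N ≤ 4 * M * (1 + N * s) := by
      refine le_of_mul_le_mul_right ?_ hs0
      linarith
    rw [div_le_iff₀ hk] at hN
    have h9 : k * N ≤ 8 * M * (N * s) := by linarith
    have h10 : k ≤ 8 * M * s := by
      refine le_of_mul_le_mul_right ?_ hN0
      linarith
    linarith
  have e1 : ∀ᶠ N : ℕ in atTop, 8 * M / k ≤ N :=
    tendsto_natCast_atTop_atTop.eventually_ge_atTop _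
  have e2 : ∀ᶠ N : ℕ in atTop, q ^ N ≤ 1 / 2 :=
    (tendsto_pow_atTop_nhds_zero_of_lt_one hq0.le hq1).eventually_le_const (by norm_num)
  -- Eventually the Lipschitz constant of κ(|λ|^N) on [a, b] is smaller than the minimal slope `m`
  -- of the rate, so two solutions in [a, b] must coincide.
  have e3 : ∀ᶠ N : ℕ in atTop, L * (N * q ^ (N - 1) * D) < m := by
    have t1 : Tendsto (fun N : ℕ => L * (q⁻¹ * D) * (N * q ^ N)) atTop (nhds 0) := by
      simpa using (tendsto_self_mul_const_pow_of_lt_one hq0.le hq1).const_mul (L * (q⁻¹ * D))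
    filter_upwards [t1.eventually_lt_const hm, eventually_ge_atTop 1] with N hN hN1
    have : q ^ N = q * q ^ (N - 1) := by rw [← pow_succ', Nat.sub_add_cancel hN1]
    rw [this] at hN
    refine lt_of_eq_of_lt ?_ hN
    field_simp
  filter_upwards [e1, e2, e3] with N hN1 hN2 hN3
  have hpow : ∀ x ∈ Icc a b, |decay U V x| ^ N ≤ q ^ N := fun x hx =>
    pow_le_pow_left₀ (abs_nonneg _) (hdq x hx) N
  have hhalf : ∀ x ∈ Icc a b, |decay U V x| ^ N ≤ 1 / 2 := fun x hx => (hpow x hx).trans hN2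
  have hnn : ∀ x, 0 ≤ |decay U V x| ^ N := fun x => by positivity
  have hκlip : ∀ x ∈ Icc a b, ∀ y ∈ Icc a b,
      |κ (|decay U V x| ^ N) - κ (|decay U V y| ^ N)| ≤ L * (N * q ^ (N - 1) * D) * |x - y| := by
    intro x hx y hy
    calc |κ (|decay U V x| ^ N) - κ (|decay U V y| ^ N)|
        ≤ L * |(|decay U V x| ^ N) - |decay U V y| ^ N| :=
          hlip _ _ (hnn x) (hhalf x hx) (hnn y) (hhalf y hy)
      _ ≤ L * (N * q ^ (N - 1) * (D * |x - y|)) := by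
          refine mul_le_mul_of_nonneg_left ((abs_pow_sub_pow_le_mul (hdq x hx) (hdq y hy) N).trans
            (mul_le_mul_of_nonneg_left (hdl x hx y hy) (by positivity))) hL
      _ = _ := by ring
  refine ⟨?_, fun x hx hsol => ?_⟩
  · obtain ⟨x, hx, hsol⟩ : (0 : ℝ) ∈
        (fun x => rate U V x - κ (|decay U V x| ^ N)) '' Icc a b := by
      refine intermediate_value_Icc' hab.le (hτc.sub ?_) ⟨?_, ?_⟩
      · have : LipschitzOnWith (Real.toNNReal (L * (N * q ^ (N - 1) * D)))
            (fun x => κ (|decay U V x| ^ N)) (Icc a b) :=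
          LipschitzOnWith.of_dist_le_mul fun x hx y hy => by
            rw [Real.dist_eq, Real.dist_eq, Real.coe_toNNReal _ (by positivity)]
            exact hκlip x hx y hy
        exact this.continuousOn
      · have h1 := hlow _ (hnn b) ((hhalf b (right_mem_Icc.2 hab.le)).trans_lt (by norm_num))
        have h2 := hhalf b (right_mem_Icc.2 hab.le)
        show rate U V b - κ (|decay U V b| ^ N) ≤ 0
        nlinarith
      · have h1 := hK _ (hnn a) ((hhalf a (left_mem_Icc.2 hab.le)).trans (by norm_num))
        show 0 ≤ rate U V a - κ (|decay U V a| ^ N)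
        linarith
    refine ⟨x, ⟨hsub hx, sub_eq_zero.1 hsol⟩, ?_⟩
    rintro y ⟨hy, hsol'⟩
    have hy' := hloc N hN1 y hy hsol'
    have h1 := hslope y hy' x hx
    rw [hsol', sub_eq_zero.1 hsol] at h1
    have h2 := hκlip y hy' x hx
    by_contra hne
    have : 0 < |y - x| := abs_pos.2 (sub_ne_zero.2 hne)
    nlinarith
  · have hx' := hloc N hN1 x hx hsol
    have h1 := hslope x hx' x₀ hx₀
    rw [hsol, hx₀'] at h1
    have h2 := hlip _ _ (hnn x) (hhalf x hx') le_rfl (by norm_num)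
    rw [sub_zero, abs_of_nonneg (hnn x)] at h2
    have h3 := mul_le_mul_of_nonneg_left (hpow x hx') hL
    have h4 : |x - x₀| ≤ L / m * q ^ N := by
      rw [div_mul_eq_mul_div, le_div_iff₀ hm]; linarith
    have : 0 < q ^ N := by positivity
    linarith

end

/-! ### The two branches of the eigenvalue equation -/

/-- The larger root `κ` of `(κ - a) (κ - b) = a b x ^ 2`. -/
def upperBranch (a b x : ℝ) : ℝ := (a + b + √((a - b) ^ 2 + 4 * (a * b) * x ^ 2)) / 2

/-- The smaller root `κ` of `(κ - a) (κ - b) = a b x ^ 2`. -/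
def lowerBranch (a b x : ℝ) : ℝ := (a + b - √((a - b) ^ 2 + 4 * (a * b) * x ^ 2)) / 2

/-- If ab ≤ 0, the expression is smallest at x = 1, where it equals (a + b)². -/
theorem discrim_nonneg {a b x : ℝ} (hx0 : 0 ≤ x) (hx : x ≤ 1) :
    0 ≤ (a - b) ^ 2 + 4 * (a * b) * x ^ 2 := by
  have hx2 : x ^ 2 ≤ 1 := by nlinarith
  rcases le_total 0 (a * b) with h | h
  · positivity
  · nlinarith [mul_le_mul_of_nonpos_left hx2 h, sq_nonneg (a + b)]

theorem sub_upperBranch_mul_sub_lowerBranch {a b x : ℝ} (hx0 : 0 ≤ x) (hx : x ≤ 1) (t : ℝ) :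
    (t - upperBranch a b x) * (t - lowerBranch a b x) = (t - a) * (t - b) - a * b * x ^ 2 := by
  have := Real.sq_sqrt (discrim_nonneg (a := a) (b := b) hx0 hx)
  rw [upperBranch, lowerBranch]
  linear_combination -(1 / 4) * this

theorem eq_branch_iff {a b x : ℝ} (hx0 : 0 ≤ x) (hx : x ≤ 1) (t : ℝ) :
    (t - a) * (t - b) = a * b * x ^ 2 ↔ t = upperBranch a b x ∨ t = lowerBranch a b x := by
  rw [← sub_eq_zero, ← sub_upperBranch_mul_sub_lowerBranch hx0 hx, mul_eq_zero, sub_eq_zero,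
    sub_eq_zero]

theorem upperBranch_add_lowerBranch (a b x : ℝ) :
    upperBranch a b x + lowerBranch a b x = a + b := by
  rw [upperBranch, lowerBranch]; ring

theorem lowerBranch_le_upperBranch (a b x : ℝ) : lowerBranch a b x ≤ upperBranch a b x := by
  rw [upperBranch, lowerBranch]
  linarith [Real.sqrt_nonneg ((a - b) ^ 2 + 4 * (a * b) * x ^ 2)]

theorem upperBranch_mul_lowerBranch {a b x : ℝ} (hx0 : 0 ≤ x) (hx : x ≤ 1) :
    upperBranch a b x * lowerBranch a b x = a * b * (1 - x ^ 2) := by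
  have := sub_upperBranch_mul_sub_lowerBranch (a := a) (b := b) hx0 hx 0
  linear_combination this

/-- With X and Y the two roots, |X - Y|(X + Y) = |k|(x + y)|x - y|, while X + Y ≥ m(x + y). No
positive lower bound for the radicand is needed, so the case p = 0, that is a = b, is included. -/
theorem abs_sqrt_sub_sqrt_le {p k m L : ℝ} {s : Set ℝ} (hs : ∀ x ∈ s, 0 ≤ x ∧ m * x ≤ √(p + k * x ^ 2))
    (hp : ∀ x ∈ s, 0 ≤ p + k * x ^ 2) (hm : 0 < m) (hL : |k| ≤ L * m) {x y : ℝ} (hx : x ∈ s)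
    (hy : y ∈ s) : |√(p + k * x ^ 2) - √(p + k * y ^ 2)| ≤ L * |x - y| := by
  have h1 := Real.sq_sqrt (hp x hx)
  have h2 := Real.sq_sqrt (hp y hy)
  obtain ⟨x0, hxm⟩ := hs x hx
  obtain ⟨y0, hym⟩ := hs y hy
  set X := √(p + k * x ^ 2)
  set Y := √(p + k * y ^ 2)
  rcases eq_or_lt_of_le (add_nonneg x0 y0) with h0 | h0
  · have : x = y := by linarith
    subst this
    simp [X, Y]
  have hXY : 0 < X + Y := by nlinarith
  have hL0 : 0 ≤ L := by
    by_contra! h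
    nlinarith [abs_nonneg k]
  have e : |X - Y| * (X + Y) = |k| * (x + y) * |x - y| := by
    have e1 := abs_mul (X - Y) (X + Y)
    have e2 := abs_mul (k * (x + y)) (x - y)
    rw [abs_mul k, abs_of_pos h0] at e2
    rw [abs_of_pos hXY] at e1
    rw [← e1, ← e2]
    congr 1
    linear_combination h1 - h2
  refine le_of_mul_le_mul_right ?_ hXY
  rw [e]
  calc |k| * (x + y) * |x - y| ≤ L * m * (x + y) * |x - y| := by gcongr
    _ = L * |x - y| * (m * x + m * y) := by ring
    _ ≤ L * |x - y| * (X + Y) := by gcongr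

theorem exists_lipschitz_sqrt_discrim {a b : ℝ} (hab : a * b ≠ 0) : ∃ L, 0 ≤ L ∧
    ∀ x y, 0 ≤ x → x ≤ 1 / 2 → 0 ≤ y → y ≤ 1 / 2 →
      |√((a - b) ^ 2 + 4 * (a * b) * x ^ 2) - √((a - b) ^ 2 + 4 * (a * b) * y ^ 2)|
        ≤ L * |x - y| := by
  set k := 4 * (a * b) with hk
  have hk0 : 0 < |k| := abs_pos.2 (mul_ne_zero four_ne_zero hab)
  have hm : 0 < √|k| := Real.sqrt_pos.2 hk0
  refine ⟨|k| / √|k|, by positivity, fun x y hx0 hx hy0 hy =>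
    abs_sqrt_sub_sqrt_le (s := Icc 0 (1 / 2)) (fun z hz => ⟨hz.1, ?_⟩) (fun z hz => ?_) hm
      (by rw [div_mul_cancel₀ _ hm.ne']) ⟨hx0, hx⟩ ⟨hy0, hy⟩⟩
  · refine Real.le_sqrt_of_sq_le ?_
    rw [mul_pow, Real.sq_sqrt hk0.le]
    have hz2 : z ^ 2 ≤ 1 / 4 := by nlinarith [hz.1, hz.2]
    rcases abs_cases k with ⟨h, h'⟩ | ⟨h, h'⟩
    · rw [h]
      nlinarith [sq_nonneg (a - b)]
    · rw [h]
      nlinarith [sq_nonneg (a - b), sq_nonneg (a + b), mul_le_mul_of_nonneg_left hz2 (neg_pos.2 h').le]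
  · exact discrim_nonneg hz.1 (hz.2.trans (by norm_num))

theorem abs_upperBranch_sub (a b x y : ℝ) : |upperBranch a b x - upperBranch a b y| =
    |√((a - b) ^ 2 + 4 * (a * b) * x ^ 2) - √((a - b) ^ 2 + 4 * (a * b) * y ^ 2)| / 2 := by
  rw [upperBranch, upperBranch, ← sub_div, abs_div, abs_two, add_sub_add_left_eq_sub]

theorem abs_lowerBranch_sub (a b x y : ℝ) : |lowerBranch a b x - lowerBranch a b y| =
    |√((a - b) ^ 2 + 4 * (a * b) * x ^ 2) - √((a - b) ^ 2 + 4 * (a * b) * y ^ 2)| / 2 := by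
  rw [lowerBranch, lowerBranch, ← sub_div, abs_div, abs_two, sub_sub_sub_cancel_left, abs_sub_comm]

theorem isBranch_upperBranch {a b : ℝ} (ha : 0 < a) (hb : 0 < b) : IsBranch (upperBranch a b) where
  lower := ⟨(a + b) / 2, by positivity, fun x hx0 _ => by
    rw [upperBranch]
    nlinarith [Real.sqrt_nonneg ((a - b) ^ 2 + 4 * (a * b) * x ^ 2)]⟩
  upper := ⟨a + b, fun x hx0 hx => by
    have h1 := upperBranch_mul_lowerBranch (a := a) (b := b) hx0 hx
    have h2 := upperBranch_add_lowerBranch a b x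
    have h3 : 0 < upperBranch a b x := by rw [upperBranch]; positivity
    have h4 : 0 ≤ a * b * (1 - x ^ 2) := mul_nonneg (by positivity) (by nlinarith)
    have h5 := nonneg_of_mul_nonneg_right (h1.symm ▸ h4) h3
    linarith⟩
  lipschitz := by
    obtain ⟨L, hL, h⟩ := exists_lipschitz_sqrt_discrim (mul_pos ha hb).ne'
    refine ⟨L / 2, by positivity, fun x y hx0 hx hy0 hy => ?_⟩
    rw [abs_upperBranch_sub]
    linarith [h x y hx0 hx hy0 hy]

/-- The product of the branches is ab(1 - x²) and the upper one is at most a + b. Since the lower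
branch vanishes at x = 1, a bound by a multiple of 1 - x is all that can be expected. -/
theorem isBranch_lowerBranch {a b : ℝ} (ha : 0 < a) (hb : 0 < b) : IsBranch (lowerBranch a b) where
  lower := ⟨a * b / (a + b), by positivity, fun x hx0 hx => by
    have h1 := upperBranch_mul_lowerBranch (a := a) (b := b) hx0 hx.le
    have h2 := upperBranch_add_lowerBranch a b x
    have h3 : 0 < upperBranch a b x := by rw [upperBranch]; positivity
    have h4 : 0 ≤ a * b * (1 - x ^ 2) := mul_nonneg (by positivity) (by nlinarith)
    have h5 := nonneg_of_mul_nonneg_right (h1.symm ▸ h4) h3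
    rw [div_mul_eq_mul_div, div_le_iff₀ (by positivity)]
    have h6 : a * b * (1 - x) ≤ a * b * (1 - x ^ 2) :=
      mul_le_mul_of_nonneg_left (by nlinarith) (by positivity)
    nlinarith⟩
  upper := ⟨(a + b) / 2, fun x _ _ => by
    linarith [lowerBranch_le_upperBranch a b x, upperBranch_add_lowerBranch a b x]⟩
  lipschitz := by
    obtain ⟨L, hL, h⟩ := exists_lipschitz_sqrt_discrim (mul_pos ha hb).ne'
    refine ⟨L / 2, by positivity, fun x y hx0 hx hy0 hy => ?_⟩
    rw [abs_lowerBranch_sub]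
    linarith [h x y hx0 hx hy0 hy]

theorem lowerBranch_neg {a b x : ℝ} (ha : 0 < a) (hb : b < 0) (hx0 : 0 ≤ x) (hx : x < 1) :
    lowerBranch a b x < 0 := by
  have h1 := upperBranch_mul_lowerBranch (a := a) (b := b) hx0 hx.le
  have h2 := lowerBranch_le_upperBranch a b x
  have h3 : a * b * (1 - x ^ 2) < 0 := mul_neg_of_neg_of_pos (mul_neg_of_pos_of_neg ha hb)
    (by nlinarith)
  by_contra! h
  nlinarith [mul_nonneg (h.trans h2) h]

/-- The branches have product ab(1 - x²), and the lower one lies in [b, 0). Hence the upper one is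
at least a(1 - x²), and so at least a(1 - x). -/
theorem isBranch_upperBranch_of_neg {a b : ℝ} (ha : 0 < a) (hb : b < 0) :
    IsBranch (upperBranch a b) := by
  have hab := mul_neg_of_pos_of_neg ha hb
  have hup : ∀ x, 0 ≤ x → x ≤ 1 → upperBranch a b x ≤ a := fun x hx0 hx => by
    have : √((a - b) ^ 2 + 4 * (a * b) * x ^ 2) ≤ a - b := by
      refine Real.sqrt_le_iff.2 ⟨by linarith, ?_⟩
      nlinarith [mul_nonneg (neg_pos.2 hab).le (sq_nonneg x)]
    rw [upperBranch]; linarith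
  refine ⟨⟨a, ha, fun x hx0 hx => ?_⟩, ⟨a, hup⟩, ?_⟩
  · have h1 := upperBranch_mul_lowerBranch (a := a) (b := b) hx0 hx.le
    have h2 := upperBranch_add_lowerBranch a b x
    have h3 := lowerBranch_neg ha hb hx0 hx
    have h4 := hup x hx0 hx.le
    have h5 : b ≤ lowerBranch a b x := by linarith
    have h6 : 0 ≤ upperBranch a b x := by
      by_contra! h
      have : a * b * (1 - x ^ 2) < 0 := mul_neg_of_neg_of_pos hab (by nlinarith)
      nlinarith [mul_pos_of_neg_of_neg h h3]
    have h7 : a * (1 - x ^ 2) ≤ upperBranch a b x := by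
      refine le_of_mul_le_mul_right ?_ (neg_pos.2 hb)
      nlinarith [mul_le_mul_of_nonneg_left h5 h6]
    nlinarith [mul_nonneg ha.le (mul_nonneg hx0 (sub_nonneg.2 hx.le))]
  · obtain ⟨L, hL, h⟩ := exists_lipschitz_sqrt_discrim hab.ne
    refine ⟨L / 2, by positivity, fun x y hx0 hx hy0 hy => ?_⟩
    rw [abs_upperBranch_sub]
    linarith [h x y hx0 hx hy0 hy]

/-- The solutions of `(τ - a) (τ - b) = a b λ ^ (2 N)` in the positive part of `J`. -/
def solutions (J : Set ℝ) (U V : ℝ → ℝ) (a b : ℝ) (N : ℕ) : Set ℝ :=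
  {x ∈ posPart J U V | (rate U V x - a) * (rate U V x - b) = a * b * (decay U V x ^ N) ^ 2}

section

variable {J : Set ℝ} {U V : ℝ → ℝ} {e a b : ℝ}

theorem mem_solutions_iff {N : ℕ} {x : ℝ} : x ∈ solutions J U V a b N ↔ x ∈ posPart J U V ∧
    (rate U V x = upperBranch a b (|decay U V x| ^ N) ∨
      rate U V x = lowerBranch a b (|decay U V x| ^ N)) := by
  refine and_congr_right fun hx => ?_
  rw [← eq_branch_iff (by positivity)
    (pow_le_one₀ (abs_nonneg _) (abs_decay_lt_one hx.2.1 hx.2.2).le), ← abs_pow, sq_abs]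

theorem solutions_comm (N : ℕ) : solutions J U V a b N = solutions J U V b a N := by
  ext x
  refine and_congr_right fun _ => ?_
  rw [mul_comm, mul_comm b a]

/-- For τ > 0 and a, b < 0 the left-hand side exceeds ab, which bounds the right-hand side. No
largeness of `N` is involved. -/
theorem solutions_eq_empty (ha : a < 0) (hb : b < 0) (N : ℕ) : solutions J U V a b N = ∅ := by
  refine eq_empty_of_forall_notMem fun x hx => ?_
  obtain ⟨hx, h⟩ := hx
  have h1 := IsDescendingPair.rate_pos hx
  have h2 := (abs_decay_lt_one hx.2.1 hx.2.2).le
  have h3 : (decay U V x ^ N) ^ 2 ≤ 1 := by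
    rw [← sq_abs, abs_pow]
    exact pow_le_one₀ (by positivity) (pow_le_one₀ (abs_nonneg _) h2)
  nlinarith [mul_pos_of_neg_of_neg ha hb, mul_pos h1 (neg_pos.2 ha), mul_pos h1 (neg_pos.2 hb)]

/-- Only the upper branch can meet the positive rate, and it does so exactly once for large `N`. -/
theorem IsDescendingPair.solutions_eq_singleton (h : IsDescendingPair J U V e) (ha : 0 < a)
    (hb : b < 0) : ∀ᶠ N in atTop, ∃ x, solutions J U V a b N = {x} := by
  obtain ⟨x₀, -, -, C, q, -, -, -, hN⟩ := h.existsUnique (isBranch_upperBranch_of_neg ha hb)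
  filter_upwards [hN, eventually_ge_atTop 1] with N ⟨⟨x, hx, hu⟩, _⟩ hN1
  refine ⟨x, ext fun y => ?_⟩
  rw [mem_solutions_iff, mem_singleton_iff]
  constructor
  · rintro ⟨hy, hy' | hy'⟩
    · exact hu y ⟨hy, hy'⟩
    · have := lowerBranch_neg ha hb (x := |decay U V y| ^ N) (by positivity)
        (pow_lt_one₀ (abs_nonneg _) (abs_decay_lt_one hy.2.1 hy.2.2) (by omega))
      linarith [IsDescendingPair.rate_pos hy]
  · rintro rfl
    exact ⟨hx.1, .inl hx.2⟩

/-- Each branch contributes one point. The two points coincide only where the discriminant (a - b)²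
+ 4abΛ² vanishes, that is for a = b and λ = 0. -/
theorem IsDescendingPair.solutions_eq_pair (h : IsDescendingPair J U V e) (ha : 0 < a)
    (hb : 0 < b) : ∀ᶠ N in atTop, ∃ x y, solutions J U V a b N = {x, y} ∧
      (x = y → a = b ∧ decay U V x = 0) ∧ (a = b → decay U V x = 0 → decay U V y = 0 →
        x = y ∧ rate U V x = a) := by
  obtain ⟨x₀, -, -, C, q, -, -, -, hN⟩ := h.existsUnique (isBranch_upperBranch ha hb)
  obtain ⟨y₀, -, -, C', q', -, -, -, hN'⟩ := h.existsUnique (isBranch_lowerBranch ha hb)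
  filter_upwards [hN, hN', eventually_ge_atTop 1] with N ⟨⟨x, hx, hu⟩, _⟩ ⟨⟨y, hy, hv⟩, _⟩ hN1
  refine ⟨x, y, ext fun z => ?_, ?_, ?_⟩
  · rw [mem_solutions_iff, mem_insert_iff, mem_singleton_iff]
    constructor
    · rintro ⟨hz, hz' | hz'⟩
      · exact .inl (hu z ⟨hz, hz'⟩)
      · exact .inr (hv z ⟨hz, hz'⟩)
    · rintro (rfl | rfl)
      · exact ⟨hx.1, .inl hx.2⟩
      · exact ⟨hy.1, .inr hy.2⟩
  · rintro rfl
    have h1 := hx.2.symm.trans hy.2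
    have h2 : √((a - b) ^ 2 + 4 * (a * b) * (|decay U V x| ^ N) ^ 2) = 0 := by
      rw [upperBranch, lowerBranch] at h1
      linarith
    rw [Real.sqrt_eq_zero (by positivity)] at h2
    have h3 : 0 ≤ 4 * (a * b) * (|decay U V x| ^ N) ^ 2 := by positivity
    have h4 : (a - b) ^ 2 = 0 := by nlinarith [sq_nonneg (a - b)]
    have h5 : 4 * (a * b) * (|decay U V x| ^ N) ^ 2 = 0 := by linarith
    refine ⟨sub_eq_zero.1 (pow_eq_zero_iff two_ne_zero |>.1 h4), ?_⟩
    have h6 := (mul_eq_zero.1 h5).resolve_left (by positivity)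
    exact abs_eq_zero.1 (pow_eq_zero_iff (by omega) |>.1 (pow_eq_zero_iff two_ne_zero |>.1 h6))
  · rintro rfl h1 h2
    have e1 : ∀ z, decay U V z = 0 → upperBranch a a (|decay U V z| ^ N) = a ∧
        lowerBranch a a (|decay U V z| ^ N) = a := by
      intro z hz
      rw [hz, abs_zero, zero_pow (by omega), upperBranch, lowerBranch]
      simp
    have h3 := hx.2.trans (e1 x h1).1
    have h4 := hy.2.trans (e1 y h2).2
    exact ⟨h.strictAntiOn_rate.injOn hx.1 hy.1 (h3.trans h4.symm), h3⟩

/-- For a = b the branches are a(1 ± Λ). Both start from a, so both solutions are exponentially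
close to the same point, the one with τ = a. -/
theorem IsDescendingPair.abs_sub_le_of_mem_solutions (h : IsDescendingPair J U V e) (ha : 0 < a) :
    ∃ C q, 0 < C ∧ 0 < q ∧ q < 1 ∧ ∀ᶠ N in atTop, ∀ x ∈ solutions J U V a a N,
      ∀ y ∈ solutions J U V a a N, |x - y| ≤ C * q ^ N := by
  obtain ⟨x₀, hx₀, hx₀', C, q, hC, hq0, hq1, hN⟩ := h.existsUnique (isBranch_upperBranch ha ha)
  obtain ⟨y₀, hy₀, hy₀', C', q', hC', hq0', hq1', hN'⟩ :=
    h.existsUnique (isBranch_lowerBranch ha ha)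
  have hxy : x₀ = y₀ := by
    refine h.strictAntiOn_rate.injOn hx₀ hy₀ ?_
    rw [hx₀', hy₀', upperBranch, lowerBranch]
    simp
  subst hxy
  refine ⟨2 * max C C', max q q', by positivity, by positivity, max_lt hq1 hq1', ?_⟩
  filter_upwards [hN, hN'] with N ⟨_, h1⟩ ⟨_, h2⟩
  have key : ∀ x ∈ solutions J U V a a N, |x - x₀| ≤ max C C' * max q q' ^ N := by
    intro x hx
    obtain ⟨hx, hx' | hx'⟩ := mem_solutions_iff.1 hx
    · exact (h1 x hx hx').trans (mul_le_mul (le_max_left _ _)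
        (pow_le_pow_left₀ hq0.le (le_max_left _ _) _) (by positivity) (by positivity))
    · exact (h2 x hx hx').trans (mul_le_mul (le_max_right _ _)
        (pow_le_pow_left₀ hq0'.le (le_max_right _ _) _) (by positivity) (by positivity))
  intro x hx y hy
  have h3 := key x hx
  have h4 := key y hy
  rw [abs_sub_comm] at h4
  linarith [abs_sub_le x x₀ y]

end

/-! ### The quotients `(η ± c) / S` -/

/-- The quotient `(η + κ) / S`. -/
def ratio (α κ E : ℝ) : ℝ := (disc α E + κ) / solS E π

theorem contDiff_solC_pi : ContDiff ℝ 1 fun E => solC E π :=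
  (contDiff_cosSqrt.of_le (by norm_num)).comp (contDiff_id.mul contDiff_const)

theorem contDiff_solS_pi : ContDiff ℝ 1 fun E => solS E π :=
  contDiff_const.mul ((contDiff_sincSqrt.of_le (by norm_num)).comp
    (contDiff_id.mul contDiff_const))

theorem contDiff_disc (α : ℝ) : ContDiff ℝ 1 (disc α) :=
  contDiff_solC_pi.add ((contDiff_const.mul contDiff_solS_pi).div_const 4)

theorem contDiffAt_ratio {α κ E : ℝ} (hS : solS E π ≠ 0) : ContDiffAt ℝ 1 (ratio α κ) E :=
  ((contDiff_disc α).contDiffAt.add contDiffAt_const).div contDiff_solS_pi.contDiffAt hS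

theorem solC_pi_eq (E : ℝ) : solC E π = 2 * cosSqrt (E * π ^ 2 / 4) ^ 2 - 1 := by
  rw [← cosSqrt_four_mul, solC]; ring_nf

theorem solS_pi_eq (E : ℝ) :
    solS E π = π * (cosSqrt (E * π ^ 2 / 4) * sincSqrt (E * π ^ 2 / 4)) := by
  rw [cosSqrt_mul_sincSqrt, solS]; ring_nf

/-- Half-angle formulas at z = (√E π/2)²: 1 + C = 2cos², 1 - C = 2sin² and √E S = 2 sin cos turn the
quotient into a combination of cotangent and tangent, in a form that is regular across E = 0. -/
theorem ratio_eq {α κ E : ℝ} (hS : solS E π ≠ 0) : ratio α κ E = α / 4 +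
    (1 + κ) / π * (cosSqrt (E * π ^ 2 / 4) / sincSqrt (E * π ^ 2 / 4)) -
    (1 - κ) / π * (E * π ^ 2 / 4 * sincSqrt (E * π ^ 2 / 4) / cosSqrt (E * π ^ 2 / 4)) := by
  have h := solS_pi_eq E
  rw [h] at hS
  have h1 := left_ne_zero_of_mul (right_ne_zero_of_mul hS)
  have h2 := right_ne_zero_of_mul (right_ne_zero_of_mul hS)
  have h3 := cosSqrt_sq_add (E * π ^ 2 / 4)
  have hπ := Real.pi_ne_zero
  rw [ratio, disc, h, solC_pi_eq]
  generalize E * π ^ 2 / 4 = z at *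
  field_simp
  linear_combination (4 * (1 - κ)) * h3

theorem hasDerivAt_cosSqrt_div_sincSqrt {z : ℝ} (hz : sincSqrt z ≠ 0) :
    ∃ d < 0, HasDerivAt (fun z => cosSqrt z / sincSqrt z) d z :=
  ⟨_, div_neg_of_neg_of_pos (deriv_quotient_neg z) (by positivity),
    (differentiable_cosSqrt z).hasDerivAt.div (differentiable_sincSqrt z).hasDerivAt hz⟩

theorem hasDerivAt_mul_sincSqrt_div_cosSqrt {z : ℝ} (hz : cosSqrt z ≠ 0) :
    ∃ d > 0, HasDerivAt (fun z => z * sincSqrt z / cosSqrt z) d z := by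
  refine ⟨_, ?_, ((hasDerivAt_id z).mul (differentiable_sincSqrt z).hasDerivAt).div
    (hasDerivAt_cosSqrt z) hz⟩
  have h1 := two_mul_mul_deriv_sincSqrt z
  have h2 := cosSqrt_sq_add z
  have h3 := cosSqrt_mul_sincSqrt z
  have h4 := neg_one_lt_sincSqrt (4 * z)
  refine div_pos ?_ (by positivity)
  simp only [id, Pi.mul_apply]
  have : (1 * sincSqrt z + z * deriv sincSqrt z) * cosSqrt z - z * sincSqrt z * -(sincSqrt z / 2) =
      (1 + sincSqrt (4 * z)) / 2 := by
    linear_combination (1 / 2) * cosSqrt z * h1 + (1 / 2) * h2 + (1 / 2) * h3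
  rw [this]
  linarith

/-- For |κ| < 1 the weights 1 ± κ are both positive; the cotangent term decreases and the tangent
term, which is subtracted, increases. -/
theorem deriv_ratio_neg {α κ E : ℝ} (hκ : |κ| < 1) (hS : solS E π ≠ 0) :
    deriv (ratio α κ) E < 0 := by
  have h := solS_pi_eq E
  have hS' := hS
  rw [h] at hS'
  obtain ⟨d, hd, hd'⟩ :=
    hasDerivAt_cosSqrt_div_sincSqrt (right_ne_zero_of_mul (right_ne_zero_of_mul hS'))
  obtain ⟨d₁, hd₁, hd₁'⟩ :=
    hasDerivAt_mul_sincSqrt_div_cosSqrt (left_ne_zero_of_mul (right_ne_zero_of_mul hS'))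
  have hw : HasDerivAt (fun E : ℝ => E * π ^ 2 / 4) (π ^ 2 / 4) E := by
    simpa using ((hasDerivAt_id E).mul_const (π ^ 2)).div_const 4
  have key := (((hd'.comp E hw).const_mul ((1 + κ) / π)).const_add (α / 4)).sub
    ((hd₁'.comp E hw).const_mul ((1 - κ) / π))
  have hev : ratio α κ =ᶠ[nhds E] _ :=
    (contDiff_solS_pi.continuous.continuousAt.eventually_ne hS).mono fun x hx => ratio_eq hx
  rw [(key.congr_of_eventuallyEq hev).deriv]
  have hπ := Real.pi_pos
  obtain ⟨k1, k2⟩ := abs_lt.1 hκ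
  have p1 : 0 < (1 + κ) / π := div_pos (by linarith) hπ
  have p2 : 0 < (1 - κ) / π := div_pos (by linarith) hπ
  have p3 : 0 < π ^ 2 / 4 := by positivity
  nlinarith [mul_pos p1 (mul_pos (neg_pos.2 hd) p3), mul_pos p2 (mul_pos hd₁ p3)]

/-! ### Range of the quotients between the Dirichlet eigenvalues -/

/-- The intervals between the zeros of `E ↦ solS E π`. -/
def dirichletInterval (m : ℕ) : Set ℝ := {E | (0 < m → (m : ℝ) ^ 2 < E) ∧ E < (m + 1) ^ 2}

theorem dirichletInterval_zero : dirichletInterval 0 = Iio 1 := by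
  ext; simp [dirichletInterval]

theorem dirichletInterval_of_pos {m : ℕ} (hm : 0 < m) :
    dirichletInterval m = Ioo ((m : ℝ) ^ 2) ((m + 1) ^ 2) := by
  ext; simp [dirichletInterval, hm]

theorem isOpen_dirichletInterval (m : ℕ) : IsOpen (dirichletInterval m) := by
  rcases Nat.eq_zero_or_pos m with rfl | hm
  · rw [dirichletInterval_zero]; exact isOpen_Iio
  · rw [dirichletInterval_of_pos hm]; exact isOpen_Ioo

theorem ordConnected_dirichletInterval (m : ℕ) : (dirichletInterval m).OrdConnected := by
  rcases Nat.eq_zero_or_pos m with rfl | hm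
  · rw [dirichletInterval_zero]; exact ordConnected_Iio
  · rw [dirichletInterval_of_pos hm]; exact ordConnected_Ioo

theorem sq_lt_succ_sq (m : ℕ) : (m : ℝ) ^ 2 < (m + 1) ^ 2 :=
  pow_lt_pow_left₀ (lt_add_one _) m.cast_nonneg two_ne_zero

theorem mul_solS_sq (x : ℝ) : x * solS (x ^ 2) π = Real.sin (x * π) := by
  rw [← mul_sincSqrt_sq, solS, ← mul_pow]; ring

theorem solS_pos_of_nonpos {E : ℝ} (hE : E ≤ 0) : 0 < solS E π := by
  have hπ := Real.pi_pos
  refine mul_pos hπ ?_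
  rcases hE.eq_or_lt with rfl | h
  · rw [zero_mul, sincSqrt_zero]; norm_num
  · linarith [one_lt_sincSqrt (z := E * π ^ 2) (by nlinarith [sq_pos_of_pos hπ])]

theorem solS_natCast_sq {k : ℕ} (hk : 0 < k) : solS ((k : ℝ) ^ 2) π = 0 := by
  have := mul_solS_sq k
  rw [Real.sin_nat_mul_pi] at this
  exact (mul_eq_zero.1 this).resolve_left (by positivity)

theorem solC_natCast_sq (k : ℕ) : solC ((k : ℝ) ^ 2) π = (-1) ^ k := by
  rw [solC, ← mul_pow, cosSqrt_sq, Real.cos_nat_mul_pi]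

/-- For E = x² with m < x < m + 1, xS = sin(xπ) has the sign (-1)^m; for E ≤ 0, which occurs only if
m = 0, S is positive. -/
theorem neg_one_pow_mul_solS_pos {m : ℕ} {E : ℝ} (hE : E ∈ dirichletInterval m) :
    0 < (-1) ^ m * solS E π := by
  obtain ⟨h1, h2⟩ := hE
  rcases le_or_gt E 0 with h | h
  · rcases Nat.eq_zero_or_pos m with rfl | hm
    · simpa using solS_pos_of_nonpos h
    · have := h1 hm
      have : (0 : ℝ) ≤ (m : ℝ) ^ 2 := by positivity
      linarith
  obtain ⟨x, hx, rfl⟩ : ∃ x, 0 < x ∧ E = x ^ 2 := ⟨√E, Real.sqrt_pos.2 h, (Real.sq_sqrt h.le).symm⟩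
  have hxm : (m : ℝ) < x := by
    rcases Nat.eq_zero_or_pos m with rfl | hm
    · simpa using hx
    · exact lt_of_pow_lt_pow_left₀ 2 hx.le (h1 hm)
  have hxm' : x < m + 1 := lt_of_pow_lt_pow_left₀ 2 (by positivity) h2
  have hs : 0 < Real.sin (x * π - m * π) := by
    refine Real.sin_pos_of_pos_of_lt_pi ?_ ?_ <;> nlinarith [Real.pi_pos]
  rw [Real.sin_sub_nat_mul_pi, ← mul_solS_sq] at hs
  refine pos_of_mul_pos_right (a := x) ?_ hx.le
  linarith

theorem solS_ne_zero {m : ℕ} {E : ℝ} (hE : E ∈ dirichletInterval m) : solS E π ≠ 0 :=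
  right_ne_zero_of_mul (neg_one_pow_mul_solS_pos hE).ne'

theorem exists_mem_dirichletInterval {E : ℝ} (hS : solS E π ≠ 0) :
    ∃ m, E ∈ dirichletInterval m := by
  rcases le_or_gt E 0 with h | h
  · exact ⟨0, by rw [dirichletInterval_zero]; exact h.trans_lt one_pos⟩
  have h1 := Nat.floor_le (Real.sqrt_nonneg E)
  have h2 := Nat.lt_floor_add_one √E
  have h3 := Real.sq_sqrt h.le
  refine ⟨⌊√E⌋₊, fun hm => ?_, ?_⟩
  · refine (pow_lt_pow_left₀ (lt_of_le_of_ne h1 fun h4 => hS ?_) (by positivity)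
      two_ne_zero).trans_eq h3
    rw [← h3, ← h4]
    exact solS_natCast_sq hm
  · exact h3.symm.trans_lt (pow_lt_pow_left₀ h2 (Real.sqrt_nonneg E) two_ne_zero)

theorem contDiffOn_ratio (α κ : ℝ) (m : ℕ) : ContDiffOn ℝ 1 (ratio α κ) (dirichletInterval m) :=
  fun _ hE => (contDiffAt_ratio (solS_ne_zero hE)).contDiffWithinAt

theorem ratio_eq_mul_inv (α κ : ℝ) (m : ℕ) (E : ℝ) :
    ratio α κ E = (-1) ^ m * (disc α E + κ) * ((-1) ^ m * solS E π)⁻¹ := by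
  rw [ratio, mul_inv, div_eq_mul_inv]
  have : ((-1 : ℝ) ^ m) * ((-1) ^ m)⁻¹ = 1 := mul_inv_cancel₀ (by simp)
  linear_combination -(disc α E + κ) * (solS E π)⁻¹ * this

theorem tendsto_inv_solS {k m : ℕ} (hk : 0 < k) {s : Set ℝ}
    (hs : ∀ᶠ E in nhdsWithin ((k : ℝ) ^ 2) s, E ∈ dirichletInterval m) :
    Tendsto (fun E => ((-1) ^ m * solS E π)⁻¹) (nhdsWithin ((k : ℝ) ^ 2) s) atTop := by
  refine Tendsto.inv_tendsto_nhdsGT_zero (tendsto_nhdsWithin_iff.2 ⟨?_, ?_⟩)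
  · have : Continuous fun E => (-1) ^ m * solS E π :=
      continuous_const.mul contDiff_solS_pi.continuous
    have := this.tendsto ((k : ℝ) ^ 2)
    rw [solS_natCast_sq hk, mul_zero] at this
    exact this.mono_left nhdsWithin_le_nhds
  · filter_upwards [hs] with E hE using neg_one_pow_mul_solS_pos hE

theorem tendsto_disc_add (α κ : ℝ) {k : ℕ} (m : ℕ) (hk : 0 < k) (s : Set ℝ) :
    Tendsto (fun E => (-1) ^ m * (disc α E + κ)) (nhdsWithin ((k : ℝ) ^ 2) s)
      (nhds ((-1) ^ m * ((-1) ^ k + κ))) := by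
  have : Continuous fun E => (-1) ^ m * (disc α E + κ) :=
    continuous_const.mul ((contDiff_disc α).continuous.add continuous_const)
  have := this.tendsto ((k : ℝ) ^ 2)
  rw [disc, solS_natCast_sq hk, solC_natCast_sq, mul_zero, zero_div, add_zero] at this
  exact this.mono_left nhdsWithin_le_nhds

theorem abs_neg_one_pow_mul (κ : ℝ) (m : ℕ) : |(-1) ^ m * κ| = |κ| := by
  rw [abs_mul, abs_pow, abs_neg, abs_one, one_pow, one_mul]

/-- After multiplication of numerator and denominator by (-1)^m, the denominator tends to 0 from
above and the numerator to 1 + (-1)^m κ > 0. At the right end of the interval the limit of the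
numerator is -1 + (-1)^m κ < 0. -/
theorem tendsto_ratio_left {α κ : ℝ} (hκ : |κ| < 1) {m : ℕ} (hm : 0 < m) :
    Tendsto (ratio α κ) (nhdsWithin ((m : ℝ) ^ 2) (Ioi ((m : ℝ) ^ 2))) atTop := by
  rw [funext (ratio_eq_mul_inv α κ m)]
  refine Tendsto.pos_mul_atTop ?_ (tendsto_disc_add α κ m hm _) (tendsto_inv_solS hm ?_)
  · rw [← abs_neg_one_pow_mul κ m] at hκ
    rw [mul_add, ← mul_pow]
    norm_num
    linarith [(abs_lt.1 hκ).1]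
  · rw [dirichletInterval_of_pos hm]
    exact Ioo_mem_nhdsGT (sq_lt_succ_sq m)

theorem tendsto_ratio_right {α κ : ℝ} (hκ : |κ| < 1) (m : ℕ) :
    Tendsto (ratio α κ) (nhdsWithin (((m + 1 : ℕ) : ℝ) ^ 2) (Iio (((m + 1 : ℕ) : ℝ) ^ 2))) atBot := by
  rw [funext (ratio_eq_mul_inv α κ m)]
  refine Tendsto.neg_mul_atTop ?_ (tendsto_disc_add α κ m m.succ_pos _)
    (tendsto_inv_solS m.succ_pos ?_)
  · rw [← abs_neg_one_pow_mul κ m] at hκ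
    rw [mul_add, pow_succ, ← mul_assoc, ← mul_pow]
    norm_num
    linarith [(abs_lt.1 hκ).2]
  · push_cast
    rcases Nat.eq_zero_or_pos m with rfl | hm
    · rw [dirichletInterval_zero]
      norm_num
      exact self_mem_nhdsWithin
    · rw [dirichletInterval_of_pos hm]
      exact Ioo_mem_nhdsLT (sq_lt_succ_sq m)

/-- For negative E the cotangent term becomes x coth x ≥ x with x = yπ/2, and the subtracted tangent
term is nonpositive. This replaces the limit at the left end for the interval unbounded below. -/
theorem le_ratio_neg_sq {α κ y : ℝ} (hκ : |κ| < 1) (hy : 0 < y) :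
    α / 4 + (1 + κ) / 2 * y ≤ ratio α κ (-y ^ 2) := by
  obtain ⟨k1, k2⟩ := abs_lt.1 hκ
  have hπ := Real.pi_pos
  rw [ratio_eq (solS_pos_of_nonpos (by nlinarith)).ne']
  set x := y * π / 2 with hx
  have hx0 : 0 < x := by positivity
  have e : -y ^ 2 * π ^ 2 / 4 = -x ^ 2 := by rw [hx]; ring
  have hs : 0 < Real.sinh x := Real.sinh_pos_iff.2 hx0
  have hc := Real.cosh_pos x
  have e1 : sincSqrt (-x ^ 2) = Real.sinh x / x := by
    rw [eq_div_iff hx0.ne', mul_comm, mul_sincSqrt_neg_sq]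
  rw [e, e1, cosSqrt_neg_sq]
  have h1 : x ≤ Real.cosh x / (Real.sinh x / x) := by
    rw [le_div_iff₀ (by positivity), mul_div_cancel₀ _ hx0.ne']
    exact (Real.sinh_lt_cosh x).le
  have h2 : -x ^ 2 * (Real.sinh x / x) / Real.cosh x ≤ 0 :=
    div_nonpos_of_nonpos_of_nonneg (mul_nonpos_of_nonpos_of_nonneg (by nlinarith)
      (by positivity)) hc.le
  have h3 : (1 + κ) / 2 * y = (1 + κ) / π * x := by rw [hx]; field_simp
  have p1 : 0 < (1 + κ) / π := div_pos (by linarith) hπ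
  have p2 : 0 < (1 - κ) / π := div_pos (by linarith) hπ
  rw [h3]
  nlinarith [mul_le_mul_of_nonneg_left h1 p1.le, mul_nonneg_of_nonpos_of_nonpos h2
    (neg_nonpos.2 p2.le)]

theorem exists_ratio_gt {α c : ℝ} (hc : |c| < 1) (m : ℕ) (K : ℝ) :
    ∃ E ∈ dirichletInterval m, K < ratio α c E ∧ K < ratio α (-c) E := by
  have hc' : |-c| < 1 := by rwa [abs_neg]
  rcases Nat.eq_zero_or_pos m with rfl | hm
  · obtain ⟨k1, k2⟩ := abs_lt.1 hc
    obtain ⟨y, hy0, hy1, hy2⟩ : ∃ y, 0 < y ∧ K < α / 4 + (1 + c) / 2 * y ∧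
        K < α / 4 + (1 + -c) / 2 * y := by
      have t : ∀ κ : ℝ, -1 < κ → ∀ᶠ y in atTop, K < α / 4 + (1 + κ) / 2 * y := fun κ hκ =>
        (tendsto_atTop_add_const_left _ _ (tendsto_id.const_mul_atTop
          (by linarith : 0 < (1 + κ) / 2))).eventually_gt_atTop K
      exact ((eventually_gt_atTop 0).and ((t c k1).and (t (-c) (by linarith)))).exists
    refine ⟨-y ^ 2, ?_, hy1.trans_le (le_ratio_neg_sq hc hy0),
      hy2.trans_le (le_ratio_neg_sq hc' hy0)⟩
    rw [dirichletInterval_zero]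
    show -y ^ 2 < 1
    nlinarith
  · have h := (((tendsto_ratio_left (α := α) hc hm).eventually_gt_atTop K).and
      ((tendsto_ratio_left (α := α) hc' hm).eventually_gt_atTop K)).and
        (Ioo_mem_nhdsGT (sq_lt_succ_sq m))
    obtain ⟨E, ⟨h1, h2⟩, h3⟩ := h.exists
    exact ⟨E, by rwa [dirichletInterval_of_pos hm], h1, h2⟩

theorem exists_ratio_lt {α c : ℝ} (hc : |c| < 1) (m : ℕ) (K : ℝ) :
    ∃ E ∈ dirichletInterval m, ratio α c E < K ∧ ratio α (-c) E < K := by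
  have hc' : |-c| < 1 := by rwa [abs_neg]
  have h := (((tendsto_ratio_right (α := α) hc m).eventually_lt_atBot K).and
    ((tendsto_ratio_right (α := α) hc' m).eventually_lt_atBot K)).and
      (Ioo_mem_nhdsLT (by push_cast; exact sq_lt_succ_sq m : (m : ℝ) ^ 2 < ((m + 1 : ℕ) : ℝ) ^ 2))
  obtain ⟨E, ⟨h1, h2⟩, h3⟩ := h.exists
  exact ⟨E, ⟨fun _ => h3.1, by simpa using h3.2⟩, h1, h2⟩

theorem strictAntiOn_ratio {α κ : ℝ} (hκ : |κ| < 1) (m : ℕ) :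
    StrictAntiOn (ratio α κ) (dirichletInterval m) :=
  strictAntiOn_of_deriv_neg (ordConnected_dirichletInterval m).convex
    (contDiffOn_ratio α κ m).continuousOn
    fun _ hx => deriv_ratio_neg hκ (solS_ne_zero (interior_subset hx))

theorem exists_ratio_eq_zero {α κ : ℝ} (hκ : |κ| < 1) (m : ℕ) :
    ∃ z ∈ dirichletInterval m, ratio α κ z = 0 := by
  obtain ⟨x, hx, hx0, -⟩ := exists_ratio_gt (α := α) hκ m 0
  obtain ⟨y, hy, hy0, -⟩ := exists_ratio_lt (α := α) hκ m 0
  obtain ⟨z, hz, h⟩ := (ordConnected_dirichletInterval m).isPreconnected.intermediate_value hy hx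
    (contDiffOn_ratio α κ m).continuousOn ⟨hy0.le, hx0.le⟩
  exact ⟨z, hz, h⟩

/-- The points e and e' are the smaller and the larger of the zeros of the two quotients. The
reflection x ↦ -x with a change of sign turns the part where both are negative into one where both
are positive, so one counting lemma serves all gaps. -/
theorem exists_isDescendingPair {α c : ℝ} (hc : |c| < 1) (m : ℕ) : ∃ e e', e ≤ e' ∧
    IsDescendingPair (dirichletInterval m) (ratio α c) (ratio α (-c)) e ∧
    IsDescendingPair (Neg.neg ⁻¹' dirichletInterval m) (fun x => -ratio α c (-x))
      (fun x => -ratio α (-c) (-x)) (-e') := by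
  have hc' : |-c| < 1 := by rwa [abs_neg]
  obtain ⟨y, hy, hy0⟩ := exists_ratio_eq_zero (α := α) hc m
  obtain ⟨z, hz, hz0⟩ := exists_ratio_eq_zero (α := α) hc' m
  have hU := (strictAntiOn_ratio (α := α) hc m).antitoneOn
  have hV := (strictAntiOn_ratio (α := α) hc' m).antitoneOn
  have hmin : min y z ∈ dirichletInterval m := by
    rcases min_choice y z with h | h <;> rw [h] <;> assumption
  have hmax : max y z ∈ dirichletInterval m := by
    rcases max_choice y z with h | h <;> rw [h] <;> assumption
  have hd : ∀ κ : ℝ, ∀ x ∈ Neg.neg ⁻¹' dirichletInterval m,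
      HasDerivAt (fun x => -ratio α κ (-x)) (deriv (ratio α κ) (-x)) x := fun κ x hx => by
    have h := ((contDiffAt_ratio (α := α) (κ := κ) (solS_ne_zero hx)).differentiableAt
      (by norm_num)).hasDerivAt
    exact ((h.comp x (hasDerivAt_neg x)).neg).congr_deriv (by ring)
  have hcd : ∀ κ : ℝ, ContDiffOn ℝ 1 (fun x => -ratio α κ (-x))
      (Neg.neg ⁻¹' dirichletInterval m) := fun κ =>
    ((contDiffOn_ratio α κ m).comp contDiff_neg.contDiffOn fun _ hx => hx).neg
  refine ⟨min y z, max y z, min_le_max, ⟨isOpen_dirichletInterval m,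
    ordConnected_dirichletInterval m, contDiffOn_ratio _ _ m, contDiffOn_ratio _ _ m,
    fun x hx => deriv_ratio_neg hc (solS_ne_zero hx),
    fun x hx => deriv_ratio_neg hc' (solS_ne_zero hx), hmin,
    hy0.symm.trans_le (hU hmin hy (min_le_left _ _)),
    hz0.symm.trans_le (hV hmin hz (min_le_right _ _)), ?_, exists_ratio_gt hc m⟩,
    ⟨(isOpen_dirichletInterval m).preimage continuous_neg, ?_, hcd c, hcd (-c),
    fun x hx => (hd c x hx).deriv.trans_lt (deriv_ratio_neg hc (solS_ne_zero hx)),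
    fun x hx => (hd (-c) x hx).deriv.trans_lt (deriv_ratio_neg hc' (solS_ne_zero hx)),
    by rw [mem_preimage, neg_neg]; exact hmax, ?_, ?_, ?_, fun K => ?_⟩⟩
  · rcases min_choice y z with h | h <;> rw [h]
    · rw [hy0, zero_mul]
    · rw [hz0, mul_zero]
  · refine ⟨fun x hx y hy w hw => (ordConnected_dirichletInterval m).out hy hx
      ⟨neg_le_neg hw.2, neg_le_neg hw.1⟩⟩
  · rw [neg_neg, neg_nonneg]
    exact (hU hy hmax (le_max_left _ _)).trans hy0.le
  · rw [neg_neg, neg_nonneg]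
    exact (hV hz hmax (le_max_right _ _)).trans hz0.le
  · rw [neg_neg]
    rcases max_choice y z with h | h <;> rw [h]
    · rw [hy0, neg_zero, zero_mul]
    · rw [hz0, neg_zero, mul_zero]
  · obtain ⟨x, hx, h1, h2⟩ := exists_ratio_lt (α := α) hc m (-K)
    refine ⟨-x, by rwa [mem_preimage, neg_neg], ?_, ?_⟩ <;> rw [neg_neg] <;> linarith

/-! ### Gaps -/

section

variable {S : Set ℝ} {O : ℕ → Set ℝ}

/-- The gaps of `S` are the sets `O 0, O 1, …`, from the left to the right. -/
structure IsGapSequence (S : Set ℝ) (O : ℕ → Set ℝ) : Prop where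
  compl_eq : Sᶜ = ⋃ i, O i
  ordConnected : ∀ i, (O i).OrdConnected
  nonempty : ∀ i, (O i).Nonempty
  separated : ∀ i, ∃ s ∈ S, (∀ x ∈ O i, x < s) ∧ ∀ x ∈ O (i + 1), s < x

theorem IsGapSequence.exists_separating (h : IsGapSequence S O) {i j : ℕ} (hij : i < j) :
    ∃ s ∈ S, (∀ x ∈ O i, x < s) ∧ ∀ x ∈ O j, s < x := by
  induction j, hij using Nat.le_induction with
  | base => exact h.separated i
  | succ j _ ih =>
    obtain ⟨s, hs, h1, h2⟩ := ih
    obtain ⟨t, -, h3, h4⟩ := h.separated j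
    obtain ⟨x, hx⟩ := h.nonempty j
    exact ⟨s, hs, h1, fun y hy => (h2 x hx).trans ((h3 x hx).trans (h4 y hy))⟩

theorem IsGapSequence.lt (h : IsGapSequence S O) {i j : ℕ} (hij : i < j) {x y : ℝ} (hx : x ∈ O i)
    (hy : y ∈ O j) : x < y := by
  obtain ⟨s, -, h1, h2⟩ := h.exists_separating hij
  exact (h1 x hx).trans (h2 y hy)

theorem IsGapSequence.injective (h : IsGapSequence S O) : Function.Injective O := by
  intro i j hij
  by_contra hne
  obtain ⟨x, hx⟩ := h.nonempty i
  rcases lt_or_gt_of_ne hne with h1 | h1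
  · exact lt_irrefl x (h.lt h1 hx (hij ▸ hx))
  · exact lt_irrefl x (h.lt h1 (hij ▸ hx) hx)

/-- A component of the complement is an interval; if it met another `O j`, it would contain a
separating point of S. -/
theorem IsGapSequence.connectedComponentIn_eq (h : IsGapSequence S O) {i : ℕ} {x : ℝ}
    (hx : x ∈ O i) : connectedComponentIn Sᶜ x = O i := by
  have hsub : ∀ j, O j ⊆ Sᶜ := fun j => h.compl_eq ▸ subset_iUnion O j
  refine Subset.antisymm (fun y hy => ?_)
    ((h.ordConnected i).isPreconnected.subset_connectedComponentIn hx (hsub i))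
  have hoc : (connectedComponentIn Sᶜ x).OrdConnected :=
    isPreconnected_connectedComponentIn.ordConnected
  have hx' := mem_connectedComponentIn (hsub i hx)
  have hyS := connectedComponentIn_subset _ _ hy
  rw [h.compl_eq, mem_iUnion] at hyS
  obtain ⟨j, hj⟩ := hyS
  rcases lt_trichotomy i j with hij | rfl | hij
  · obtain ⟨s, hs, h1, h2⟩ := h.exists_separating hij
    exact absurd hs (connectedComponentIn_subset _ _ (hoc.out hx' hy ⟨(h1 x hx).le, (h2 y hj).le⟩))
  · exact hj
  · obtain ⟨s, hs, h1, h2⟩ := h.exists_separating hij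
    exact absurd hs (connectedComponentIn_subset _ _ (hoc.out hy hx' ⟨(h1 y hj).le, (h2 x hx).le⟩))

theorem IsGapSequence.isGap_iff (h : IsGapSequence S O) {I : Set ℝ} :
    IsGap S I ↔ ∃ i, I = O i := by
  constructor
  · rintro ⟨x, hx, rfl⟩
    rw [h.compl_eq, mem_iUnion] at hx
    obtain ⟨i, hi⟩ := hx
    exact ⟨i, h.connectedComponentIn_eq hi⟩
  · rintro ⟨i, rfl⟩
    obtain ⟨x, hx⟩ := h.nonempty i
    exact ⟨x, h.compl_eq ▸ mem_iUnion_of_mem i hx, (h.connectedComponentIn_eq hx).symm⟩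

/-- The gaps to the left of `O i` are `O 0`, …, `O (i - 1)`. Gaps are numbered from one but `O` is
indexed from zero, so parities are interchanged. -/
theorem IsGapSequence.isNthGap (h : IsGapSequence S O) {I : Set ℝ} {m : ℕ} (hI : IsNthGap S m I) :
    ∃ i, m = i + 1 ∧ I = O i := by
  obtain ⟨hg, hc⟩ := hI
  obtain ⟨i, rfl⟩ := h.isGap_iff.1 hg
  refine ⟨i, ?_, rfl⟩
  have : {J | IsGap S J ∧ J ≠ O i ∧ ∀ x ∈ J, ∀ y ∈ O i, x < y} = O '' Iio i := by
    ext J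
    simp only [h.isGap_iff]
    constructor
    · rintro ⟨⟨j, rfl⟩, h1, h2⟩
      refine ⟨j, ?_, rfl⟩
      by_contra hij
      obtain ⟨x, hx⟩ := h.nonempty i
      obtain ⟨y, hy⟩ := h.nonempty j
      rcases (not_lt.1 (show ¬ j < i from hij)).eq_or_lt with rfl | hij
      · exact h1 rfl
      · exact lt_asymm (h2 y hy x hx) (h.lt hij hx hy)
    · rintro ⟨j, hj, rfl⟩
      exact ⟨⟨j, rfl⟩, fun e => hj.ne (h.injective e), fun x hx y hy => h.lt hj hx hy⟩
  rw [this, h.injective.encard_image, ← Nat.cast_one] at hc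
  rw [show (Iio i) = ((Finset.range i : Finset ℕ) : Set ℕ) by ext; simp,
    encard_coe_eq_coe_finsetCard, Finset.card_range] at hc
  exact_mod_cast hc.symm

end

/-- The gaps of the periodic chain, from the left to the right. -/
def gapSet (α c : ℝ) (i : ℕ) : Set ℝ :=
  if Even i then {E ∈ dirichletInterval (i / 2) | 0 < ratio α c E ∧ 0 < ratio α (-c) E}
  else {E ∈ dirichletInterval (i / 2) | ratio α c E < 0 ∧ ratio α (-c) E < 0}

theorem gapSet_two_mul (α c : ℝ) (m : ℕ) : gapSet α c (2 * m) =
    posPart (dirichletInterval m) (ratio α c) (ratio α (-c)) := by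
  rw [gapSet, if_pos (even_two_mul m), Nat.mul_div_cancel_left m two_pos, posPart]

theorem gapSet_two_mul_add_one (α c : ℝ) (m : ℕ) : gapSet α c (2 * m + 1) =
    Neg.neg ⁻¹' posPart (Neg.neg ⁻¹' dirichletInterval m) (fun x => -ratio α c (-x))
      (fun x => -ratio α (-c) (-x)) := by
  rw [gapSet, if_neg (by simp), show (2 * m + 1) / 2 = m by omega]
  ext x
  simp [posPart]

theorem abs_lt_abs_disc_iff {α c E : ℝ} (hS : solS E π ≠ 0) :
    |c| < |disc α E| ↔ 0 < ratio α c E * ratio α (-c) E := by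
  have : ratio α c E * ratio α (-c) E = (disc α E ^ 2 - c ^ 2) / solS E π ^ 2 := by
    rw [ratio, ratio, div_mul_div_comm]; ring
  rw [this, ← sq_lt_sq, lt_div_iff₀ (by positivity), zero_mul, sub_pos]

theorem mem_gapSet_iff {α c E : ℝ} :
    (∃ i, E ∈ gapSet α c i) ↔ solS E π ≠ 0 ∧ |c| < |disc α E| := by
  constructor
  · rintro ⟨i, hi⟩
    rw [gapSet] at hi
    split_ifs at hi
    · have hS := solS_ne_zero hi.1
      exact ⟨hS, (abs_lt_abs_disc_iff hS).2 (mul_pos hi.2.1 hi.2.2)⟩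
    · have hS := solS_ne_zero hi.1
      exact ⟨hS, (abs_lt_abs_disc_iff hS).2 (mul_pos_of_neg_of_neg hi.2.1 hi.2.2)⟩
  · rintro ⟨hS, h⟩
    obtain ⟨m, hm⟩ := exists_mem_dirichletInterval hS
    rcases pos_and_pos_or_neg_and_neg_of_mul_pos ((abs_lt_abs_disc_iff hS).1 h) with h | h
    · exact ⟨2 * m, by rw [gapSet_two_mul]; exact ⟨hm, h⟩⟩
    · refine ⟨2 * m + 1, ?_⟩
      rw [gapSet, if_neg (by simp), show (2 * m + 1) / 2 = m by omega]
      exact ⟨hm, h⟩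

theorem abs_cos_mul_pi_lt_one {A : ℝ} (hA : ∀ m : ℤ, A ≠ m) : |Real.cos (A * π)| < 1 := by
  have h : Real.sin (A * π) ≠ 0 := fun h => by
    obtain ⟨n, hn⟩ := Real.sin_eq_zero_iff.1 h
    exact hA n (mul_right_cancel₀ Real.pi_ne_zero hn).symm
  rw [← sq_lt_one_iff_abs_lt_one]
  have := Real.sin_sq_add_cos_sq (A * π)
  have : 0 < Real.sin (A * π) ^ 2 := by positivity
  linarith

/-- The two gaps in one Dirichlet interval are separated by a zero of UV, where |η| = |c|. Gaps in
adjacent intervals are separated by the Dirichlet eigenvalue (m + 1)². -/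
theorem isGapSequence_gapSet {A : ℝ} (hA : ∀ m : ℤ, A ≠ m) (α : ℝ) :
    IsGapSequence (essentialSpectrum (periodicHamiltonian A α))
      (gapSet α (Real.cos (A * π))) := by
  have hc := abs_cos_mul_pi_lt_one hA
  set c := Real.cos (A * π) with hcdef
  choose e e' hee h1 h2 using exists_isDescendingPair (α := α) hc
  have o1 : ∀ m, gapSet α c (2 * m) = dirichletInterval m ∩ Iio (e m) := fun m => by
    rw [gapSet_two_mul]; ext x; exact (h1 m).mem_posPart_iff
  have o2 : ∀ m, gapSet α c (2 * m + 1) = dirichletInterval m ∩ Ioi (e' m) := fun m => by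
    rw [gapSet_two_mul_add_one]; ext x
    rw [mem_preimage, (h2 m).mem_posPart_iff, mem_preimage, neg_neg, neg_lt_neg_iff]
    rfl
  refine ⟨?_, fun i => ?_, fun i => ?_, fun i => ?_⟩
  · ext E
    rw [mem_compl_iff, mem_essentialSpectrum_periodic, not_or, not_le, mem_iUnion, mem_gapSet_iff]
  · rcases Nat.even_or_odd' i with ⟨m, rfl | rfl⟩
    · rw [o1]; exact (ordConnected_dirichletInterval m).inter ordConnected_Iio
    · rw [o2]; exact (ordConnected_dirichletInterval m).inter ordConnected_Ioi
  · rcases Nat.even_or_odd' i with ⟨m, rfl | rfl⟩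
    · obtain ⟨x, hx, -⟩ := (h1 m).exists_rate_gt 0
      exact ⟨x, by rwa [gapSet_two_mul]⟩
    · obtain ⟨x, hx, -⟩ := (h2 m).exists_rate_gt 0
      refine ⟨-x, ?_⟩
      rw [gapSet_two_mul_add_one, mem_preimage, neg_neg]
      exact hx
  · rcases Nat.even_or_odd' i with ⟨m, rfl | rfl⟩
    · refine ⟨e m, ?_, fun x hx => (o1 m ▸ hx).2, fun x hx => (hee m).trans_lt (o2 m ▸ hx).2⟩
      by_contra hE
      rw [mem_essentialSpectrum_periodic, not_or, not_le, ← hcdef] at hE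
      have h3 := (abs_lt_abs_disc_iff hE.1).1 hE.2
      rw [(h1 m).mul_eq] at h3
      exact lt_irrefl _ h3
    · refine ⟨((m + 1 : ℕ) : ℝ) ^ 2,
        mem_essentialSpectrum_periodic.2 (.inl (solS_natCast_sq m.succ_pos)), fun x hx => ?_,
        fun x hx => ?_⟩
      · have := (o2 m ▸ hx).1.2
        exact_mod_cast this
      · rw [show 2 * m + 1 + 1 = 2 * (m + 1) by ring, o1] at hx
        exact hx.1.1 m.succ_pos

/-! ### Multiplicities in the gaps -/

/-- The Green function of the difference operator of the periodic chain. -/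
def green (lam : ℝ) (q j : ℤ) : ℂ := (lam : ℂ) ^ (j - q).natAbs

theorem green_self (lam : ℝ) (q : ℤ) : green lam q q = 1 := by simp [green]

theorem sqSummable_green {lam : ℝ} (h : |lam| < 1) (q : ℤ) : SqSummable (green lam q) := by
  have h0 : SqSummable fun j : ℤ => (lam : ℂ) ^ j.natAbs := by
    have hs : Summable fun n : ℕ => (lam ^ 2) ^ n :=
      summable_geometric_of_lt_one (sq_nonneg _) ((sq_lt_one_iff_abs_lt_one lam).2 h)
    refine Summable.of_nat_of_neg ?_ ?_ <;>
    · refine hs.congr fun n => ?_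
      rw [← pow_mul, mul_comm, pow_mul, ← sq_abs]
      simp
  exact h0.shift (-q)

/-- Off q this is the characteristic equation for λ; at q both neighbours contribute λ, which leaves
4cλ - 4η. -/
theorem periodic_green {c η lam : ℝ} (h : c * (1 + lam ^ 2) = 2 * η * lam) (q j : ℤ) :
    2 * (c : ℂ) * (green lam q (j + 1) + green lam q (j - 1)) - 4 * η * green lam q j =
      -(2 * (2 * η - 2 * c * lam) : ℝ) * if j = q then 1 else 0 := by
  have h' : (c : ℂ) * (1 + lam ^ 2) = 2 * η * lam := by exact_mod_cast h
  obtain ⟨k, rfl⟩ : ∃ k, j = q + k := ⟨j - q, by ring⟩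
  have e1 : q + k + 1 - q = k + 1 := by ring
  have e2 : q + k - 1 - q = k - 1 := by ring
  rw [green, green, green, e1, e2, add_sub_cancel_left]
  split_ifs with hk
  · obtain rfl : k = 0 := by omega
    push_cast
    simp
    ring
  · have hk : k ≠ 0 := fun h => hk (by omega)
    rcases lt_or_gt_of_ne hk with hk | hk
    · obtain ⟨n, rfl⟩ : ∃ n : ℕ, k = -(n + 1 : ℕ) := ⟨(-k - 1).toNat, by omega⟩
      rw [show (-((n + 1 : ℕ) : ℤ) + 1).natAbs = n by omega,
        show (-((n + 1 : ℕ) : ℤ) - 1).natAbs = n + 2 by omega,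
        show (-((n + 1 : ℕ) : ℤ)).natAbs = n + 1 by omega]
      rw [mul_zero]
      linear_combination 2 * (lam : ℂ) ^ n * h'
    · obtain ⟨n, rfl⟩ : ∃ n : ℕ, k = (n + 1 : ℕ) := ⟨(k - 1).toNat, by omega⟩
      rw [show (((n + 1 : ℕ) : ℤ) + 1).natAbs = n + 2 by omega,
        show (((n + 1 : ℕ) : ℤ) - 1).natAbs = n by omega,
        show (((n + 1 : ℕ) : ℤ)).natAbs = n + 1 by omega]
      rw [mul_zero]
      linear_combination 2 * (lam : ℂ) ^ n * h'

/-- The linear map with the matrix `!![a, b; c, d]`. -/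
def pairMap (a b c d : ℂ) : ℂ × ℂ →ₗ[ℂ] ℂ × ℂ :=
  (a • LinearMap.fst ℂ ℂ ℂ + b • LinearMap.snd ℂ ℂ ℂ).prod
    (c • LinearMap.fst ℂ ℂ ℂ + d • LinearMap.snd ℂ ℂ ℂ)

theorem mem_ker_pairMap {a b c d : ℂ} {x : ℂ × ℂ} : x ∈ LinearMap.ker (pairMap a b c d) ↔
    a * x.1 + b * x.2 = 0 ∧ c * x.1 + d * x.2 = 0 := by
  simp [pairMap]

open scoped Classical in
theorem rank_ker_pairMap (a b c d : ℂ) : Module.rank ℂ (LinearMap.ker (pairMap a b c d)) =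
    if a * d = b * c then (if a = 0 ∧ b = 0 ∧ c = 0 ∧ d = 0 then 2 else 1) else 0 := by
  rw [← Module.finrank_eq_rank]
  have h2 : Module.finrank ℂ (ℂ × ℂ) = 2 := by simp
  split_ifs with h h0
  · have : LinearMap.ker (pairMap a b c d) = ⊤ := by
      rw [eq_top_iff]
      intro x _
      rw [mem_ker_pairMap]
      simp [h0]
    rw [this, finrank_top, h2]
    rfl
  · have n0 : Module.finrank ℂ (LinearMap.ker (pairMap a b c d)) ≠ 0 := fun e => by
      rw [Submodule.finrank_eq_zero] at e
      -- If the determinant vanishes, (b, -a) and (d, -c) lie in the kernel, so a trivial kernel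
      -- would make the matrix zero.
      have h3 : ((b, -a) : ℂ × ℂ) ∈ LinearMap.ker (pairMap a b c d) :=
        mem_ker_pairMap.2 ⟨by ring, by linear_combination -h⟩
      have h4 : ((d, -c) : ℂ × ℂ) ∈ LinearMap.ker (pairMap a b c d) :=
        mem_ker_pairMap.2 ⟨by linear_combination h, by ring⟩
      rw [e, Submodule.mem_bot, Prod.ext_iff] at h3 h4
      exact h0 ⟨neg_eq_zero.1 h3.2, h3.1, neg_eq_zero.1 h4.2, h4.1⟩
    have n2 : Module.finrank ℂ (LinearMap.ker (pairMap a b c d)) ≠ 2 := fun e => by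
      have e := Submodule.eq_top_of_finrank_eq (e.trans h2.symm)
      have h3 : ((1, 0) : ℂ × ℂ) ∈ LinearMap.ker (pairMap a b c d) := e ▸ trivial
      have h4 : ((0, 1) : ℂ × ℂ) ∈ LinearMap.ker (pairMap a b c d) := e ▸ trivial
      simp only [mem_ker_pairMap, mul_one, mul_zero, add_zero, zero_add] at h3 h4
      exact h0 ⟨h3.1, h4.1, h3.2, h4.2⟩
    have := (LinearMap.ker (pairMap a b c d)).finrank_le
    rw [show Module.finrank ℂ (LinearMap.ker (pairMap a b c d)) = 1 by omega]
    simp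
  · have : LinearMap.ker (pairMap a b c d) = ⊥ := by
      rw [eq_bot_iff]
      intro x hx
      obtain ⟨h3, h4⟩ := mem_ker_pairMap.1 hx
      have e1 : (a * d - b * c) * x.1 = 0 := by linear_combination d * h3 - b * h4
      have e2 : (a * d - b * c) * x.2 = 0 := by linear_combination a * h4 - c * h3
      have hd := sub_ne_zero.2 h
      exact Prod.ext ((mul_eq_zero.1 e1).resolve_left hd) ((mul_eq_zero.1 e2).resolve_left hd)
    rw [this, finrank_bot]
    simp

section

variable {A α E t lam : ℝ}

theorem jacobi_distantImpurities (γ₁ γ₂ : ℝ) (p : ℤ) (n : ℕ) (φ : ℤ → ℂ) (j : ℤ) :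
    jacobi A E (distantImpurities α γ₁ γ₂ p n) φ j =
      2 * Real.cos (A * π) * (φ (j + 1) + φ (j - 1)) - 4 * disc α E * φ j -
        solS E π * ((if j = p then γ₁ * φ p else 0) +
          (if j = p + n + 1 then γ₂ * φ (p + n + 1) else 0)) := by
  rw [jacobi, disc, distantImpurities]
  split_ifs with h1 h2 h2
  · omega
  · subst h1; push_cast; ring
  · subst h2; push_cast; ring
  · push_cast; ring

/-- The periodic difference operator maps both sides to the same multiples of the delta sequences at
the impurities, and it is injective on ℓ². -/
theorem eq_green_of_jacobi (hc : |Real.cos (A * π)| < |disc α E|) (hlam : |lam| < 1)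
    (h1 : 2 * disc α E - 2 * Real.cos (A * π) * lam = solS E π * t / 2)
    (h2 : Real.cos (A * π) * (1 + lam ^ 2) = 2 * disc α E * lam) {γ₁ γ₂ : ℝ} {p : ℤ} {n : ℕ}
    {φ : ℤ → ℂ} (hφ : SqSummable φ)
    (h : ∀ j, jacobi A E (distantImpurities α γ₁ γ₂ p n) φ j = 0) (j : ℤ) :
    t * φ j = -(γ₁ * φ p * green lam p j + γ₂ * φ (p + n + 1) * green lam (p + n + 1) j) := by
  have key := periodic_solution_unique hc (φ := fun j => t * φ j +
    (γ₁ * φ p * green lam p j + γ₂ * φ (p + n + 1) * green lam (p + n + 1) j))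
    ((hφ.const_mul _).add (((sqSummable_green hlam p).const_mul _).add
      ((sqSummable_green hlam (p + n + 1)).const_mul _))) (fun j => ?_) j
  · linear_combination key
  have e := h j
  rw [jacobi_distantImpurities] at e
  have g1 := periodic_green h2 p j
  have g2 := periodic_green h2 (p + n + 1) j
  rw [h1] at g1 g2
  have e2 : ∀ (q : ℤ) (x : ℂ), (if j = q then x else 0) = x * if j = q then 1 else 0 :=
    fun q x => by split_ifs <;> simp
  push_cast [-Complex.ofReal_cos] at g1 g2
  rw [e2 p, e2 (p + n + 1)] at e
  linear_combination t * e + γ₁ * φ p * g1 + γ₂ * φ (p + n + 1) * g2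

theorem green_distant (lam : ℝ) (p : ℤ) (n : ℕ) : green lam p (p + n + 1) = (lam : ℂ) ^ (n + 1) := by
  rw [green, show (p + n + 1 - p).natAbs = n + 1 by omega]

theorem green_distant' (lam : ℝ) (p : ℤ) (n : ℕ) :
    green lam (p + n + 1) p = (lam : ℂ) ^ (n + 1) := by
  rw [green, show (p - (p + n + 1)).natAbs = n + 1 by omega]

/-- The two linear equations say that the values of this sequence at the impurities are tx and ty,
which makes the superposition of Green functions consistent with the impurity terms. -/
theorem jacobi_green (h1 : 2 * disc α E - 2 * Real.cos (A * π) * lam = solS E π * t / 2)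
    (h2 : Real.cos (A * π) * (1 + lam ^ 2) = 2 * disc α E * lam) {γ₁ γ₂ : ℝ} {p : ℤ} {n : ℕ}
    {x y : ℂ} (hx : (t + γ₁) * x + lam ^ (n + 1) * γ₂ * y = 0)
    (hy : lam ^ (n + 1) * γ₁ * x + (t + γ₂) * y = 0) (j : ℤ) :
    jacobi A E (distantImpurities α γ₁ γ₂ p n)
      (fun j => -(γ₁ * x * green lam p j + γ₂ * y * green lam (p + n + 1) j)) j = 0 := by
  rw [jacobi_distantImpurities, green_self, green_self, green_distant, green_distant']
  have g1 := periodic_green h2 p j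
  have g2 := periodic_green h2 (p + n + 1) j
  rw [h1] at g1 g2
  have e2 : ∀ (q : ℤ) (x : ℂ), (if j = q then x else 0) = x * if j = q then 1 else 0 :=
    fun q x => by split_ifs <;> simp
  push_cast [-Complex.ofReal_cos] at g1 g2
  rw [e2 p, e2 (p + n + 1)]
  linear_combination -γ₁ * x * g1 - γ₂ * y * g2 +
    solS E π * (if j = p then 1 else 0) * γ₁ * hx +
    solS E π * (if j = p + n + 1 then 1 else 0) * γ₂ * hy

/-- Reduction of the eigenvalue problem in a gap to two linear equations. -/
theorem multiplicity_eq_rank_ker_pairMap (hS : solS E π ≠ 0)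
    (hc : |Real.cos (A * π)| < |disc α E|) (hlam : |lam| < 1) (ht : t ≠ 0)
    (h1 : 2 * disc α E - 2 * Real.cos (A * π) * lam = solS E π * t / 2)
    (h2 : Real.cos (A * π) * (1 + lam ^ 2) = 2 * disc α E * lam) (γ₁ γ₂ : ℝ) (p : ℤ) (n : ℕ) :
    multiplicity (impurityHamiltonian A α γ₁ γ₂ p n) E =
      Module.rank ℂ (LinearMap.ker (pairMap (t + γ₁) (lam ^ (n + 1) * γ₂) (lam ^ (n + 1) * γ₁)
        (t + γ₂))) := by
  rw [impurityHamiltonian, multiplicity_eq_rank]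
  have ht' : (t : ℂ) ≠ 0 := by exact_mod_cast ht
  set K := hamiltonianGraph A (distantImpurities α γ₁ γ₂ p n) ⊓ LinearMap.ker (shiftMap E)
  have key : ∀ w ∈ K, ∀ j, t * vertexValue A j w = -(γ₁ * vertexValue A p w * green lam p j +
      γ₂ * vertexValue A (p + n + 1) w * green lam (p + n + 1) j) := by
    rintro ⟨u, v⟩ ⟨hg, hk⟩ j
    obtain rfl : v = (E : ℂ) • u := mem_ker_shiftMap.1 hk
    have e := fun j => jacobi_vertexValue (w := 0) (by rwa [add_zero]) j
    simp only [add_zero, map_zero] at e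
    exact eq_green_of_jacobi hc hlam h1 h2 (sqSummable_vertexValue A (u, (E : ℂ) • u)) e j
  -- An eigenvector is sent to its values at the two impurities; the equations of the system are
  -- `key` at these vertices.
  let f : K →ₗ[ℂ] LinearMap.ker (pairMap (t + γ₁) (lam ^ (n + 1) * γ₂) (lam ^ (n + 1) * γ₁)
      (t + γ₂)) :=
    ((vertexPair A p (p + n + 1)).comp K.subtype).codRestrict _ fun w => by
      have k1 := key w w.2 p
      have k2 := key w w.2 (p + n + 1)
      rw [green_self, green_distant'] at k1
      rw [green_self, green_distant] at k2
      rw [mem_ker_pairMap]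
      constructor
      · change (t + γ₁ : ℂ) * vertexValue A p w + lam ^ (n + 1) * γ₂ *
          vertexValue A (p + n + 1) w = 0
        linear_combination k1
      · change (lam ^ (n + 1) * γ₁ : ℂ) * vertexValue A p w + (t + γ₂) *
          vertexValue A (p + n + 1) w = 0
        linear_combination k2
  refine (LinearEquiv.ofBijective f ⟨?_, ?_⟩).rank_eq
  · rw [injective_iff_map_eq_zero]
    intro w hw
    have hp : vertexValue A p w = 0 := congrArg (fun x => x.1.1) hw
    have hq : vertexValue A (p + n + 1) w = 0 := congrArg (fun x => x.1.2) hw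
    have h0 : ∀ j, vertexValue A j w = 0 := fun j => by
      have := key w w.2 j
      rw [hp, hq] at this
      simpa [ht'] using this
    obtain ⟨⟨u, v⟩, hg, hk⟩ := w
    obtain rfl : v = (E : ℂ) • u := mem_ker_shiftMap.1 hk
    obtain rfl := eq_zero_of_vertexValue hS hg h0
    ext1
    simp
  · rintro ⟨⟨x, y⟩, hxy⟩
    obtain ⟨hx, hy⟩ := mem_ker_pairMap.1 hxy
    -- The sequence built from (x, y) has the values tx and ty at the impurities, so the kernel
    -- vector is rescaled by the inverse of t.
    have hx' : ((t : ℂ) + γ₁) * ((t : ℂ)⁻¹ * x) + lam ^ (n + 1) * γ₂ * ((t : ℂ)⁻¹ * y) = 0 := by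
      linear_combination (t : ℂ)⁻¹ * hx
    have hy' : (lam ^ (n + 1) * γ₁ : ℂ) * ((t : ℂ)⁻¹ * x) + (t + γ₂) * ((t : ℂ)⁻¹ * y) = 0 := by
      linear_combination (t : ℂ)⁻¹ * hy
    obtain ⟨u, hu, hv⟩ := exists_mem_graph hS (φ := fun j =>
      -(γ₁ * ((t : ℂ)⁻¹ * x) * green lam p j +
        γ₂ * ((t : ℂ)⁻¹ * y) * green lam (p + n + 1) j))
      (by simpa using ((((sqSummable_green hlam p).const_mul _).add
        ((sqSummable_green hlam (p + n + 1)).const_mul _)).const_mul (-1))) 0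
      (fun j => (jacobi_green h1 h2 hx' hy' j).trans (map_zero _).symm)
    rw [add_zero] at hu hv
    refine ⟨⟨_, hu, mem_ker_shiftMap.2 rfl⟩, Subtype.ext (Prod.ext ?_ ?_)⟩
    · refine (hv p).trans ?_
      rw [green_self, green_distant']
      linear_combination -hx' + mul_inv_cancel_left₀ ht' x
    · refine (hv (p + n + 1)).trans ?_
      rw [green_self, green_distant]
      linear_combination -hy' + mul_inv_cancel_left₀ ht' y

open scoped Classical in
theorem multiplicity_impurityHamiltonian (hS : solS E π ≠ 0)
    (hc : |Real.cos (A * π)| < |disc α E|) (hlam : |lam| < 1) (ht : t ≠ 0)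
    (h1 : 2 * disc α E - 2 * Real.cos (A * π) * lam = solS E π * t / 2)
    (h2 : Real.cos (A * π) * (1 + lam ^ 2) = 2 * disc α E * lam) (γ₁ γ₂ : ℝ) (p : ℤ) (n : ℕ) :
    multiplicity (impurityHamiltonian A α γ₁ γ₂ p n) E =
      if (t + γ₁) * (t + γ₂) = γ₁ * γ₂ * (lam ^ (n + 1)) ^ 2 then
        (if lam = 0 ∧ γ₁ = γ₂ ∧ t = -γ₁ then 2 else 1) else 0 := by
  rw [multiplicity_eq_rank_ker_pairMap hS hc hlam ht h1 h2, rank_ker_pairMap]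
  congr 1
  · rw [eq_iff_iff]
    norm_cast
    rw [show lam ^ (n + 1) * γ₂ * (lam ^ (n + 1) * γ₁) = γ₁ * γ₂ * (lam ^ (n + 1)) ^ 2 by ring]
  · congr 1
    rw [eq_iff_iff]
    norm_cast
    constructor
    · rintro ⟨k1, k2, k3, k4⟩
      -- As t = -γ₁ is nonzero, the off-diagonal entry can vanish only through λ = 0.
      have e1 : γ₁ ≠ 0 := fun h => ht (by linarith)
      exact ⟨pow_eq_zero_iff (n.succ_ne_zero) |>.1 ((mul_eq_zero.1 k3).resolve_right e1),
        by linarith, by linarith⟩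
    · rintro ⟨rfl, rfl, rfl⟩
      simp

end

/-! ### The eigenvalues in the gaps -/

/-- With u = √U and v = √V one has (U - V)λ = (u - v)². Since S(U + V) = ±2η and S(U - V) = ±2c,
these are the relations required of the Green function. -/
theorem decay_identities {U V : ℝ → ℝ} {x : ℝ} (hU : 0 < U x) (hV : 0 < V x) :
    U x + V x - (U x - V x) * decay U V x = rate U V x / 2 ∧
      (U x - V x) * (1 + decay U V x ^ 2) = 2 * (U x + V x) * decay U V x := by
  have h1 := Real.sqrt_pos.2 hU
  have h2 := Real.sqrt_pos.2 hV
  rw [decay, rate, Real.sqrt_mul hU.le]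
  have e1 := Real.sq_sqrt hU.le
  have e2 := Real.sq_sqrt hV.le
  set u := √(U x)
  set v := √(V x)
  rw [← e1, ← e2]
  have : u + v ≠ 0 := by positivity
  constructor <;> field_simp <;> ring

theorem decay_eq_zero_iff {U V : ℝ → ℝ} {x : ℝ} (hU : 0 < U x) (hV : 0 < V x) :
    decay U V x = 0 ↔ U x = V x := by
  have h1 := Real.sqrt_pos.2 hU
  have h2 := Real.sqrt_pos.2 hV
  rw [decay, div_eq_zero_iff, or_iff_left (by positivity), sub_eq_zero, Real.sqrt_inj hU.le hV.le]

theorem ratio_add (α c : ℝ) {E : ℝ} (hS : solS E π ≠ 0) :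
    solS E π * (ratio α c E + ratio α (-c) E) = 2 * disc α E := by
  rw [ratio, ratio]; field_simp; ring

theorem ratio_sub (α c : ℝ) {E : ℝ} (hS : solS E π ≠ 0) :
    solS E π * (ratio α c E - ratio α (-c) E) = 2 * c := by
  rw [ratio, ratio]; field_simp; ring

open scoped Classical in
-- The sign s makes both quotients positive. It passes to t = sτ, which turns the determinant
-- equation into (τ - a)(τ - b) = ab λ^(2(n+1)) with a = -sγ₁ and b = -sγ₂.
theorem multiplicity_of_pos {A α E : ℝ} (hS : solS E π ≠ 0) {s : ℝ} (hs : s ^ 2 = 1)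
    {U V : ℝ → ℝ} {x : ℝ} (hU : U x = s * ratio α (Real.cos (A * π)) E)
    (hV : V x = s * ratio α (-Real.cos (A * π)) E) (hU0 : 0 < U x) (hV0 : 0 < V x)
    (γ₁ γ₂ : ℝ) (p : ℤ) (n : ℕ) : multiplicity (impurityHamiltonian A α γ₁ γ₂ p n) E =
      if (rate U V x - -s * γ₁) * (rate U V x - -s * γ₂) =
        (-s * γ₁) * (-s * γ₂) * (decay U V x ^ (n + 1)) ^ 2 then
        (if decay U V x = 0 ∧ -s * γ₁ = -s * γ₂ ∧ rate U V x = -s * γ₁ then 2 else 1) else 0 := by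
  have hs0 : s ≠ 0 := fun h => by simp [h] at hs
  have hr : 0 < rate U V x := mul_pos four_pos (Real.sqrt_pos.2 (mul_pos hU0 hV0))
  have hc : |Real.cos (A * π)| < |disc α E| := by
    rw [abs_lt_abs_disc_iff hS]
    have := mul_pos hU0 hV0
    rw [hU, hV] at this
    linear_combination this + (ratio α (Real.cos (A * π)) E * ratio α (-Real.cos (A * π)) E) * hs
  obtain ⟨i1, i2⟩ := decay_identities hU0 hV0
  have r1 := ratio_add α (Real.cos (A * π)) hS
  have r2 := ratio_sub α (Real.cos (A * π)) hS
  have eU : ratio α (Real.cos (A * π)) E = s * U x := by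
    rw [hU]; linear_combination -(ratio α (Real.cos (A * π)) E) * hs
  have eV : ratio α (-Real.cos (A * π)) E = s * V x := by
    rw [hV]; linear_combination -(ratio α (-Real.cos (A * π)) E) * hs
  rw [eU, eV] at r1 r2
  rw [multiplicity_impurityHamiltonian hS hc (abs_decay_lt_one hU0 hV0)
    (t := s * rate U V x) (mul_ne_zero hs0 hr.ne')
    (by linear_combination -r1 + decay U V x * r2 + solS E π * s * i1)
    (by linear_combination -(1 + decay U V x ^ 2) / 2 * r2 + decay U V x * r1 +
      solS E π * s / 2 * i2)]
  have k1 : ∀ a b : ℝ, (s * a = b) = (a = s * b) := fun a b => by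
    rw [eq_iff_iff]
    constructor
    · rintro rfl; linear_combination -a * hs
    · rintro rfl; linear_combination b * hs
  congr 1
  · rw [eq_iff_iff]
    constructor
    · intro h; linear_combination h + (-(rate U V x) ^ 2 - γ₁ * γ₂ * (decay U V x ^ (n + 1)) ^ 2 + γ₁ * γ₂) * hs
    · intro h; linear_combination h + (rate U V x ^ 2 + γ₁ * γ₂ * (decay U V x ^ (n + 1)) ^ 2 - γ₁ * γ₂) * hs
  · refine if_congr ?_ rfl rfl
    rw [mul_right_inj' (neg_ne_zero.2 hs0), k1, mul_neg, neg_mul]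

open scoped Classical in
/-- `f` maps the eigenvalues in the `i`-th gap to the solutions of an equation for the descending
pair `U`, `V`. -/
structure IsGapModel (A α : ℝ) (i : ℕ) (J : Set ℝ) (U V : ℝ → ℝ) (e : ℝ) (f : ℝ ≃ᵢ ℝ) : Prop where
  isDescendingPair : IsDescendingPair J U V e
  decay_eq_zero_iff : ∀ x ∈ posPart J U V, decay U V x = 0 ↔ Real.cos (A * π) = 0
  eigenvalues_inter : ∀ (γ₁ γ₂ : ℝ) (p : ℤ) (n : ℕ),
    eigenvalues (impurityHamiltonian A α γ₁ γ₂ p n) ∩ gapSet α (Real.cos (A * π)) i =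
      f ⁻¹' solutions J U V (-(-1) ^ i * γ₁) (-(-1) ^ i * γ₂) (n + 1)
  multiplicity_eq : ∀ (γ₁ γ₂ : ℝ) (p : ℤ) (n : ℕ),
    ∀ x ∈ solutions J U V (-(-1) ^ i * γ₁) (-(-1) ^ i * γ₂) (n + 1),
      multiplicity (impurityHamiltonian A α γ₁ γ₂ p n) (f.symm x) =
        if decay U V x = 0 ∧ -(-1) ^ i * γ₁ = -(-1) ^ i * γ₂ ∧ rate U V x = -(-1) ^ i * γ₁
        then 2 else 1

/-- For even i the map is the identity, for odd i the reflection; both are isometries, so counts and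
distances of eigenvalues can be read off from the model. -/
theorem exists_isGapModel {A : ℝ} (hA : ∀ m : ℤ, A ≠ m) (α : ℝ) (i : ℕ) :
    ∃ J U V e f, IsGapModel A α i J U V e f := by
  have hc := abs_cos_mul_pi_lt_one hA
  set c := Real.cos (A * π) with hcdef
  suffices H : ∀ (J : Set ℝ) (U V : ℝ → ℝ) (e : ℝ) (f : ℝ ≃ᵢ ℝ), IsDescendingPair J U V e →
      gapSet α c i = f ⁻¹' posPart J U V → (∀ x ∈ J, solS (f.symm x) π ≠ 0) →
      (∀ x, U x = (-1) ^ i * ratio α c (f.symm x)) →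
      (∀ x, V x = (-1) ^ i * ratio α (-c) (f.symm x)) →
      IsGapModel A α i J U V e f by
    obtain ⟨m, hm⟩ := Nat.even_or_odd' i
    obtain ⟨e, e', -, h1, h2⟩ := exists_isDescendingPair (α := α) hc m
    rcases hm with rfl | rfl
    · refine ⟨_, _, _, _, _, H _ _ _ e (IsometryEquiv.refl ℝ) h1 (gapSet_two_mul α c m)
        (fun x hx => solS_ne_zero hx) (fun x => ?_) (fun x => ?_)⟩ <;>
      · rw [(even_two_mul m).neg_one_pow, one_mul]; rfl
    · refine ⟨_, _, _, _, _, H _ _ _ (-e') (IsometryEquiv.neg ℝ) h2 (gapSet_two_mul_add_one α c m)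
        (fun x hx => solS_ne_zero hx) (fun x => ?_) (fun x => ?_)⟩ <;>
      · rw [(odd_two_mul_add_one m).neg_one_pow, neg_one_mul]; rfl
  intro J U V e f h hO hS hU hV
  have hs : (((-1 : ℝ)) ^ i) ^ 2 = 1 := by rw [← pow_mul, mul_comm, pow_mul]; norm_num
  have hmult := fun (γ₁ γ₂ : ℝ) (p : ℤ) (n : ℕ) (x : ℝ) (hx : x ∈ posPart J U V) =>
    multiplicity_of_pos (A := A) (hS x hx.1) hs (hU x) (hV x) hx.2.1 hx.2.2 γ₁ γ₂ p n
  refine ⟨h, fun x hx => ?_, fun γ₁ γ₂ p n => ?_, fun γ₁ γ₂ p n x hx => ?_⟩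
  · have r := ratio_sub α c (hS x hx.1)
    have hS' := hS x hx.1
    rw [decay_eq_zero_iff hx.2.1 hx.2.2, hU, hV, mul_right_inj' (fun h => by simp [h] at hs),
      ← sub_eq_zero]
    constructor
    · intro h0
      rw [h0] at r
      linarith
    · intro h0
      rw [show c = 0 from h0, mul_zero] at r
      rw [show c = 0 from h0]
      exact (mul_eq_zero.1 r).resolve_left hS'
  · rw [hO]
    ext E
    rw [mem_inter_iff, mem_preimage, mem_preimage, and_comm, solutions, mem_ofPred_eq]
    refine and_congr_right fun hE => ?_
    have := hmult γ₁ γ₂ p n (f E) hE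
    rw [f.symm_apply_apply] at this
    rw [eigenvalues, mem_ofPred_eq, this]
    split_ifs with k1 k2
    · exact iff_of_true two_ne_zero k1
    · exact iff_of_true one_ne_zero k1
    · exact iff_of_false (not_not.2 rfl) k1
  · have := hmult γ₁ γ₂ p n x hx.1
    rwa [if_pos hx.2] at this

theorem cos_mul_pi_eq_zero_iff {A : ℝ} : Real.cos (A * π) = 0 ↔ ∃ m : ℤ, A - 1 / 2 = m := by
  rw [Real.cos_eq_zero_iff]
  refine exists_congr fun m => ?_
  have hπ := Real.pi_pos
  constructor
  · intro h
    have : A = (2 * m + 1) / 2 := mul_right_cancel₀ hπ.ne' (by linarith)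
    linarith
  · intro h
    have : A = m + 1 / 2 := by linarith
    rw [this]; ring

section

variable {A α γ₁ γ₂ : ℝ} {i : ℕ}

theorem eigenvalues_inter_gapSet_eq_empty (hA : ∀ m : ℤ, A ≠ m) (h₁ : -(-1) ^ i * γ₁ < 0)
    (h₂ : -(-1) ^ i * γ₂ < 0) (p : ℤ) (n : ℕ) :
    eigenvalues (impurityHamiltonian A α γ₁ γ₂ p n) ∩ gapSet α (Real.cos (A * π)) i = ∅ := by
  obtain ⟨J, U, V, e, f, H⟩ := exists_isGapModel hA α i
  rw [H.eigenvalues_inter, solutions_eq_empty h₁ h₂, preimage_empty]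

theorem hasSimpleEigenvalues_one (hA : ∀ m : ℤ, A ≠ m) (α : ℝ) (i : ℕ) (h : γ₁ * γ₂ < 0) :
    ∀ᶠ n : ℕ in atTop, ∀ p : ℤ, HasSimpleEigenvalues (impurityHamiltonian A α γ₁ γ₂ p n)
      (gapSet α (Real.cos (A * π)) i) 1 := by
  obtain ⟨J, U, V, e, f, H⟩ := exists_isGapModel hA α i
  have hd := H.isDescendingPair
  have hs : (((-1 : ℝ)) ^ i) ^ 2 = 1 := by rw [← pow_mul, mul_comm, pow_mul]; norm_num
  set a := -(-1) ^ i * γ₁ with ha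
  set b := -(-1) ^ i * γ₂ with hb
  have hab : a * b < 0 := by
    rw [ha, hb]
    linear_combination h + γ₁ * γ₂ * hs
  have hev : ∀ᶠ N in atTop, ∃ x, solutions J U V a b N = {x} := by
    rcases mul_neg_iff.1 hab with ⟨h1, h2⟩ | ⟨h1, h2⟩
    · exact hd.solutions_eq_singleton h1 h2
    · simp_rw [solutions_comm (a := a)]
      exact hd.solutions_eq_singleton h2 h1
  -- The solution set does not involve `p`, so the threshold for `n` is uniform in the position.
  filter_upwards [(tendsto_add_atTop_nat 1).eventually hev] with n ⟨x, hx⟩ p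
  have H1 := H.eigenvalues_inter γ₁ γ₂ p n
  have H2 := H.multiplicity_eq γ₁ γ₂ p n
  rw [HasSimpleEigenvalues, H1]
  constructor
  · rw [hx, encard_preimage_of_bijective f.bijective, encard_singleton, Nat.cast_one]
  · intro E hE
    have := H2 (f E) hE
    rwa [f.symm_apply_apply, if_neg] at this
    rintro ⟨-, h, -⟩
    rw [ha, hb, h] at hab
    exact (mul_self_nonneg _).not_gt hab

theorem eventuallyTwoEigenvalues (hA : ∀ m : ℤ, A ≠ m) (α : ℝ) (h₁ : 0 < -(-1) ^ i * γ₁)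
    (h₂ : 0 < -(-1) ^ i * γ₂) :
    EventuallyTwoEigenvalues A α γ₁ γ₂ (gapSet α (Real.cos (A * π)) i) := by
  obtain ⟨J, U, V, e, f, H⟩ := exists_isGapModel hA α i
  have hd := H.isDescendingPair
  have hdec := H.decay_eq_zero_iff
  have hs : -(-1 : ℝ) ^ i ≠ 0 := by simp
  filter_upwards [(tendsto_add_atTop_nat 1).eventually (hd.solutions_eq_pair h₁ h₂)]
    with n ⟨x, y, hxy, hne, heq⟩ p
  have H1 := H.eigenvalues_inter γ₁ γ₂ p n
  have H2 := H.multiplicity_eq γ₁ γ₂ p n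
  have hx : x ∈ posPart J U V := (hxy.superset (mem_insert x {y})).1
  have hy : y ∈ posPart J U V := (hxy.superset (mem_insert_of_mem x rfl)).1
  rw [← cos_mul_pi_eq_zero_iff, ← mul_right_inj' (b := γ₁) hs]
  constructor
  · intro hn
    rw [HasSimpleEigenvalues, H1]
    constructor
    · rw [encard_preimage_of_bijective f.bijective, hxy, encard_pair]
      · rfl
      · intro h
        obtain ⟨k1, k2⟩ := hne h
        exact hn ⟨(hdec x hx).1 k2, k1⟩
    · intro E hE
      have := H2 (f E) hE
      rwa [f.symm_apply_apply, if_neg] at this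
      rintro ⟨k1, k2, -⟩
      exact hn ⟨(hdec _ hE.1).1 k1, k2⟩
  · rintro ⟨k1, k2⟩
    obtain ⟨rfl, hr⟩ := heq k2 ((hdec x hx).2 k1) ((hdec y hy).2 k1)
    rw [pair_eq_singleton] at hxy
    refine ⟨f.symm x, ?_, ?_⟩
    · rw [H1, hxy]
      ext E
      rw [mem_preimage, mem_singleton_iff, mem_singleton_iff, f.eq_symm_apply]
    · rw [H2 x (hxy ▸ mem_singleton x), if_pos ⟨(hdec x hx).2 k1, k2, hr⟩]

theorem exists_abs_sub_eigenvalues_le (hA : ∀ m : ℤ, A ≠ m) (α : ℝ) (i : ℕ) {γ : ℝ} (hγ : γ ≠ 0) :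
    ∃ C > (0 : ℝ), ∃ c > (0 : ℝ), ∀ᶠ n : ℕ in atTop, ∀ p : ℤ,
      ∀ E ∈ eigenvalues (impurityHamiltonian A α γ γ p n) ∩ gapSet α (Real.cos (A * π)) i,
      ∀ E' ∈ eigenvalues (impurityHamiltonian A α γ γ p n) ∩ gapSet α (Real.cos (A * π)) i,
        |E - E'| ≤ C * Real.exp (-c * n) := by
  obtain ⟨J, U, V, e, f, H⟩ := exists_isGapModel hA α i
  have hd := H.isDescendingPair
  have hs : -(-1 : ℝ) ^ i ≠ 0 := by simp
  rcases lt_or_gt_of_ne (mul_ne_zero hs hγ) with h | h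
  -- For this sign the gap contains no eigenvalues and any constants will do.
  · refine ⟨1, one_pos, 1, one_pos, .of_forall fun n p E hE => ?_⟩
    rw [eigenvalues_inter_gapSet_eq_empty hA h h] at hE
    exact hE.elim
  obtain ⟨C, q, hC, hq0, hq1, hN⟩ := hd.abs_sub_le_of_mem_solutions h
  -- With this rate e^(-cn) = q^n, which dominates the q^(n+1) of the model.
  refine ⟨C, hC, -Real.log q, neg_pos.2 (Real.log_neg hq0 hq1), ?_⟩
  filter_upwards [(tendsto_add_atTop_nat 1).eventually hN] with n hn p E hE E' hE'
  rw [H.eigenvalues_inter] at hE hE'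
  have h1 := hn _ hE _ hE'
  rw [← Real.dist_eq, f.dist_eq, Real.dist_eq] at h1
  refine h1.trans (mul_le_mul_of_nonneg_left ?_ hC.le)
  rw [neg_neg, mul_comm, ← Real.log_pow, Real.exp_log (by positivity)]
  exact pow_le_pow_of_le_one hq0.le hq1.le n.le_succ

end

end RingChain

end

/-! ### Assembly of the theorem -/

theorem mainTheorem11 (A α γ₁ γ₂ : ℝ) (hA : ∀ m : ℤ, A ≠ m) :
    -- the essential spectrum is not changed by the impurities
    (∀ (p : ℤ) (n : ℕ),
      RingChain.essentialSpectrum (RingChain.impurityHamiltonian A α γ₁ γ₂ p n) =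
        RingChain.essentialSpectrum (RingChain.periodicHamiltonian A α)) ∧
    -- impurities of opposite signs
    (γ₁ * γ₂ < 0 →
      ∀ I, RingChain.IsGap
          (RingChain.essentialSpectrum (RingChain.periodicHamiltonian A α)) I →
        ∀ᶠ n : ℕ in atTop, ∀ p : ℤ,
          RingChain.HasSimpleEigenvalues (RingChain.impurityHamiltonian A α γ₁ γ₂ p n) I 1) ∧
    -- positive impurities
    (0 < γ₁ → 0 < γ₂ →
      (∀ (m : ℕ) (I : Set ℝ), Even m → RingChain.IsNthGap
          (RingChain.essentialSpectrum (RingChain.periodicHamiltonian A α)) m I →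
        RingChain.EventuallyTwoEigenvalues A α γ₁ γ₂ I) ∧
      (∀ᶠ n : ℕ in atTop, ∀ (p : ℤ) (m : ℕ) (I : Set ℝ), Odd m → RingChain.IsNthGap
          (RingChain.essentialSpectrum (RingChain.periodicHamiltonian A α)) m I →
        RingChain.eigenvalues (RingChain.impurityHamiltonian A α γ₁ γ₂ p n) ∩ I = ∅)) ∧
    -- negative impurities
    (γ₁ < 0 → γ₂ < 0 →
      (∀ (m : ℕ) (I : Set ℝ), Odd m → RingChain.IsNthGap
          (RingChain.essentialSpectrum (RingChain.periodicHamiltonian A α)) m I →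
        RingChain.EventuallyTwoEigenvalues A α γ₁ γ₂ I) ∧
      (∀ᶠ n : ℕ in atTop, ∀ (p : ℤ) (m : ℕ) (I : Set ℝ), Even m → RingChain.IsNthGap
          (RingChain.essentialSpectrum (RingChain.periodicHamiltonian A α)) m I →
        RingChain.eigenvalues (RingChain.impurityHamiltonian A α γ₁ γ₂ p n) ∩ I = ∅)) ∧
    -- equal impurities: all eigenvalues in a gap are exponentially close to each other
    (γ₁ = γ₂ → γ₁ ≠ 0 →
      ∀ I, RingChain.IsGap
          (RingChain.essentialSpectrum (RingChain.periodicHamiltonian A α)) I →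
        ∃ C > (0 : ℝ), ∃ c > (0 : ℝ), ∀ᶠ n : ℕ in atTop, ∀ p : ℤ,
          ∀ E ∈ RingChain.eigenvalues (RingChain.impurityHamiltonian A α γ₁ γ₂ p n) ∩ I,
          ∀ E' ∈ RingChain.eigenvalues (RingChain.impurityHamiltonian A α γ₁ γ₂ p n) ∩ I,
            |E - E'| ≤ C * Real.exp (-c * n)) := by
  have hg := RingChain.isGapSequence_gapSet hA α
  refine ⟨fun p n => RingChain.essentialSpectrum_congr (p := p) (q := p + n + 1)
    fun j h1 h2 => by rw [RingChain.distantImpurities, if_neg h1, if_neg h2], fun h I hI => ?_,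
    fun h1 h2 => ⟨fun m I hm hI => ?_, .of_forall fun n p m I hm hI => ?_⟩,
    fun h1 h2 => ⟨fun m I hm hI => ?_, .of_forall fun n p m I hm hI => ?_⟩, ?_⟩
  · obtain ⟨i, rfl⟩ := hg.isGap_iff.1 hI
    exact RingChain.hasSimpleEigenvalues_one hA α i h
  · obtain ⟨i, rfl, rfl⟩ := hg.isNthGap hI
    -- The gap number is i + 1, so an even gap has odd i, and there a = γ₁ and b = γ₂; in the odd
    -- gaps the signs are reversed.
    have hi : (-1 : ℝ) ^ i = -1 := (Nat.not_even_iff_odd.1 (Nat.even_add_one.1 hm)).neg_one_pow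
    exact RingChain.eventuallyTwoEigenvalues hA α (by rw [hi]; linarith) (by rw [hi]; linarith)
  · obtain ⟨i, rfl, rfl⟩ := hg.isNthGap hI
    have hi : (-1 : ℝ) ^ i = 1 := (Nat.not_odd_iff_even.1 (Nat.odd_add_one.1 hm)).neg_one_pow
    exact RingChain.eigenvalues_inter_gapSet_eq_empty hA (by rw [hi]; linarith)
      (by rw [hi]; linarith) p n
  · obtain ⟨i, rfl, rfl⟩ := hg.isNthGap hI
    have hi : (-1 : ℝ) ^ i = 1 := (Nat.not_odd_iff_even.1 (Nat.odd_add_one.1 hm)).neg_one_pow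
    exact RingChain.eventuallyTwoEigenvalues hA α (by rw [hi]; linarith) (by rw [hi]; linarith)
  · obtain ⟨i, rfl, rfl⟩ := hg.isNthGap hI
    have hi : (-1 : ℝ) ^ i = -1 := (Nat.not_even_iff_odd.1 (Nat.even_add_one.1 hm)).neg_one_pow
    exact RingChain.eigenvalues_inter_gapSet_eq_empty hA (by rw [hi]; linarith)
      (by rw [hi]; linarith) p n
  · rintro rfl h I hI
    obtain ⟨i, rfl⟩ := hg.isGap_iff.1 hI
    exact RingChain.exists_abs_sub_eigenvalues_le hA α i h
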